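/- Let $n \ge 1$ and let $\Omega \subset \mathbb{R}^n$ be a bounded domain (nonempty, connected, open) with smooth boundary $\partial\Omega$. A real number $\nu$ is a Steklov eigenvalue of $\Omega$ if the problem $$\Delta f = 0 \ \text{ in } \Omega, \qquad \frac{\partial f}{\partial \eta} = \nu f \ \text{ on } \partial\Omega,$$ where $\eta$ is the outward unit normal, has a nontrivial (weak) solution, i.e. there is a nonzero $f \in H^1(\Omega)$ with $\int_\Omega \langle \nabla f, \nabla \varphi\rangle\,dx = \nu \int_{\partial\Omega} f\varphi \, d\sigma$ for all $\varphi \in C^\infty(\mathbb{R}^n)$, where $f$ on $\partial\Omega$ is understood as the trace. Then there is a smallest nonzero Steklov eigenvalue $\nu_1(\Omega)$, and it satisfies $$\nu_1(\Omega) \le \frac{1}{R},$$ where $R > 0$ is the radius of the balls in $\mathbb{R}^n$ with the same volume as $\Omega$. Moreover, $\nu_1(\Omega) = 1/R$ if and only if $\Omega$ is a ball of radius $R$. -/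

import Mathlib

open MeasureTheory Filter Topology
open scoped ContDiff ENNReal

namespace Steklov

noncomputable section

/-- `Ω` has smooth boundary: near every boundary point, `Ω` is the negativity set of a smooth
function with nonvanishing differential. -/
def HasSmoothBoundary {n : ℕ} (Ω : Set (EuclideanSpace ℝ (Fin n))) : Prop :=
  ∀ p ∈ frontier Ω, ∃ (U : Set (EuclideanSpace ℝ (Fin n))) (ρ : EuclideanSpace ℝ (Fin n) → ℝ),
    IsOpen U ∧ p ∈ U ∧ ContDiffOn ℝ ∞ ρ U ∧ (∀ x ∈ U, fderiv ℝ ρ x ≠ 0) ∧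
      ∀ x ∈ U, x ∈ Ω ↔ ρ x < 0

/-- A bounded domain (nonempty connected open set) with smooth boundary. -/
structure IsBoundedSmoothDomain {n : ℕ} (Ω : Set (EuclideanSpace ℝ (Fin n))) : Prop where
  isOpen : IsOpen Ω
  isConnected : IsConnected Ω
  isBounded : Bornology.IsBounded Ω
  smoothBoundary : HasSmoothBoundary Ω

/-- The Lebesgue measure on `Ω`. -/
def interiorMeasure {n : ℕ} (Ω : Set (EuclideanSpace ℝ (Fin n))) :
    Measure (EuclideanSpace ℝ (Fin n)) :=
  volume.restrict Ω

/-- The surface measure of `∂Ω`: the `(n-1)`-dimensional Hausdorff measure, normalised so as to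
agree with Lebesgue measure on `(n-1)`-dimensional Euclidean spaces. -/
def surfaceMeasure {n : ℕ} (Ω : Set (EuclideanSpace ℝ (Fin n))) :
    Measure (EuclideanSpace ℝ (Fin n)) :=
  (Measure.euclideanHausdorffMeasure (n - 1)).restrict (frontier Ω)

/-- `G` is a weak gradient of `u` in `Ω`. -/
def HasWeakGradient {n : ℕ} (Ω : Set (EuclideanSpace ℝ (Fin n)))
    (u : EuclideanSpace ℝ (Fin n) → ℝ)
    (G : EuclideanSpace ℝ (Fin n) → EuclideanSpace ℝ (Fin n)) : Prop :=
  ∀ φ : EuclideanSpace ℝ (Fin n) → ℝ, ContDiff ℝ ∞ φ → HasCompactSupport φ → tsupport φ ⊆ Ω →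
    ∫ x, u x • gradient φ x ∂(interiorMeasure Ω) = - ∫ x, φ x • G x ∂(interiorMeasure Ω)

/-- `u` belongs to the Sobolev space `H¹(Ω)` and has weak gradient `G`. -/
structure MemH1 {n : ℕ} (Ω : Set (EuclideanSpace ℝ (Fin n)))
    (u : EuclideanSpace ℝ (Fin n) → ℝ)
    (G : EuclideanSpace ℝ (Fin n) → EuclideanSpace ℝ (Fin n)) : Prop where
  memLp : MemLp u 2 (interiorMeasure Ω)
  memLp_grad : MemLp G 2 (interiorMeasure Ω)
  weakGradient : HasWeakGradient Ω u G

/-- `t ∈ L²(∂Ω)` is the trace on `∂Ω` of the `H¹(Ω)` function `u` with weak gradient `G`: the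
trace operator is the continuous extension to `H¹(Ω)` of the restriction to `∂Ω` of functions
which are smooth up to the boundary. -/
structure IsTrace {n : ℕ} (Ω : Set (EuclideanSpace ℝ (Fin n)))
    (u : EuclideanSpace ℝ (Fin n) → ℝ)
    (G : EuclideanSpace ℝ (Fin n) → EuclideanSpace ℝ (Fin n))
    (t : EuclideanSpace ℝ (Fin n) → ℝ) : Prop where
  memLp : MemLp t 2 (surfaceMeasure Ω)
  approx : ∃ φ : ℕ → EuclideanSpace ℝ (Fin n) → ℝ, (∀ k, ContDiff ℝ ∞ (φ k)) ∧
    Tendsto (fun k => eLpNorm (fun x => φ k x - u x) 2 (interiorMeasure Ω)) atTop (𝓝 0) ∧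
    Tendsto (fun k => eLpNorm (fun x => gradient (φ k) x - G x) 2 (interiorMeasure Ω))
      atTop (𝓝 0) ∧
    Tendsto (fun k => eLpNorm (fun x => φ k x - t x) 2 (surfaceMeasure Ω)) atTop (𝓝 0)

/-- `u` (with weak gradient `G` and trace `t`) solves the Steklov problem `Δu = 0` in `Ω`,
`∂u/∂η = ν u` on `∂Ω`, in the weak sense: `∫_Ω ⟨∇u, ∇φ⟩ = ν ∫_{∂Ω} u φ` for all smooth `φ`. -/
structure IsSteklovSolution {n : ℕ} (Ω : Set (EuclideanSpace ℝ (Fin n))) (ν : ℝ)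
    (u : EuclideanSpace ℝ (Fin n) → ℝ)
    (G : EuclideanSpace ℝ (Fin n) → EuclideanSpace ℝ (Fin n))
    (t : EuclideanSpace ℝ (Fin n) → ℝ) : Prop where
  memH1 : MemH1 Ω u G
  isTrace : IsTrace Ω u G t
  weakForm : ∀ φ : EuclideanSpace ℝ (Fin n) → ℝ, ContDiff ℝ ∞ φ →
    ∫ x, inner ℝ (G x) (gradient φ x) ∂(interiorMeasure Ω)
      = ν * ∫ x, t x * φ x ∂(surfaceMeasure Ω)

/-- `ν` is a Steklov eigenvalue of `Ω`: the Steklov problem has a solution which is not (a.e.)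
zero. -/
def IsSteklovEigenvalue {n : ℕ} (Ω : Set (EuclideanSpace ℝ (Fin n))) (ν : ℝ) : Prop :=
  ∃ u G t, IsSteklovSolution Ω ν u G t ∧ ¬ (u =ᵐ[interiorMeasure Ω] 0)

/-- The set of nonzero Steklov eigenvalues of `Ω`. -/
def nonzeroSteklovEigenvalues {n : ℕ} (Ω : Set (EuclideanSpace ℝ (Fin n))) : Set ℝ :=
  {ν : ℝ | ν ≠ 0 ∧ IsSteklovEigenvalue Ω ν}

/-- The first nonzero Steklov eigenvalue `ν₁(Ω)`. -/
def firstSteklovEigenvalue {n : ℕ} (Ω : Set (EuclideanSpace ℝ (Fin n))) : ℝ :=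
  sInf (nonzeroSteklovEigenvalues Ω)

end

end Steklov

/-!
The proof has four parts.

*Divergence theorem.* Boundary regularity enters only through outer normals in the sense of cone
conditions (`IsOuterNormalAt`), which a smooth defining function provides. Near a boundary point
with normal `e`, the frontier is, in a small ball, a Lipschitz graph of slope `τ` over the
hyperplane orthogonal to any unit vector close to `e`; projecting it to that hyperplane changes
Hausdorff measure by a factor `1 + O(τ²)`. The fundamental theorem of calculus on parallel lines
thus gives the fluxes of `f e` and of `f (e + τ w)` up to relative errors `O(τ²)`. Their difference,
divided by `τ`, is the flux of `f w` up to a relative error `O(τ)` (`exists_ball_flux`). A partition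
of unity and `τ → 0` yield the Gauss–Green formula (`integral_fderiv_eq_surface`) with respect to
the Hausdorff surface measure.

*Existence of the first eigenvalue.* The Gauss–Green formula for the fields `φ² x` and `φ² V`, with
`V` transversal to the boundary, gives a Friedrichs inequality (`exists_friedrichs`) and an
interpolation inequality for the trace (`exists_trace_interpolation`). With Rellich's theorem
(`exists_subseq_cauchy_L2`) the trace is compact relative to the energy, so the Rayleigh quotient
`∫_Ω |∇φ|² / ∫_∂Ω φ²` has a minimiser among the functions with mean zero on the boundary
(`exists_rayleigh_minimizer`). The minimum is positive because `Ω` is connected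
(`ae_const_of_tendsto`); it is an eigenvalue (`exists_pos_eigenvalue_rayleigh`), and a lower bound
for every nonzero eigenvalue (`le_of_mem_nonzeroSteklovEigenvalues`).

*Upper bound.* The coordinates centred at the barycentre `c` of `∂Ω` are admissible in the Rayleigh
quotient, and their sum gives `ν₁ ∫_∂Ω |x - c|² ≤ n |Ω|` (`exists_center_rayleigh`). On the other
hand `∫_∂Ω |x - c|² ≥ n R |Ω|`, with equality only for balls (`le_integral_norm_sub_sq`,
`eq_ball_of_integral_norm_sub_sq_le`). To see this, put `y = x - c` and integrate the divergence of
the field `2 R |y|² y / (|y|² + R²)`: the field has length at most `|y|²`, with normal component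
`|y|²` on the sphere of radius `R`, and its divergence is smaller inside the ball of radius `R` than
on the sphere, and larger outside. Moving mass from `Ω` into the ball of equal volume therefore
decreases the integral.

*The ball.* A ball of radius `R` has no eigenvalue `ν` with `0 < ν < 1 / R`
(`one_div_le_of_isSteklovEigenvalue_ball`). Let `u` be an eigenfunction with trace `t`. For a
homogeneous polynomial `p` of degree `k`, Green's identity reads `(k / R - ν) ∫ t p = ∫ u Δp`. There
is a polynomial `w` of degree less than `k` with `Δp = Δ((R² - |y|²) w)`
(`exists_polyLaplacian_ballPoly_mul`), and Green's identity for `(R² - |y|²) w` reads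
`∫ u Δp = - 2 R ∫ t w`. By induction on the degree, `t` is orthogonal to all polynomials, hence to
all continuous functions by the Stone–Weierstrass theorem, so that `t = 0`. This forces `u = 0`.
-/

namespace Steklov

open Metric Set

variable {n : ℕ}

local notation "𝔼" => EuclideanSpace ℝ (Fin n)

/-! ### Fluxes through boundary pieces that are graphs over a hyperplane -/

/-- Inside `U`, the set `Ω` lies strictly below its boundary in all directions of a cone around
`v`: travelling from a point outside `Ω` along a vector making an angle of cosine at least `τ` with
`v`, one stays away from the closure of `Ω`. For small `τ` this says that `∂Ω ∩ U` is a Lipschitz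
graph over the hyperplane orthogonal to `v`, with slope about `τ`. -/
def ConeCondition (Ω U : Set 𝔼) (v : 𝔼) (τ : ℝ) : Prop :=
  ∀ x ∈ U, ∀ y ∈ U, x ∉ Ω → x ≠ y → τ * ‖y - x‖ ≤ inner ℝ v (y - x) → y ∉ closure Ω

theorem ConeCondition.mono {Ω U U' : Set 𝔼} {v : 𝔼} {τ : ℝ} (h : ConeCondition Ω U v τ)
    (hU : U' ⊆ U) : ConeCondition Ω U' v τ :=
  fun x hx y hy => h x (hU hx) y (hU hy)

/-- Lines in the direction of a unit vector `v`, parametrised by the hyperplane orthogonal to `v`,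
disintegrate Lebesgue measure. -/
theorem measurePreserving_smul_add {v : 𝔼} (hv : ‖v‖ = 1) :
    MeasurePreserving (fun q : ℝ × (ℝ ∙ v)ᗮ => q.1 • v + (q.2 : 𝔼))
      ((volume : Measure ℝ).prod volume) volume := by
  have h1 := (Submodule.measurePreserving_measurableEquivProd (ℝ ∙ v) (0 : 𝔼)).symm
  have h2 : (Measure.euclideanHausdorffMeasure (Module.finrank ℝ 𝔼) : Measure 𝔼) = volume :=
    InnerProductSpace.euclideanHausdorffMeasure_eq_volume
  rw [h2] at h1
  have h3 := (LinearIsometryEquiv.toSpanUnitSingleton (𝕜 := ℝ) v hv).measurePreserving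
  have h4 := h1.comp (h3.prod (MeasurePreserving.id (volume : Measure (ℝ ∙ v)ᗮ)))
  have h5 : (fun q : ℝ × (ℝ ∙ v)ᗮ => q.1 • v + (q.2 : 𝔼)) =
      (Submodule.measurableEquivProd (ℝ ∙ v) (0 : 𝔼)).symm ∘
        Prod.map (LinearIsometryEquiv.toSpanUnitSingleton (𝕜 := ℝ) v hv) id := by
    funext q
    simp
  rw [h5]
  exact h4

theorem measurableEmbedding_smul_add {v : 𝔼} (hv : ‖v‖ = 1) :
    MeasurableEmbedding (fun q : ℝ × (ℝ ∙ v)ᗮ => q.1 • v + (q.2 : 𝔼)) := by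
  have h1 := (Submodule.measurableEquivProd (ℝ ∙ v) (0 : 𝔼)).symm.measurableEmbedding
  have h4 := h1.comp (((LinearIsometryEquiv.toSpanUnitSingleton (𝕜 := ℝ) v
    hv).toHomeomorph.toMeasurableEquiv.prodCongr
      (MeasurableEquiv.refl (ℝ ∙ v)ᗮ)).measurableEmbedding)
  convert h4 using 1
  funext q
  simp [MeasurableEquiv.prodCongr]

/-- Euclidean Hausdorff measure under a map which is Lipschitz on the set. -/
theorem euclideanHausdorffMeasure_image_le {X Y : Type*} [EMetricSpace X] [MeasurableSpace X]
    [BorelSpace X] [EMetricSpace Y] [MeasurableSpace Y] [BorelSpace Y] {f : X → Y} {s : Set X}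
    {K : NNReal} (h : LipschitzOnWith K f s) (d : ℕ) :
    Measure.euclideanHausdorffMeasure d (f '' s)
      ≤ (K : ℝ≥0∞) ^ d * Measure.euclideanHausdorffMeasure d s := by
  simp_rw [Measure.euclideanHausdorffMeasure_def, Measure.smul_apply]
  have := h.hausdorffMeasure_image_le (d := d) (by positivity)
  rw [ENNReal.rpow_natCast] at this
  rw [ENNReal.smul_def, ENNReal.smul_def, smul_eq_mul, smul_eq_mul, mul_left_comm]
  gcongr

/-- The fundamental theorem of calculus on an open subset `O` of the line for a function supported
in an interval `J` on which `O` is an initial segment; `B` plays the role of the boundary of `O`. -/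
theorem setIntegral_deriv_of_mem {h : ℝ → ℝ} (hh : ContDiff ℝ 1 h) (hc : HasCompactSupport h)
    {J O : Set ℝ} (hO : MeasurableSet O) (hJ : tsupport h ⊆ J) {s₀ : ℝ}
    (hlt : ∀ s ∈ J, s < s₀ → s ∈ O) (hgt : ∀ s ∈ J, s₀ ≤ s → s ∉ O) :
    ∫ s in O, deriv h s = h s₀ := by
  rw [← HasCompactSupport.integral_Iic_deriv_eq hh hc s₀, integral_Iic_eq_integral_Iio,
    ← integral_indicator hO, ← integral_indicator measurableSet_Iio]
  congr 1
  ext s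
  by_cases hs : s ∈ J
  · by_cases h1 : s < s₀
    · rw [indicator_of_mem (hlt s hs h1), indicator_of_mem (mem_Iio.2 h1)]
    · rw [indicator_of_notMem (hgt s hs (not_lt.1 h1)), indicator_of_notMem (by simpa using h1)]
  · have : deriv h s = 0 := by
      by_contra hne
      exact hs (hJ (support_deriv_subset (Function.mem_support.2 hne)))
    simp [indicator, this]

theorem integral_deriv_eq_zero {h : ℝ → ℝ} (hh : ContDiff ℝ 1 h) (hc : HasCompactSupport h) :
    ∫ s, deriv h s = 0 := by
  have hi : Integrable (deriv h) :=
    (hh.continuous_deriv le_rfl).integrable_of_hasCompactSupport hc.deriv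
  exact integral_eq_zero_of_hasDerivAt_of_integrable
    (fun x => (hh.differentiable one_ne_zero x).hasDerivAt) hi
    (hh.continuous.integrable_of_hasCompactSupport hc)

theorem setIntegral_deriv_of_notMem {h : ℝ → ℝ} (hh : ContDiff ℝ 1 h) (hc : HasCompactSupport h)
    {J O : Set ℝ} (hO : IsOpen O) (hJc : IsPreconnected J) (hJ : tsupport h ⊆ J)
    (hd : ∀ s ∈ J, s ∉ frontier O) :
    ∫ s in O, deriv h s = 0 := by
  have h0 : ∀ s, s ∉ J → deriv h s = 0 := fun s hs => by
    by_contra hne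
    exact hs (hJ (support_deriv_subset (Function.mem_support.2 hne)))
  have hsub : J ⊆ O ∪ (closure O)ᶜ := fun s hs => by
    by_contra hne
    simp only [mem_union, mem_compl_iff, not_or, not_not] at hne
    exact hd s hs (by rw [hO.frontier_eq]; exact ⟨hne.2, hne.1⟩)
  rcases hJc.subset_or_subset hO isClosed_closure.isOpen_compl
    (disjoint_compl_right.mono_left subset_closure) hsub with h1 | h1
  · rw [← integral_deriv_eq_zero hh hc, setIntegral_eq_integral_of_forall_compl_eq_zero]
    exact fun s hs => h0 s fun h2 => hs (h1 h2)
  · rw [setIntegral_eq_zero_of_forall_eq_zero]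
    exact fun s hs => h0 s fun h2 => h1 h2 (subset_closure hs)

/-- The orthogonal projection onto the hyperplane orthogonal to `v`. -/
noncomputable def hyperplaneProj (v : 𝔼) : 𝔼 →L[ℝ] (ℝ ∙ v)ᗮ := (ℝ ∙ v)ᗮ.orthogonalProjectionOnto

theorem smul_add_hyperplaneProj {v : 𝔼} (hv : ‖v‖ = 1) (x : 𝔼) :
    (inner ℝ v x) • v + (hyperplaneProj v x : 𝔼) = x := by
  have h := Submodule.starProjection_add_starProjection_orthogonal (K := ℝ ∙ v) x
  rw [Submodule.starProjection_unit_singleton ℝ hv] at h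
  exact h

theorem norm_sq_hyperplaneProj {v : 𝔼} (hv : ‖v‖ = 1) (x : 𝔼) :
    ‖hyperplaneProj v x‖ ^ 2 = ‖x‖ ^ 2 - (inner ℝ v x) ^ 2 := by
  have h := (ℝ ∙ v).norm_sq_eq_add_norm_sq_projection x
  have h2 : ‖(ℝ ∙ v).orthogonalProjectionOnto x‖ ^ 2 = (inner ℝ v x) ^ 2 := by
    rw [← Submodule.norm_coe, ← Submodule.starProjection_apply,
      Submodule.starProjection_unit_singleton ℝ hv, norm_smul, hv, mul_one, Real.norm_eq_abs,
      sq_abs]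
  rw [h2] at h
  rw [h]
  simp [hyperplaneProj]

theorem finrank_hyperplane {v : 𝔼} (hv : ‖v‖ = 1) : Module.finrank ℝ (ℝ ∙ v)ᗮ = n - 1 := by
  have h := (ℝ ∙ v).finrank_add_finrank_orthogonal
  rw [finrank_span_singleton (by rintro rfl; simp at hv), finrank_euclideanSpace_fin] at h
  omega

theorem volume_hyperplane {v : 𝔼} (hv : ‖v‖ = 1) :
    (volume : Measure (ℝ ∙ v)ᗮ) = Measure.euclideanHausdorffMeasure (n - 1) := by
  rw [← InnerProductSpace.euclideanHausdorffMeasure_eq_volume, finrank_hyperplane hv]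

section Graph

variable {Ω : Set (EuclideanSpace ℝ (Fin n))} {p v : EuclideanSpace ℝ (Fin n)} {r τ : ℝ}

theorem norm_sub_le_of_coneCondition (hΩ : IsOpen Ω) (hv : ‖v‖ = 1) (hτ0 : 0 ≤ τ) (hτ : τ < 1)
    {U : Set 𝔼} (hc : ConeCondition Ω U v τ) {x y : 𝔼} (hx : x ∈ frontier Ω ∩ U)
    (hy : y ∈ frontier Ω ∩ U) :
    ‖x - y‖ ≤ (1 - τ ^ 2)⁻¹ * ‖hyperplaneProj v x - hyperplaneProj v y‖ := by
  have key : ∀ x y : 𝔼, x ∈ frontier Ω ∩ U → y ∈ frontier Ω ∩ U →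
      inner ℝ v (x - y) ≤ τ * ‖x - y‖ := by
    intro x y hx hy
    by_contra! h
    have hne : y ≠ x := by rintro rfl; simp at h
    rw [hΩ.frontier_eq] at hx hy
    exact hc y hy.2 x hx.2 hy.1.2 hne h.le hx.1.1
  have h1 := key x y hx hy
  have h2 := key y x hy hx
  rw [norm_sub_rev, ← neg_sub x y, inner_neg_right] at h2
  have h3 : (inner ℝ v (x - y)) ^ 2 ≤ τ ^ 2 * ‖x - y‖ ^ 2 := by
    rw [← mul_pow]; exact sq_le_sq' (by linarith) h1
  have h4 := norm_sq_hyperplaneProj hv (x - y)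
  rw [map_sub] at h4
  have hpos : 0 < 1 - τ ^ 2 := by nlinarith
  have h5 : (1 - τ ^ 2) * ‖x - y‖ ^ 2 ≤ ‖hyperplaneProj v x - hyperplaneProj v y‖ ^ 2 := by
    rw [h4]; linarith
  rw [← div_eq_inv_mul, le_div_iff₀ hpos]
  refine le_of_sq_le_sq ?_ (norm_nonneg _)
  calc (‖x - y‖ * (1 - τ ^ 2)) ^ 2 = (1 - τ ^ 2) * ((1 - τ ^ 2) * ‖x - y‖ ^ 2) := by ring
    _ ≤ 1 * ‖hyperplaneProj v x - hyperplaneProj v y‖ ^ 2 := by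
      gcongr
      nlinarith [sq_nonneg τ]
    _ = _ := one_mul _

/-- A boundary piece satisfying the cone condition, projected to the hyperplane: the projected
Hausdorff measure dominates Lebesgue measure on the shadow of the piece. -/
theorem restrict_shadow_le (hv : ‖v‖ = 1) (S : Set 𝔼) :
    (volume : Measure (ℝ ∙ v)ᗮ).restrict (hyperplaneProj v '' S) ≤
      ((Measure.euclideanHausdorffMeasure (n - 1)).restrict S).map (hyperplaneProj v) := by
  refine Measure.le_iff.2 fun A hA => ?_
  have hm : Measurable (hyperplaneProj v) := (hyperplaneProj v).continuous.measurable
  rw [Measure.map_apply hm hA, Measure.restrict_apply hA, Measure.restrict_apply (hm hA),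
    volume_hyperplane hv]
  have h1 : A ∩ hyperplaneProj v '' S = hyperplaneProj v '' (hyperplaneProj v ⁻¹' A ∩ S) := by
    rw [image_preimage_inter]
  have hl : LipschitzOnWith 1 (hyperplaneProj v) (hyperplaneProj v ⁻¹' A ∩ S) := by
    refine LipschitzWith.lipschitzOnWith (LipschitzWith.of_dist_le_mul fun x y => ?_)
    rw [dist_eq_norm, dist_eq_norm, ← map_sub, NNReal.coe_one, one_mul]
    refine abs_le_of_sq_le_sq' ?_ (norm_nonneg _) |>.2
    rw [norm_sq_hyperplaneProj hv]
    nlinarith [sq_nonneg (inner ℝ v (x - y))]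
  rw [h1]
  simpa using euclideanHausdorffMeasure_image_le hl (n - 1)

theorem map_le_smul_restrict_shadow (hΩ : IsOpen Ω) (hv : ‖v‖ = 1) (hτ0 : 0 ≤ τ) (hτ : τ < 1)
    {U : Set 𝔼} (hc : ConeCondition Ω U v τ) :
    ((Measure.euclideanHausdorffMeasure (n - 1)).restrict (frontier Ω ∩ U)).map (hyperplaneProj v) ≤
      ENNReal.ofReal (((1 - τ ^ 2)⁻¹) ^ (n - 1)) •
      (volume : Measure (ℝ ∙ v)ᗮ).restrict (hyperplaneProj v '' (frontier Ω ∩ U)) := by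
  refine Measure.le_iff.2 fun A hA => ?_
  have hm : Measurable (hyperplaneProj v) := (hyperplaneProj v).continuous.measurable
  rw [Measure.map_apply hm hA, Measure.smul_apply, Measure.restrict_apply hA,
    Measure.restrict_apply (hm hA), volume_hyperplane hv]
  set S := frontier Ω ∩ U with hSdef
  have h1 : A ∩ hyperplaneProj v '' S = hyperplaneProj v '' (hyperplaneProj v ⁻¹' A ∩ S) := by
    rw [image_preimage_inter]
  have hinj : InjOn (hyperplaneProj v) S := by
    intro x hx y hy hxy
    have := norm_sub_le_of_coneCondition hΩ hv hτ0 hτ hc hx hy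
    rw [hxy, sub_self, norm_zero, mul_zero] at this
    exact sub_eq_zero.1 (norm_le_zero_iff.1 this)
  set B := hyperplaneProj v ⁻¹' A ∩ S
  have hB : B ⊆ S := inter_subset_right
  have hleft : ∀ x ∈ B, Function.invFunOn (hyperplaneProj v) B (hyperplaneProj v x) = x :=
    fun x hx => (hinj.mono hB).leftInvOn_invFunOn hx
  have hpos : 0 < (1 - τ ^ 2)⁻¹ := inv_pos.2 (by nlinarith)
  have hl : LipschitzOnWith (Real.toNNReal (1 - τ ^ 2)⁻¹)
      (Function.invFunOn (hyperplaneProj v) B) (hyperplaneProj v '' B) := by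
    refine LipschitzOnWith.of_dist_le_mul ?_
    rintro _ ⟨x, hx, rfl⟩ _ ⟨y, hy, rfl⟩
    rw [hleft x hx, hleft y hy, dist_eq_norm, dist_eq_norm, Real.coe_toNNReal _ hpos.le]
    exact norm_sub_le_of_coneCondition hΩ hv hτ0 hτ hc (hB hx) (hB hy)
  have h2 := euclideanHausdorffMeasure_image_le hl (n - 1)
  have h3 : Function.invFunOn (hyperplaneProj v) B '' (hyperplaneProj v '' B) = B := by
    rw [image_image]
    exact (image_congr hleft).trans (image_id' B)
  rw [h3] at h2
  rw [h1, ENNReal.ofReal_pow hpos.le]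
  exact h2

end Graph

section Graph

variable {Ω : Set (EuclideanSpace ℝ (Fin n))} {p v : EuclideanSpace ℝ (Fin n)} {r τ : ℝ}

theorem surfaceMeasure_restrict {U : Set 𝔼} (hU : MeasurableSet U) :
    (surfaceMeasure Ω).restrict U =
      (Measure.euclideanHausdorffMeasure (n - 1)).restrict (frontier Ω ∩ U) := by
  rw [surfaceMeasure, Measure.restrict_restrict hU, inter_comm]

theorem surfaceMeasure_ball_lt_top (hΩ : IsOpen Ω) (hv : ‖v‖ = 1) (hτ0 : 0 ≤ τ) (hτ : τ < 1)
    (hc : ConeCondition Ω (ball p r) v τ) : surfaceMeasure Ω (ball p r) < ⊤ := by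
  have h := map_le_smul_restrict_shadow hΩ hv hτ0 hτ hc univ
  have hm : Measurable (hyperplaneProj v) := (hyperplaneProj v).continuous.measurable
  rw [Measure.map_apply hm MeasurableSet.univ, preimage_univ, Measure.restrict_apply_univ,
    Measure.smul_apply, Measure.restrict_apply_univ] at h
  rw [← Measure.restrict_apply_univ, surfaceMeasure_restrict measurableSet_ball,
    Measure.restrict_apply_univ]
  refine h.trans_lt (ENNReal.mul_lt_top ENNReal.ofReal_lt_top ?_)
  have hb : Bornology.IsBounded (hyperplaneProj v '' (frontier Ω ∩ ball p r)) :=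
    (hyperplaneProj v).lipschitz.isBounded_image (isBounded_ball.subset inter_subset_right)
  exact hb.measure_lt_top

/-- The total derivative along a line in direction `v` of a function supported in a ball where the
cone condition holds. -/
noncomputable def lineFlux (Ω : Set 𝔼) (v : 𝔼) (f : 𝔼 → ℝ) (y : (ℝ ∙ v)ᗮ) : ℝ :=
  ∫ s : ℝ, Ω.indicator (fun x => fderiv ℝ f x v) (s • v + (y : 𝔼))

theorem lineFlux_eq {f : 𝔼 → ℝ} (hf : ContDiff ℝ 1 f) (hΩ : IsOpen Ω) (y : (ℝ ∙ v)ᗮ) :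
    lineFlux Ω v f y = ∫ s in {s : ℝ | s • v + (y : 𝔼) ∈ Ω},
      deriv (fun s : ℝ => f (s • v + (y : 𝔼))) s := by
  have hcont : Continuous fun s : ℝ => s • v + (y : 𝔼) := by fun_prop
  have hO : MeasurableSet {s : ℝ | s • v + (y : 𝔼) ∈ Ω} := (hΩ.preimage hcont).measurableSet
  rw [lineFlux, ← integral_indicator hO]
  congr 1
  ext s
  have hd : HasDerivAt (fun s : ℝ => f (s • v + (y : 𝔼))) (fderiv ℝ f (s • v + (y : 𝔼)) v) s := by
    have h1 : HasDerivAt (fun s : ℝ => s • v + (y : 𝔼)) v s := by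
      simpa using ((hasDerivAt_id s).smul_const v).add_const (y : 𝔼)
    exact ((hf.differentiable one_ne_zero _).hasFDerivAt).comp_hasDerivAt s h1
  by_cases hs : s • v + (y : 𝔼) ∈ Ω
  · rw [indicator_of_mem hs, indicator_of_mem (by exact hs), hd.deriv]
  · rw [indicator_of_notMem hs, indicator_of_notMem (by exact hs)]

theorem hasCompactSupport_line {f : 𝔼 → ℝ} (hs : tsupport f ⊆ ball p r) (hv : ‖v‖ = 1)
    (y : (ℝ ∙ v)ᗮ) :
    HasCompactSupport (fun s : ℝ => f (s • v + (y : 𝔼))) ∧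
      tsupport (fun s : ℝ => f (s • v + (y : 𝔼))) ⊆ {s : ℝ | s • v + (y : 𝔼) ∈ ball p r} := by
  have hcont : Continuous fun s : ℝ => s • v + (y : 𝔼) := by fun_prop
  have hsub : tsupport (fun s : ℝ => f (s • v + (y : 𝔼))) ⊆
      {s : ℝ | s • v + (y : 𝔼) ∈ tsupport f} :=
    closure_minimal (fun s hs => subset_tsupport f hs) ((isClosed_tsupport f).preimage hcont)
  have h2 := hsub.trans fun s h => hs h
  refine ⟨?_, h2⟩
  refine Metric.isCompact_of_isClosed_isBounded (isClosed_tsupport _) ?_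
  refine Bornology.IsBounded.subset ?_ h2
  have hanti : AntilipschitzWith 1 fun s : ℝ => s • v + (y : 𝔼) := by
    refine AntilipschitzWith.of_le_mul_dist fun a b => ?_
    rw [dist_add_right, dist_eq_norm, dist_eq_norm, ← sub_smul, norm_smul, hv]
    simp
  exact hanti.isBounded_preimage isBounded_ball

/-- Along a line meeting the boundary piece, the derivative integrates to the value at the unique
boundary point. -/
theorem lineFlux_of_mem {f : 𝔼 → ℝ} (hf : ContDiff ℝ 1 f) (hΩ : IsOpen Ω) (hv : ‖v‖ = 1)
    (hτ : τ < 1) (hc : ConeCondition Ω (ball p r) v τ) (hs : tsupport f ⊆ ball p r)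
    {x : 𝔼} (hx : x ∈ frontier Ω ∩ ball p r) :
    lineFlux Ω v f (hyperplaneProj v x) = f x := by
  obtain ⟨h1, h2⟩ := hasCompactSupport_line hs hv (hyperplaneProj v x)
  have hcont : Continuous fun s : ℝ => s • v + (hyperplaneProj v x : 𝔼) := by fun_prop
  have hx' := smul_add_hyperplaneProj hv x
  set y := hyperplaneProj v x
  have hcone : ∀ s t : ℝ, s < t →
      τ * ‖(t • v + (y : 𝔼)) - (s • v + (y : 𝔼))‖ ≤
        inner ℝ v ((t • v + (y : 𝔼)) - (s • v + (y : 𝔼))) ∧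
      s • v + (y : 𝔼) ≠ t • v + (y : 𝔼) := by
    intro s t hst
    have h3 : (t • v + (y : 𝔼)) - (s • v + (y : 𝔼)) = (t - s) • v := by rw [sub_smul]; abel
    constructor
    · rw [h3, norm_smul, hv, inner_smul_right, real_inner_self_eq_norm_sq, hv, Real.norm_eq_abs,
        abs_of_pos (sub_pos.2 hst)]
      nlinarith
    · intro h4
      rw [eq_comm, ← sub_eq_zero, h3, smul_eq_zero, sub_eq_zero] at h4
      rcases h4 with h4 | h4
      · exact hst.ne' h4
      · rw [h4] at hv; simp at hv
  rw [lineFlux_eq hf hΩ]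
  refine (setIntegral_deriv_of_mem (s₀ := inner ℝ v x) (hf.comp (by fun_prop)) h1
    (hΩ.preimage hcont).measurableSet h2 ?_ ?_).trans (congrArg f hx')
  · intro s hsJ hlt
    by_contra hO
    have := hcone s _ hlt
    rw [hx'] at this
    exact hc _ hsJ _ hx.2 hO this.2 this.1 (frontier_subset_closure hx.1)
  · intro s hsJ hge hO
    have hxO : x ∉ Ω := by
      have := hx.1
      rw [hΩ.frontier_eq] at this
      exact this.2
    rcases hge.eq_or_lt with h | h
    · rw [← h] at hO
      exact hxO (by simpa [hx'] using hO)
    · have := hcone _ s h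
      rw [hx'] at this
      exact hc _ hx.2 _ hsJ hxO this.2 this.1 (subset_closure hO)

theorem lineFlux_of_notMem {f : 𝔼 → ℝ} (hf : ContDiff ℝ 1 f) (hΩ : IsOpen Ω) (hv : ‖v‖ = 1)
    (hs : tsupport f ⊆ ball p r)
    {y : (ℝ ∙ v)ᗮ} (hy : y ∉ hyperplaneProj v '' (frontier Ω ∩ ball p r)) :
    lineFlux Ω v f y = 0 := by
  obtain ⟨h1, h2⟩ := hasCompactSupport_line hs hv y
  have hcont : Continuous fun s : ℝ => s • v + (y : 𝔼) := by fun_prop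
  have hconv : Convex ℝ {s : ℝ | s • v + (y : 𝔼) ∈ ball p r} := by
    have : {s : ℝ | s • v + (y : 𝔼) ∈ ball p r} =
        (AffineMap.lineMap (y : 𝔼) (v + y)) ⁻¹' ball p r := by
      ext s; simp [AffineMap.lineMap_apply]
    rw [this]
    exact (convex_ball p r).affine_preimage _
  rw [lineFlux_eq hf hΩ]
  refine setIntegral_deriv_of_notMem (hf.comp (by fun_prop)) h1 (hΩ.preimage hcont)
    hconv.isPreconnected h2 fun s hsJ hfr => hy ⟨s • v + (y : 𝔼), ⟨?_, hsJ⟩, ?_⟩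
  · exact hcont.frontier_preimage_subset Ω hfr
  · have hv0 : hyperplaneProj v v = 0 := by
      rw [hyperplaneProj]
      simp
    have hyy : hyperplaneProj v (y : 𝔼) = y := by simp [hyperplaneProj]
    rw [map_add, map_smul, hv0, smul_zero, zero_add, hyy]

/-- **Flux through a Lipschitz graph of small slope.** If `f` is supported in a ball in which `∂Ω`
is a graph of slope `τ` over the hyperplane orthogonal to `v`, the integral of `∂f/∂v` over `Ω` is,
up to the factor `(1 - τ²)^(n-1)`, the surface integral of `f`: both are compared with the integral
of `f` against Lebesgue measure on the hyperplane. -/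
theorem flux_bounds (hΩ : IsOpen Ω) (hv : ‖v‖ = 1) (hτ0 : 0 ≤ τ) (hτ : τ < 1)
    (hc : ConeCondition Ω (ball p r) v τ) {f : 𝔼 → ℝ} (hf : ContDiff ℝ 1 f)
    (hs : tsupport f ⊆ ball p r) (h0 : ∀ x ∈ frontier Ω, 0 ≤ f x) :
    (1 - τ ^ 2) ^ (n - 1) * ∫ x, f x ∂(surfaceMeasure Ω) ≤ ∫ x in Ω, fderiv ℝ f x v ∧
      ∫ x in Ω, fderiv ℝ f x v ≤ ∫ x, f x ∂(surfaceMeasure Ω) := by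
  have hcs : HasCompactSupport f :=
    Metric.isCompact_of_isClosed_isBounded (isClosed_tsupport f) (isBounded_ball.subset hs)
  have hm : Measurable (hyperplaneProj v) := (hyperplaneProj v).continuous.measurable
  have hint : Integrable (Ω.indicator fun x => fderiv ℝ f x v) := by
    refine Integrable.indicator ?_ hΩ.measurableSet
    exact ((hf.continuous_fderiv one_ne_zero).clm_apply
      continuous_const).integrable_of_hasCompactSupport (hcs.fderiv_apply (𝕜 := ℝ) v)
  set S := frontier Ω ∩ ball p r with hSdef
  have hmp := measurePreserving_smul_add hv
  have hint2 : Integrable (fun q : ℝ × (ℝ ∙ v)ᗮ =>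
      Ω.indicator (fun x => fderiv ℝ f x v) (q.1 • v + (q.2 : 𝔼)))
      ((volume : Measure ℝ).prod volume) :=
    hmp.integrable_comp_of_integrable hint
  have hI : ∫ x in Ω, fderiv ℝ f x v = ∫ y, lineFlux Ω v f y := by
    rw [← integral_indicator hΩ.measurableSet,
      ← hmp.integral_comp (measurableEmbedding_smul_add hv), integral_prod_symm _ hint2]
    rfl
  have hFint : Integrable (lineFlux Ω v f) := hint2.integral_prod_right
  have hF0 : ∀ y, 0 ≤ lineFlux Ω v f y := by
    intro y
    by_cases hy : y ∈ hyperplaneProj v '' S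
    · obtain ⟨x, hx, rfl⟩ := hy
      rw [lineFlux_of_mem hf hΩ hv hτ hc hs hx]
      exact h0 x hx.1
    · rw [lineFlux_of_notMem hf hΩ hv hs hy]
  have hI2 : ∫ x in Ω, fderiv ℝ f x v = ∫ y in hyperplaneProj v '' S, lineFlux Ω v f y := by
    rw [hI, setIntegral_eq_integral_of_forall_compl_eq_zero]
    exact fun y hy => lineFlux_of_notMem hf hΩ hv hs hy
  have hle1 := restrict_shadow_le hv S
  have hle2 := map_le_smul_restrict_shadow hΩ hv hτ0 hτ hc
  set m := ((Measure.euclideanHausdorffMeasure (n - 1)).restrict S).map (hyperplaneProj v)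
    with hmdef
  have hFm : Integrable (lineFlux Ω v f) m :=
    (hFint.restrict.smul_measure ENNReal.ofReal_ne_top).mono_measure hle2
  have hS : ∫ x, f x ∂(surfaceMeasure Ω) = ∫ y, lineFlux Ω v f y ∂m := by
    have h1 : ∫ x, f x ∂(surfaceMeasure Ω) = ∫ x in ball p r, f x ∂(surfaceMeasure Ω) := by
      rw [setIntegral_eq_integral_of_forall_compl_eq_zero]
      exact fun x hx => image_eq_zero_of_notMem_tsupport fun h => hx (hs h)
    rw [h1, surfaceMeasure_restrict measurableSet_ball, integral_map hm.aemeasurable hFm.1]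
    exact setIntegral_congr_fun (isClosed_frontier.measurableSet.inter measurableSet_ball)
      fun x hx => (lineFlux_of_mem hf hΩ hv hτ hc hs hx).symm
  have hpos : 0 < 1 - τ ^ 2 := by nlinarith
  rw [hI2, hS]
  constructor
  · have h1 := integral_mono_measure hle2 (Eventually.of_forall hF0)
      (hFint.restrict.smul_measure ENNReal.ofReal_ne_top)
    rw [integral_smul_measure, ENNReal.toReal_ofReal (by positivity), smul_eq_mul, inv_pow,
      ← div_eq_inv_mul, le_div_iff₀ (by positivity), mul_comm] at h1
    exact h1
  · exact integral_mono_measure hle1 (Eventually.of_forall hF0) hFm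

end Graph

/-! ### Outer unit normals and the divergence theorem -/

/-- The unit vector `e` is the outer normal of `Ω` at `p`: near `p`, `Ω` lies below its boundary
in every cone around `e` of aperture less than a right angle. This formulation does not refer to a
defining function, and contains that `∂Ω` is a `C¹` hypersurface near `p` as soon as it holds at
all boundary points. -/
def IsOuterNormalAt (Ω : Set 𝔼) (p e : 𝔼) : Prop :=
  ‖e‖ = 1 ∧ ∀ τ > 0, ∃ r > 0, ConeCondition Ω (ball p r) e τ

/-- The normalised gradient of a defining function is an outer normal. -/
theorem isOuterNormalAt_of_defining {Ω U : Set 𝔼} {p : 𝔼} {ρ : 𝔼 → ℝ} (hU : IsOpen U)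
    (hp : p ∈ U) (hρ : ContDiffOn ℝ 1 ρ U) (hd : fderiv ℝ ρ p ≠ 0)
    (hΩ : ∀ x ∈ U, x ∈ Ω ↔ ρ x < 0) :
    IsOuterNormalAt Ω p (‖gradient ρ p‖⁻¹ • gradient ρ p) := by
  have hg : gradient ρ p ≠ 0 := by
    intro h
    apply hd
    rw [gradient] at h
    simpa using h
  have hm : 0 < ‖gradient ρ p‖ := norm_pos_iff.2 hg
  refine ⟨by rw [norm_smul, norm_inv, norm_norm, inv_mul_cancel₀ hm.ne'], fun τ hτ => ?_⟩
  have hat : ContDiffAt ℝ 1 ρ p := hρ.contDiffAt (hU.mem_nhds hp)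
  have hst : HasStrictFDerivAt ρ (fderiv ℝ ρ p) p := hat.hasStrictFDerivAt one_ne_zero
  set m := ‖gradient ρ p‖
  have hev := hst.isLittleO.def (c := τ * m / 2) (by positivity)
  obtain ⟨r₁, hr₁, hb₁⟩ := Metric.eventually_nhds_iff_ball.1 hev
  obtain ⟨r₂, hr₂, hb₂⟩ := Metric.isOpen_iff.1 hU p hp
  refine ⟨min r₁ r₂, lt_min hr₁ hr₂, fun x hx y hy hxΩ hne hxy => ?_⟩
  have hx1 : x ∈ ball p r₁ := ball_subset_ball (min_le_left _ _) hx
  have hy1 : y ∈ ball p r₁ := ball_subset_ball (min_le_left _ _) hy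
  have hx2 : x ∈ U := hb₂ (ball_subset_ball (min_le_right _ _) hx)
  have hy2 : y ∈ U := hb₂ (ball_subset_ball (min_le_right _ _) hy)
  have h1 := hb₁ (y, x) (by rw [← ball_prod_same]; exact ⟨hy1, hx1⟩)
  have hx0 : 0 ≤ ρ x := by
    by_contra! h
    exact hxΩ ((hΩ x hx2).2 h)
  have h2 : fderiv ℝ ρ p (y - x) = m * inner ℝ (m⁻¹ • gradient ρ p) (y - x) := by
    rw [real_inner_smul_left, gradient, InnerProductSpace.toDual_symm_apply, ← mul_assoc,
      mul_inv_cancel₀ hm.ne', one_mul]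
  have hpos : 0 < ρ y := by
    simp only [Real.norm_eq_abs] at h1
    have h3 := (abs_le.1 h1).1
    rw [h2] at h3
    have h4 : 0 < ‖y - x‖ := norm_pos_iff.2 (sub_ne_zero.2 hne.symm)
    have h5 : m * (τ * ‖y - x‖) ≤ m * inner ℝ (m⁻¹ • gradient ρ p) (y - x) := by gcongr
    have h6 : 0 < τ * m * ‖y - x‖ := by positivity
    nlinarith
  have hcont : ContinuousAt ρ y := hρ.continuousOn.continuousAt (hU.mem_nhds hy2)
  intro hcl
  rw [mem_closure_iff_frequently] at hcl
  have h7 : ∀ᶠ z in 𝓝 y, z ∉ Ω := by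
    filter_upwards [hU.mem_nhds hy2, hcont.eventually (lt_mem_nhds hpos)] with z hz hz2 hz3
    exact absurd ((hΩ z hz).1 hz3) (not_lt.2 hz2.le)
  exact hcl h7

theorem IsBoundedSmoothDomain.exists_outerNormal {Ω : Set 𝔼} (hΩ : IsBoundedSmoothDomain Ω) :
    ∃ N : 𝔼 → 𝔼, ∀ p ∈ frontier Ω, IsOuterNormalAt Ω p (N p) := by
  have h : ∀ p : 𝔼, ∃ e, p ∈ frontier Ω → IsOuterNormalAt Ω p e := by
    intro p
    by_cases hp : p ∈ frontier Ω
    · obtain ⟨U, ρ, hU, hpU, hρ, hd, hiff⟩ := hΩ.smoothBoundary p hp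
      exact ⟨_, fun _ => isOuterNormalAt_of_defining hU hpU (hρ.of_le (by simp)) (hd p hpU) hiff⟩
    · exact ⟨0, fun h => absurd h hp⟩
  choose N hN using h
  exact ⟨N, hN⟩

/-- Comparison of the cones at two boundary points: outer normals vary continuously. -/
theorem norm_sub_sq_le_of_isOuterNormalAt {Ω : Set 𝔼} (hΩ : IsOpen Ω) {p x e a : 𝔼} {r τ : ℝ}
    (he : ‖e‖ = 1) (hτ0 : 0 < τ) (hτ : τ ≤ 1 / 2) (hc : ConeCondition Ω (ball p r) e τ)
    (hx : x ∈ frontier Ω) (hxr : x ∈ ball p r) (ha : IsOuterNormalAt Ω x a) :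
    ‖e - a‖ ^ 2 ≤ 4 * τ := by
  obtain ⟨ha1, ha2⟩ := ha
  have hx' := hx
  rw [hΩ.frontier_eq] at hx'
  have key : ∀ v : 𝔼, v ≠ 0 → τ * ‖v‖ ≤ inner ℝ e v → 0 ≤ inner ℝ a v := by
    intro v hv hev
    by_contra! hneg
    have hvpos : 0 < ‖v‖ := norm_pos_iff.2 hv
    obtain ⟨r', hr', hc'⟩ := ha2 (-inner ℝ a v / ‖v‖) (by apply div_pos <;> linarith)
    have hcont : Tendsto (fun s : ℝ => x + s • v) (𝓝[>] 0) (𝓝 x) := by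
      have : Continuous fun s : ℝ => x + s • v := by fun_prop
      exact (this.tendsto' 0 x (by simp)).mono_left nhdsWithin_le_nhds
    have hev1 := hcont.eventually (isOpen_ball.mem_nhds hxr)
    have hev2 := hcont.eventually (ball_mem_nhds x hr')
    obtain ⟨s, ⟨hs1, hs2⟩, hs0⟩ := ((hev1.and hev2).and self_mem_nhdsWithin).exists
    have hs0 : 0 < s := hs0
    have hne : x ≠ x + s • v := by simp [hs0.ne', hv]
    have h1 : x + s • v ∉ closure Ω := by
      refine hc x hxr _ hs1 hx'.2 hne ?_
      rw [add_sub_cancel_left, norm_smul, inner_smul_right, Real.norm_eq_abs, abs_of_pos hs0]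
      nlinarith
    refine hc' _ hs2 x (mem_ball_self hr') (fun h => h1 (subset_closure h)) hne.symm ?_ hx'.1
    have h3 : x - (x + s • v) = -(s • v) := by abel
    rw [h3, norm_neg, norm_smul, inner_neg_right, inner_smul_right, Real.norm_eq_abs,
      abs_of_pos hs0]
    apply le_of_eq
    field_simp
  set c := inner ℝ e a with hcdef
  have hee : inner ℝ e e = (1 : ℝ) := by rw [real_inner_self_eq_norm_sq, he]; norm_num
  have haa : inner ℝ a a = (1 : ℝ) := by rw [real_inner_self_eq_norm_sq, ha1]; norm_num
  have hae : inner ℝ a e = c := real_inner_comm _ _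
  have hc1 : |c| ≤ 1 := by
    have := abs_real_inner_le_norm e a
    rwa [he, ha1, one_mul] at this
  obtain ⟨hcl, hcu⟩ := abs_le.1 hc1
  set v := (c + 2 * τ) • e - a with hvdef
  have hev : inner ℝ e v = 2 * τ := by
    rw [hvdef, inner_sub_right, inner_smul_right, hee]; linarith
  have hav : inner ℝ a v = (c + 2 * τ) * c - 1 := by
    rw [hvdef, inner_sub_right, inner_smul_right, hae, haa]
  have hvv : ‖v‖ ^ 2 = 1 - c ^ 2 + 4 * τ ^ 2 := by
    rw [← real_inner_self_eq_norm_sq, hvdef, inner_sub_left, ← hvdef, hav, real_inner_smul_left,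
      hev]
    ring
  have hv2 : ‖v‖ ≤ 2 := by
    refine le_of_sq_le_sq ?_ (by norm_num)
    rw [hvv]
    nlinarith [sq_nonneg c]
  have hv0 : v ≠ 0 := by
    intro h
    rw [h, inner_zero_right] at hev
    linarith
  have h1 := key v hv0 (by rw [hev]; nlinarith)
  rw [hav] at h1
  have hexp : ‖e - a‖ ^ 2 = 2 - 2 * c := by
    rw [norm_sub_sq_real, he, ha1, ← hcdef]; ring
  rw [hexp]
  by_cases h0 : c ≤ 0
  · nlinarith
  · nlinarith

theorem continuousOn_outerNormal {Ω : Set 𝔼} (hΩ : IsOpen Ω) {N : 𝔼 → 𝔼}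
    (hN : ∀ p ∈ frontier Ω, IsOuterNormalAt Ω p (N p)) : ContinuousOn N (frontier Ω) := by
  intro p hp
  rw [Metric.continuousWithinAt_iff]
  intro ε hε
  set τ := min (1 / 2) (ε ^ 2 / 8) with hτdef
  have hτ0 : 0 < τ := lt_min (by norm_num) (by positivity)
  obtain ⟨r, hr, hc⟩ := (hN p hp).2 τ hτ0
  refine ⟨r, hr, fun {x} hx hxr => ?_⟩
  have h := norm_sub_sq_le_of_isOuterNormalAt hΩ (hN p hp).1 hτ0 (min_le_left _ _) hc hx hxr
    (hN x hx)
  rw [dist_comm, dist_eq_norm]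
  refine lt_of_pow_lt_pow_left₀ 2 hε.le (h.trans_lt ?_)
  have : τ ≤ ε ^ 2 / 8 := min_le_right _ _
  have : 0 < ε ^ 2 := by positivity
  linarith

/-- A cone condition persists, with a larger slope, when the axis is tilted. -/
theorem ConeCondition.perturb {Ω U : Set 𝔼} {e v : 𝔼} {τ s : ℝ} (h : ConeCondition Ω U e τ)
    (hv : ‖v - e‖ ≤ s) : ConeCondition Ω U v (τ + s) := by
  intro x hx y hy hxΩ hne hle
  refine h x hx y hy hxΩ hne ?_
  have h1 : inner ℝ (v - e) (y - x) ≤ ‖v - e‖ * ‖y - x‖ := real_inner_le_norm _ _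
  rw [inner_sub_left] at h1
  nlinarith [mul_le_mul_of_nonneg_right hv (norm_nonneg (y - x))]

/-- Two-sided form of `flux_bounds`, by Bernoulli's inequality. -/
theorem flux_abs_le {Ω : Set 𝔼} (hΩ : IsOpen Ω) {p v : 𝔼} {r τ : ℝ} (hv : ‖v‖ = 1) (hτ0 : 0 ≤ τ)
    (hτ : τ < 1) (hc : ConeCondition Ω (ball p r) v τ) {f : 𝔼 → ℝ} (hf : ContDiff ℝ 1 f)
    (hs : tsupport f ⊆ ball p r) (h0 : ∀ x ∈ frontier Ω, 0 ≤ f x) :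
    |(∫ x in Ω, fderiv ℝ f x v) - ∫ x, f x ∂(surfaceMeasure Ω)|
      ≤ n * τ ^ 2 * ∫ x, f x ∂(surfaceMeasure Ω) := by
  obtain ⟨h1, h2⟩ := flux_bounds hΩ hv hτ0 hτ hc hf hs h0
  have hJ : 0 ≤ ∫ x, f x ∂(surfaceMeasure Ω) :=
    setIntegral_nonneg isClosed_frontier.measurableSet h0
  have h3 : 1 + ((n - 1 : ℕ) : ℝ) * (-τ ^ 2) ≤ (1 + -τ ^ 2) ^ (n - 1) :=
    one_add_mul_le_pow (by nlinarith) _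
  have h4 : ((n - 1 : ℕ) : ℝ) ≤ n := by exact_mod_cast Nat.sub_le n 1
  have h5 : 1 - n * τ ^ 2 ≤ (1 - τ ^ 2) ^ (n - 1) := by
    rw [← sub_eq_add_neg] at h3
    nlinarith [sq_nonneg τ]
  rw [abs_le]
  constructor
  · nlinarith
  · have : 0 ≤ n * τ ^ 2 * ∫ x, f x ∂(surfaceMeasure Ω) := by positivity
    linarith

theorem _root_.Continuous.integrableOn_of_isBounded {F : Type*} [NormedAddCommGroup F] {f : 𝔼 → F}
    (hf : Continuous f) {Ω : Set 𝔼} (hb : Bornology.IsBounded Ω) : IntegrableOn f Ω :=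
  (hf.continuousOn.integrableOn_compact hb.isCompact_closure).mono_set subset_closure

theorem integrableOn_fderiv {Ω : Set 𝔼} (hb : Bornology.IsBounded Ω) {f : 𝔼 → ℝ}
    (hf : ContDiff ℝ 1 f) (w : 𝔼) : IntegrableOn (fun x => fderiv ℝ f x w) Ω :=
  (((hf.continuous_fderiv one_ne_zero).clm_apply continuous_const).integrableOn_of_isBounded hb)

/-- Near a boundary point with outer normal `e`, the integral of `∂f/∂w` over `Ω` is `⟨e, w⟩` times
the surface integral of `f`, up to a small relative error. Fluxes in the directions `e` and
`e + τ w` are known up to an error quadratic in `τ`, since boundary pieces of slope `τ` change area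
by a factor `1 + O(τ²)` when projected; so their difference can be divided by `τ`. -/
theorem exists_ball_flux {Ω : Set 𝔼} (hΩ : IsOpen Ω) {p e : 𝔼} (he : IsOuterNormalAt Ω p e)
    {ε : ℝ} (hε : 0 < ε) :
    ∃ r > 0, ∀ f : 𝔼 → ℝ, ContDiff ℝ 1 f → tsupport f ⊆ ball p r → (∀ x ∈ frontier Ω, 0 ≤ f x) →
      ∀ w : 𝔼, |(∫ x in Ω, fderiv ℝ f x w) - inner ℝ e w * ∫ x, f x ∂(surfaceMeasure Ω)|
        ≤ ε * ‖w‖ * ∫ x, f x ∂(surfaceMeasure Ω) := by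
  obtain ⟨he1, he2⟩ := he
  -- `19 n = 2 · 3² n + n` is the sum of the errors of the two fluxes, for slopes `3 τ` and `τ`
  set τ := min (1 / 4) (ε / (19 * n + 1)) with hτdef
  have hτ0 : 0 < τ := lt_min (by norm_num) (by positivity)
  have hτ4 : τ ≤ 1 / 4 := min_le_left _ _
  have hτε : (19 * n + 1) * τ ≤ ε := by
    have := min_le_right (1 / 4 : ℝ) (ε / (19 * n + 1))
    rw [← hτdef, le_div_iff₀ (by positivity)] at this
    linarith
  obtain ⟨r, hr, hc⟩ := he2 τ hτ0
  refine ⟨r, hr, fun f hf hs h0 => ?_⟩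
  have hJ : 0 ≤ ∫ x, f x ∂(surfaceMeasure Ω) :=
    setIntegral_nonneg isClosed_frontier.measurableSet h0
  set J := ∫ x, f x ∂(surfaceMeasure Ω)
  have hcs : HasCompactSupport f :=
    Metric.isCompact_of_isClosed_isBounded (isClosed_tsupport f) (isBounded_ball.subset hs)
  have hint : ∀ w : 𝔼, IntegrableOn (fun x => fderiv ℝ f x w) Ω := fun w =>
    (((hf.continuous_fderiv one_ne_zero).clm_apply
      continuous_const).integrable_of_hasCompactSupport (hcs.fderiv_apply (𝕜 := ℝ) w)).integrableOn
  set I : 𝔼 → ℝ := fun w => ∫ x in Ω, fderiv ℝ f x w with hI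
  have hIadd : ∀ a b, I (a + b) = I a + I b := fun a b => by
    simp only [hI, map_add]
    exact integral_add (hint a) (hint b)
  have hIsmul : ∀ (c : ℝ) a, I (c • a) = c * I a := fun c a => by
    simp only [hI, map_smul, smul_eq_mul]
    exact integral_const_mul c _
  have hunit : ∀ w : 𝔼, ‖w‖ = 1 → |I w - inner ℝ e w * J| ≤ ε * J := by
    intro w hw
    set u := e + τ • w with hu
    set c := inner ℝ e w with hcdef
    have hc1 : |c| ≤ 1 := by
      have := abs_real_inner_le_norm e w
      rwa [he1, hw, one_mul] at this
    obtain ⟨hcl, hcu⟩ := abs_le.1 hc1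
    have hN2 : ‖u‖ ^ 2 = 1 + 2 * τ * c + τ ^ 2 := by
      rw [hu, norm_add_sq_real, inner_smul_right, norm_smul, he1, hw, Real.norm_eq_abs,
        abs_of_pos hτ0]
      ring
    have hNl : 1 + τ * c ≤ ‖u‖ := by
      refine abs_le_of_sq_le_sq' ?_ (norm_nonneg _) |>.2
      rw [hN2]
      nlinarith [mul_nonneg (sub_nonneg.2 hcu) (by linarith : (0 : ℝ) ≤ 1 + c), sq_nonneg τ]
    have hNu : ‖u‖ ≤ 1 + τ * c + τ ^ 2 / 2 := by
      refine abs_le_of_sq_le_sq' ?_ (by nlinarith) |>.2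
      rw [hN2]
      nlinarith [sq_nonneg (τ * c + τ ^ 2 / 2)]
    have hNpos : 0 < ‖u‖ := by nlinarith
    have hN2' : ‖u‖ ≤ 2 := by nlinarith
    have hN1 : |1 - ‖u‖| ≤ τ := by
      have h1 := abs_norm_sub_norm_le e u
      rw [he1] at h1
      refine h1.trans (le_of_eq ?_)
      rw [hu, sub_add_cancel_left, norm_neg, norm_smul, hw, mul_one, Real.norm_eq_abs,
        abs_of_pos hτ0]
    set v := ‖u‖⁻¹ • u with hv
    have hv1 : ‖v‖ = 1 := by rw [hv, norm_smul, norm_inv, norm_norm, inv_mul_cancel₀ hNpos.ne']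
    have hve : ‖v - e‖ ≤ 2 * τ := by
      have h1 : v - e = (1 - ‖u‖) • v + τ • w := by
        have : ‖u‖ • v = u := by rw [hv, smul_smul, mul_inv_cancel₀ hNpos.ne', one_smul]
        rw [sub_smul, one_smul, this, hu]
        abel
      rw [h1]
      refine (norm_add_le _ _).trans ?_
      rw [norm_smul (1 - ‖u‖) v, norm_smul τ w, hv1, hw, Real.norm_eq_abs, Real.norm_eq_abs,
        abs_of_pos hτ0]
      linarith
    have h1 := flux_abs_le hΩ hv1 (by positivity) (by linarith) (hc.perturb hve) hf hs h0
    have h2 := flux_abs_le hΩ he1 hτ0.le (by linarith) hc hf hs h0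
    change |I v - J| ≤ _ * J at h1
    change |I e - J| ≤ _ * J at h2
    have h3 : I u = ‖u‖ * I v := by
      rw [← hIsmul, hv, smul_smul, mul_inv_cancel₀ hNpos.ne', one_smul]
    have h4 : I u = I e + τ * I w := by rw [hu, hIadd, hIsmul]
    -- the term of order `τ` in `‖u‖ = 1 + τ c + O(τ²)` produces the factor `c = ⟨e, w⟩`
    have h5 : τ * (I w - c * J) =
        ‖u‖ * (I v - J) - (I e - J) + (‖u‖ - 1 - τ * c) * J := by
      linear_combination h3 - h4
    have h6 : |τ * (I w - c * J)| ≤ τ * (ε * J) := by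
      rw [h5]
      have ha : |‖u‖ * (I v - J)| ≤ 2 * (n * (τ + 2 * τ) ^ 2 * J) := by
        rw [abs_mul, abs_norm]
        gcongr
      have hb : |(‖u‖ - 1 - τ * c) * J| ≤ τ ^ 2 * J := by
        rw [abs_mul, abs_of_nonneg hJ]
        gcongr
        rw [abs_le]
        constructor <;> nlinarith
      have hd := (abs_add_le (‖u‖ * (I v - J) - (I e - J)) ((‖u‖ - 1 - τ * c) * J)).trans
        (add_le_add_left (abs_sub (‖u‖ * (I v - J)) (I e - J)) _)
      have he' : (19 * n + 1) * τ * (τ * J) ≤ ε * (τ * J) := by gcongr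
      have hf' : 2 * (n * (τ + 2 * τ) ^ 2 * J) + n * τ ^ 2 * J + τ ^ 2 * J =
          (19 * n + 1) * τ * (τ * J) := by ring
      linarith
    rw [abs_mul, abs_of_pos hτ0] at h6
    exact le_of_mul_le_mul_left h6 hτ0
  intro w
  by_cases hw : w = 0
  · simp [hw]
  have hwpos : 0 < ‖w‖ := norm_pos_iff.2 hw
  have h1 := hunit (‖w‖⁻¹ • w) (by rw [norm_smul, norm_inv, norm_norm, inv_mul_cancel₀ hwpos.ne'])
  rw [hIsmul, inner_smul_right, mul_assoc, ← mul_sub, abs_mul, abs_of_pos (inv_pos.2 hwpos),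
    ← div_eq_inv_mul, div_le_iff₀ hwpos] at h1
  linarith

theorem isFiniteMeasure_surfaceMeasure {Ω : Set 𝔼} (hΩ : IsOpen Ω) (hb : Bornology.IsBounded Ω)
    {N : 𝔼 → 𝔼} (hN : ∀ p ∈ frontier Ω, IsOuterNormalAt Ω p (N p)) :
    IsFiniteMeasure (surfaceMeasure Ω) := by
  have hcpt : IsCompact (frontier Ω) :=
    hb.isCompact_closure.of_isClosed_subset isClosed_frontier frontier_subset_closure
  have h1 : surfaceMeasure Ω (frontier Ω) < ⊤ := by
    refine hcpt.measure_lt_top_of_nhdsWithin fun p hp => ?_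
    obtain ⟨r, hr, hc⟩ := (hN p hp).2 (1 / 2) (by norm_num)
    exact ⟨ball p r, mem_nhdsWithin_of_mem_nhds (ball_mem_nhds p hr),
      surfaceMeasure_ball_lt_top hΩ (hN p hp).1 (by norm_num) (by norm_num) hc⟩
  refine ⟨?_⟩
  rw [surfaceMeasure, Measure.restrict_apply_univ]
  rwa [surfaceMeasure, Measure.restrict_apply_self] at h1

theorem integrable_surfaceMeasure_of_continuousOn {Ω : Set 𝔼} (hb : Bornology.IsBounded Ω)
    [IsFiniteMeasure (surfaceMeasure Ω)] {F : Type*} [NormedAddCommGroup F] {h : 𝔼 → F}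
    (hh : ContinuousOn h (frontier Ω)) : Integrable h (surfaceMeasure Ω) := by
  have hcpt : IsCompact (frontier Ω) :=
    hb.isCompact_closure.of_isClosed_subset isClosed_frontier frontier_subset_closure
  have h1 : IntegrableOn h (frontier Ω) (surfaceMeasure Ω) := hh.integrableOn_compact hcpt
  rwa [IntegrableOn, surfaceMeasure, Measure.restrict_restrict isClosed_frontier.measurableSet,
    inter_self] at h1

theorem integral_fderiv_eq_zero {f : 𝔼 → ℝ} (hf : ContDiff ℝ 1 f) (hcs : HasCompactSupport f)
    (w : 𝔼) : ∫ x, fderiv ℝ f x w = 0 := by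
  have hi : Integrable fun x => fderiv ℝ f x w :=
    ((hf.continuous_fderiv one_ne_zero).clm_apply
      continuous_const).integrable_of_hasCompactSupport (hcs.fderiv_apply (𝕜 := ℝ) w)
  have h := integral_mul_fderiv_eq_neg_fderiv_mul_of_integrable (μ := (volume : Measure 𝔼))
    (f := fun _ => (1 : ℝ)) (g := f) (v := w) (by simp) (by simpa using hi)
    (by simpa using hf.continuous.integrable_of_hasCompactSupport hcs)
    (fun x _ => differentiableAt_const _) (fun x _ => hf.differentiable one_ne_zero x)
  simpa using h

section Divergence

variable {Ω : Set (EuclideanSpace ℝ (Fin n))}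
  {N : EuclideanSpace ℝ (Fin n) → EuclideanSpace ℝ (Fin n)}

theorem integrable_mul_normal (hΩ : IsOpen Ω) (hb : Bornology.IsBounded Ω)
    (hN : ∀ p ∈ frontier Ω, IsOuterNormalAt Ω p (N p)) {f : 𝔼 → ℝ} (hf : Continuous f) (w : 𝔼) :
    Integrable (fun x => f x * inner ℝ (N x) w) (surfaceMeasure Ω) := by
  have := isFiniteMeasure_surfaceMeasure hΩ hb hN
  exact integrable_surfaceMeasure_of_continuousOn hb
    (hf.continuousOn.mul ((continuousOn_outerNormal hΩ hN).inner continuousOn_const))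

/-- The divergence theorem up to a small relative error, for functions with small support. -/
theorem exists_ball_divergence (hΩ : IsOpen Ω) (hb : Bornology.IsBounded Ω)
    (hN : ∀ p ∈ frontier Ω, IsOuterNormalAt Ω p (N p)) (w : 𝔼) {ε : ℝ} (hε : 0 < ε) {p : 𝔼}
    (hp : p ∈ closure Ω) :
    ∃ r > 0, ∀ f : 𝔼 → ℝ, ContDiff ℝ 1 f → tsupport f ⊆ ball p r → (∀ x ∈ frontier Ω, 0 ≤ f x) →
      |(∫ x in Ω, fderiv ℝ f x w) - ∫ x, f x * inner ℝ (N x) w ∂(surfaceMeasure Ω)|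
        ≤ ε * ∫ x, f x ∂(surfaceMeasure Ω) := by
  have := isFiniteMeasure_surfaceMeasure hΩ hb hN
  by_cases hpΩ : p ∈ Ω
  · obtain ⟨r, hr, hball⟩ := Metric.isOpen_iff.1 hΩ p hpΩ
    refine ⟨r, hr, fun f hf hs _ => ?_⟩
    have hcs : HasCompactSupport f :=
      Metric.isCompact_of_isClosed_isBounded (isClosed_tsupport f) (isBounded_ball.subset hs)
    have hfr : ∀ x ∈ frontier Ω, f x = 0 := fun x hx => by
      by_contra h
      rw [hΩ.frontier_eq] at hx
      exact hx.2 (hball (hs (subset_tsupport f h)))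
    have h1 : ∫ x, f x * inner ℝ (N x) w ∂(surfaceMeasure Ω) = 0 :=
      setIntegral_eq_zero_of_forall_eq_zero fun x hx => by simp [hfr x hx]
    have h2 : ∫ x, f x ∂(surfaceMeasure Ω) = 0 :=
      setIntegral_eq_zero_of_forall_eq_zero hfr
    have h3 : ∫ x in Ω, fderiv ℝ f x w = 0 := by
      rw [← integral_fderiv_eq_zero hf hcs w, setIntegral_eq_integral_of_forall_compl_eq_zero]
      intro x hx
      have : x ∉ tsupport f := fun h => hx (hball (hs h))
      have h4 : fderiv ℝ f x = 0 := by
        by_contra hne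
        exact this (support_fderiv_subset ℝ (Function.mem_support.2 hne))
      simp [h4]
    simp [h1, h2, h3]
  · have hpf : p ∈ frontier Ω := by rw [hΩ.frontier_eq]; exact ⟨hp, hpΩ⟩
    set δ := ε / (2 * (‖w‖ + 1)) with hδ
    have hδ0 : 0 < δ := by positivity
    have hδw : δ * ‖w‖ ≤ ε / 2 := by
      rw [hδ, div_mul_eq_mul_div, div_le_iff₀ (by positivity)]
      nlinarith [norm_nonneg w]
    obtain ⟨r₁, hr₁, h₁⟩ := exists_ball_flux hΩ (hN p hpf) hδ0
    obtain ⟨r₂, hr₂, h₂⟩ := Metric.continuousWithinAt_iff.1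
      (continuousOn_outerNormal hΩ hN p hpf) δ hδ0
    refine ⟨min r₁ r₂, lt_min hr₁ hr₂, fun f hf hs h0 => ?_⟩
    have h3 := h₁ f hf (hs.trans (ball_subset_ball (min_le_left _ _))) h0 w
    have hfi : Integrable f (surfaceMeasure Ω) :=
      integrable_surfaceMeasure_of_continuousOn hb hf.continuous.continuousOn
    have h4 : |(∫ x, f x * inner ℝ (N x) w ∂(surfaceMeasure Ω)) -
        inner ℝ (N p) w * ∫ x, f x ∂(surfaceMeasure Ω)| ≤
          δ * ‖w‖ * ∫ x, f x ∂(surfaceMeasure Ω) := by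
      rw [← integral_const_mul, ← integral_const_mul,
        ← integral_sub (integrable_mul_normal hΩ hb hN hf.continuous w) (hfi.const_mul _)]
      refine (abs_integral_le_integral_abs).trans ?_
      refine setIntegral_mono_on ?_ (hfi.const_mul _) isClosed_frontier.measurableSet ?_
      · exact ((integrable_mul_normal hΩ hb hN hf.continuous w).sub (hfi.const_mul _)).abs
      · intro x hx
        have h5 : f x * inner ℝ (N x) w - inner ℝ (N p) w * f x =
            f x * inner ℝ (N x - N p) w := by rw [inner_sub_left]; ring
        rw [h5, abs_mul, abs_of_nonneg (h0 x hx)]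
        by_cases hfx : f x = 0
        · simp [hfx]
        have hxb : x ∈ ball p (min r₁ r₂) := hs (subset_tsupport f hfx)
        have h6 := h₂ hx (ball_subset_ball (min_le_right _ _) hxb)
        rw [dist_eq_norm] at h6
        have h7 := abs_real_inner_le_norm (N x - N p) w
        have h8 : ‖N x - N p‖ * ‖w‖ ≤ δ * ‖w‖ := by gcongr
        rw [mul_comm (f x)]
        exact mul_le_mul_of_nonneg_right (h7.trans h8) (h0 x hx)
    have hJ : 0 ≤ ∫ x, f x ∂(surfaceMeasure Ω) :=
      setIntegral_nonneg isClosed_frontier.measurableSet h0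
    set J := ∫ x, f x ∂(surfaceMeasure Ω)
    rw [abs_sub_comm] at h4
    refine (abs_sub_le _ _ _).trans ((add_le_add h3 h4).trans ?_)
    nlinarith

/-- Gauss–Green formula for functions which are nonnegative on the boundary: the relative errors of
the local formulas add up to `ε ∫ f` over a partition of unity, whatever its fineness. -/
theorem divergence_of_nonneg (hΩ : IsOpen Ω) (hb : Bornology.IsBounded Ω)
    (hN : ∀ p ∈ frontier Ω, IsOuterNormalAt Ω p (N p)) {f : 𝔼 → ℝ} (hf : ContDiff ℝ 1 f)
    (h0 : ∀ x ∈ frontier Ω, 0 ≤ f x) (w : 𝔼) :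
    ∫ x in Ω, fderiv ℝ f x w = ∫ x, f x * inner ℝ (N x) w ∂(surfaceMeasure Ω) := by
  have hfin := isFiniteMeasure_surfaceMeasure hΩ hb hN
  have hint : ∀ {g : 𝔼 → ℝ}, Continuous g → Integrable g (surfaceMeasure Ω) := fun hg =>
    integrable_surfaceMeasure_of_continuousOn hb hg.continuousOn
  set J := ∫ x, f x ∂(surfaceMeasure Ω) with hJ
  have key : ∀ ε > 0, |(∫ x in Ω, fderiv ℝ f x w) -
      ∫ x, f x * inner ℝ (N x) w ∂(surfaceMeasure Ω)| ≤ ε * J := by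
    intro ε hε
    have hloc := fun (p : 𝔼) (hp : p ∈ closure Ω) =>
      exists_ball_divergence hΩ hb hN w hε hp
    choose! r hr hloc using hloc
    obtain ⟨t, htK, htc⟩ := hb.isCompact_closure.elim_nhds_subcover (fun p => ball p (r p))
      fun p hp => ball_mem_nhds p (hr p hp)
    obtain ⟨χ, hχ⟩ := SmoothPartitionOfUnity.exists_isSubordinate (modelWithCornersSelf ℝ 𝔼)
      (isClosed_closure (s := Ω)) (fun i : t => ball (i : 𝔼) (r i)) (fun _ => isOpen_ball)
      (fun x hx => by simpa using htc hx)
    have hχs : ∀ i, ContDiff ℝ 1 (χ i) := fun i =>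
      ((contMDiff_iff_contDiff.1 (χ i).contMDiff).of_le (by simp))
    have hχ1 : ∀ x ∈ closure Ω, ∑ i, χ i x = 1 := fun x hx => by
      rw [← finsum_eq_sum_of_fintype]
      exact χ.sum_eq_one hx
    have hdec : ∀ x ∈ closure Ω, f x = ∑ i, χ i x * f x := fun x hx => by
      rw [← Finset.sum_mul, hχ1 x hx, one_mul]
    have hg : ∀ i, ContDiff ℝ 1 fun x => χ i x * f x := fun i => (hχs i).mul hf
    have h1 : ∫ x in Ω, fderiv ℝ f x w = ∑ i, ∫ x in Ω, fderiv ℝ (fun x => χ i x * f x) x w := by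
      rw [← integral_finsetSum _ fun i _ => integrableOn_fderiv hb (hg i) w]
      refine setIntegral_congr_fun hΩ.measurableSet fun x hx => ?_
      have he : f =ᶠ[𝓝 x] fun x => ∑ i, χ i x * f x := by
        filter_upwards [hΩ.mem_nhds hx] with y hy using hdec y (subset_closure hy)
      simp only [he.fderiv_eq]
      rw [fderiv_fun_sum fun i _ => (hg i).differentiable one_ne_zero x]
      simp
    have h2 : ∫ x, f x * inner ℝ (N x) w ∂(surfaceMeasure Ω) =
        ∑ i, ∫ x, χ i x * f x * inner ℝ (N x) w ∂(surfaceMeasure Ω) := by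
      rw [← integral_finsetSum _ fun i _ => integrable_mul_normal hΩ hb hN (hg i).continuous w]
      refine setIntegral_congr_fun isClosed_frontier.measurableSet fun x hx => ?_
      rw [← Finset.sum_mul, ← hdec x (frontier_subset_closure hx)]
    have h3 : J = ∑ i, ∫ x, χ i x * f x ∂(surfaceMeasure Ω) := by
      rw [← integral_finsetSum _ fun i _ => hint (hg i).continuous]
      exact setIntegral_congr_fun isClosed_frontier.measurableSet fun x hx =>
        hdec x (frontier_subset_closure hx)
    rw [h1, h2, h3, ← Finset.sum_sub_distrib, Finset.mul_sum]
    refine (Finset.abs_sum_le_sum_abs _ _).trans (Finset.sum_le_sum fun i _ => ?_)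
    refine hloc i (htK i i.2) _ (hg i) ?_ fun x hx => mul_nonneg (χ.nonneg i x) (h0 x hx)
    exact (closure_mono (Function.support_mul_subset_left _ _)).trans (hχ i)
  have hlim : Tendsto (fun ε : ℝ => ε * J) (𝓝[>] 0) (𝓝 0) := by
    have : Continuous fun ε : ℝ => ε * J := by fun_prop
    exact (this.tendsto' 0 0 (by simp)).mono_left nhdsWithin_le_nhds
  have h := ge_of_tendsto hlim (eventually_nhdsWithin_of_forall fun ε hε => key ε hε)
  exact sub_eq_zero.1 (abs_nonpos_iff.1 h)

/-- **Gauss–Green formula** on a bounded open set with an outer normal field. Partial fluxes are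
summed with a partition of unity; the formula for `f ≥ 0` extends to all `f` since
`2 f = (f + 1)² - f² - 1`. -/
theorem integral_fderiv_eq_surface (hΩ : IsOpen Ω) (hb : Bornology.IsBounded Ω)
    (hN : ∀ p ∈ frontier Ω, IsOuterNormalAt Ω p (N p)) {f : 𝔼 → ℝ} (hf : ContDiff ℝ 1 f)
    (w : 𝔼) :
    ∫ x in Ω, fderiv ℝ f x w = ∫ x, f x * inner ℝ (N x) w ∂(surfaceMeasure Ω) := by
  have h1 := divergence_of_nonneg hΩ hb hN (f := fun x => (f x + 1) ^ 2)
    ((hf.add contDiff_const).pow 2) (fun x _ => sq_nonneg _) w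
  have h2 := divergence_of_nonneg hΩ hb hN (f := fun x => f x ^ 2) (hf.pow 2)
    (fun x _ => sq_nonneg _) w
  have h3 := divergence_of_nonneg hΩ hb hN (f := fun _ => 1) contDiff_const
    (fun x _ => zero_le_one) w
  have i1 := integrable_mul_normal hΩ hb hN (f := fun x => (f x + 1) ^ 2)
    ((hf.continuous.add continuous_const).pow 2) w
  have i2 := integrable_mul_normal hΩ hb hN (f := fun x => f x ^ 2) (hf.continuous.pow 2) w
  have i3 := integrable_mul_normal hΩ hb hN (f := fun _ => 1) continuous_const w
  have j1 := integrableOn_fderiv hb (f := fun x => (f x + 1) ^ 2)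
    ((hf.add contDiff_const).pow 2) w
  have j2 := integrableOn_fderiv hb (f := fun x => f x ^ 2) (hf.pow 2) w
  have h4 : ∫ x in Ω, fderiv ℝ f x w =
      ((∫ x in Ω, fderiv ℝ (fun x => (f x + 1) ^ 2) x w) -
        ∫ x in Ω, fderiv ℝ (fun x => f x ^ 2) x w) / 2 := by
    rw [← integral_sub j1 j2, ← integral_div]
    congr 1
    ext x
    have hd := (hf.differentiable one_ne_zero x).hasFDerivAt
    have e1 := ((hd.add_const 1).pow 2).fderiv
    have e2 := (hd.pow 2).fderiv
    rw [e1, e2]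
    simp
    ring
  have h5 : ∫ x, f x * inner ℝ (N x) w ∂(surfaceMeasure Ω) =
      ((∫ x, (f x + 1) ^ 2 * inner ℝ (N x) w ∂(surfaceMeasure Ω)) -
        (∫ x, f x ^ 2 * inner ℝ (N x) w ∂(surfaceMeasure Ω)) -
          ∫ x, 1 * inner ℝ (N x) w ∂(surfaceMeasure Ω)) / 2 := by
    have i12 : Integrable (fun x => (f x + 1) ^ 2 * inner ℝ (N x) w - f x ^ 2 * inner ℝ (N x) w)
        (surfaceMeasure Ω) := i1.sub i2
    rw [← integral_sub i1 i2, ← integral_sub i12 i3, ← integral_div]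
    congr 1
    ext x
    ring
  rw [h4, h5, ← h1, ← h2, ← h3]
  simp

/-- **Divergence theorem** in coordinates: `F i` is the `i`-th component of the vector field. -/
theorem divergence_theorem (hΩ : IsOpen Ω) (hb : Bornology.IsBounded Ω)
    (hN : ∀ p ∈ frontier Ω, IsOuterNormalAt Ω p (N p)) {F : Fin n → 𝔼 → ℝ}
    (hF : ∀ i, ContDiff ℝ 1 (F i)) :
    ∫ x in Ω, ∑ i, fderiv ℝ (F i) x (EuclideanSpace.single i 1) =
      ∫ x, ∑ i, F i x * N x i ∂(surfaceMeasure Ω) := by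
  have h0 : ∀ (x : 𝔼) i, inner ℝ (N x) (EuclideanSpace.single i 1) = N x i := fun x i => by
    rw [real_inner_comm, EuclideanSpace.inner_single_left]
    simp
  rw [integral_finsetSum _ fun i _ => integrableOn_fderiv hb (hF i) _, integral_finsetSum]
  · refine Finset.sum_congr rfl fun i _ => ?_
    rw [integral_fderiv_eq_surface hΩ hb hN (hF i)]
    simp_rw [h0]
  · intro i _
    have := integrable_mul_normal hΩ hb hN (hF i).continuous (EuclideanSpace.single i 1)
    simpa only [h0] using this

end Divergence

/-! ### Energy estimates for smooth functions -/

theorem inner_gradient (f : 𝔼 → ℝ) (x v : 𝔼) : inner ℝ (gradient f x) v = fderiv ℝ f x v := by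
  rw [gradient, InnerProductSpace.toDual_symm_apply]

theorem gradient_apply (f : 𝔼 → ℝ) (x : 𝔼) (i : Fin n) :
    gradient f x i = fderiv ℝ f x (EuclideanSpace.single i 1) := by
  rw [← inner_gradient, real_inner_comm, EuclideanSpace.inner_single_left]
  simp

theorem _root_.ContDiff.continuous_gradient {f : 𝔼 → ℝ} {m : WithTop ℕ∞} (hf : ContDiff ℝ m f)
    (hm : m ≠ 0) : Continuous (gradient f) :=
  (InnerProductSpace.toDual ℝ 𝔼).symm.continuous.comp (hf.continuous_fderiv hm)

theorem sum_mul_apply (x y : 𝔼) : ∑ i, x i * y i = inner ℝ x y := by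
  rw [PiLp.inner_apply]
  exact Finset.sum_congr rfl fun i _ => by simp [mul_comm]

section

variable {Ω : Set (EuclideanSpace ℝ (Fin n))}
  {N : EuclideanSpace ℝ (Fin n) → EuclideanSpace ℝ (Fin n)}

/-- The Gauss–Green formula for the field `φ² V`. -/
theorem integral_sq_mul_field (hΩ : IsOpen Ω) (hb : Bornology.IsBounded Ω)
    (hN : ∀ p ∈ frontier Ω, IsOuterNormalAt Ω p (N p)) {φ : 𝔼 → ℝ} (hφ : ContDiff ℝ 1 φ)
    {V : 𝔼 → 𝔼} (hV : ContDiff ℝ 1 V) :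
    ∫ x, φ x ^ 2 * inner ℝ (V x) (N x) ∂(surfaceMeasure Ω) =
      ∫ x in Ω, (φ x ^ 2 * ∑ i, fderiv ℝ V x (EuclideanSpace.single i 1) i
        + 2 * φ x * inner ℝ (V x) (gradient φ x)) := by
  have hVi : ∀ i, ContDiff ℝ 1 fun x => V x i := fun i => contDiff_euclidean.1 hV i
  have h := divergence_theorem hΩ hb hN (F := fun i x => φ x ^ 2 * V x i)
    fun i => (hφ.pow 2).mul (hVi i)
  have h1 : ∀ x, φ x ^ 2 * inner ℝ (V x) (N x) = ∑ i, φ x ^ 2 * V x i * N x i := fun x => by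
    rw [← sum_mul_apply, Finset.mul_sum]
    simp_rw [mul_assoc]
  simp_rw [h1]
  rw [← h]
  congr 1
  ext x
  rw [← sum_mul_apply, Finset.mul_sum, Finset.mul_sum, ← Finset.sum_add_distrib]
  refine Finset.sum_congr rfl fun i _ => ?_
  have hd := (hφ.differentiable one_ne_zero x).hasFDerivAt
  have hVd : HasFDerivAt (fun x => V x i)
      ((EuclideanSpace.proj i : 𝔼 →L[ℝ] ℝ).comp (fderiv ℝ V x)) x :=
    (EuclideanSpace.proj i : 𝔼 →L[ℝ] ℝ).hasFDerivAt.comp x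
      (hV.differentiable one_ne_zero x).hasFDerivAt
  have e : HasFDerivAt (fun x => φ x ^ 2 * V x i) _ x := (hd.pow 2).mul hVd
  rw [e.fderiv, gradient_apply]
  simp
  ring

/-- A Friedrichs inequality: the `L²(Ω)` norm is controlled by the energy and the trace. It is the
Gauss–Green formula for the field `φ² x`. -/
theorem exists_friedrichs (hn : 1 ≤ n) (hΩ : IsOpen Ω) (hb : Bornology.IsBounded Ω)
    (hN : ∀ p ∈ frontier Ω, IsOuterNormalAt Ω p (N p)) :
    ∃ C : ℝ, ∀ φ : 𝔼 → ℝ, ContDiff ℝ 1 φ → ∫ x in Ω, φ x ^ 2 ≤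
      C * ((∫ x in Ω, ‖gradient φ x‖ ^ 2) + ∫ x, φ x ^ 2 ∂(surfaceMeasure Ω)) := by
  have hfin := isFiniteMeasure_surfaceMeasure hΩ hb hN
  obtain ⟨D, hD⟩ := hb.closure.exists_norm_le
  set D' := max D 0
  have hD0 : 0 ≤ D' := le_max_right _ _
  have hD' : ∀ x ∈ closure Ω, ‖x‖ ≤ D' := fun x hx => (hD x hx).trans (le_max_left _ _)
  refine ⟨4 * D' ^ 2 + 2 * D', fun φ hφ => ?_⟩
  -- the field `x` has divergence `n ≥ 1`, and `2 φ ⟨x, ∇φ⟩ ≥ - φ² / 2 - 2 |x|² |∇φ|²`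
  have h := integral_sq_mul_field hΩ hb hN hφ (V := fun x => x) contDiff_id
  have hdiv : ∀ x : 𝔼, ∑ i, fderiv ℝ (fun x : 𝔼 => x) x (EuclideanSpace.single i 1) i =
      (n : ℝ) := fun x => by simp
  simp_rw [hdiv] at h
  have hgc := hφ.continuous_gradient one_ne_zero
  have hc := hφ.continuous
  have i1 : IntegrableOn (fun x => φ x ^ 2) Ω := (hc.pow 2).integrableOn_of_isBounded hb
  have i2 : IntegrableOn (fun x => ‖gradient φ x‖ ^ 2) Ω :=
    (hgc.norm.pow 2).integrableOn_of_isBounded hb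
  have i3 : IntegrableOn (fun x => φ x ^ 2 * n + 2 * φ x * inner ℝ x (gradient φ x)) Ω :=
    (((hc.pow 2).mul continuous_const).add ((continuous_const.mul hc).mul
      (continuous_id.inner hgc))).integrableOn_of_isBounded hb
  have i4 : Integrable (fun x => φ x ^ 2) (surfaceMeasure Ω) :=
    integrable_surfaceMeasure_of_continuousOn hb (hc.pow 2).continuousOn
  have h1 : ∫ x in Ω, (1 / 2 * φ x ^ 2 - 2 * D' ^ 2 * ‖gradient φ x‖ ^ 2) ≤
      ∫ x in Ω, (φ x ^ 2 * n + 2 * φ x * inner ℝ x (gradient φ x)) := by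
    refine setIntegral_mono_on ((i1.const_mul _).sub (i2.const_mul _)) i3 hΩ.measurableSet
      fun x hx => ?_
    have hn' : (1 : ℝ) ≤ n := by exact_mod_cast hn
    have h2 := abs_real_inner_le_norm x (gradient φ x)
    have h3 : ‖x‖ * ‖gradient φ x‖ ≤ D' * ‖gradient φ x‖ := by
      gcongr
      exact hD' x (subset_closure hx)
    have h4 := (abs_le.1 (h2.trans h3))
    set q := inner ℝ x (gradient φ x)
    set g := ‖gradient φ x‖
    have h5 : q ^ 2 ≤ (D' * g) ^ 2 := sq_le_sq' h4.1 h4.2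
    nlinarith [sq_nonneg (φ x / 2 + 2 * q), sq_nonneg (φ x), sq_nonneg (φ x + 2 * q)]
  have h2 : ∫ x, φ x ^ 2 * inner ℝ x (N x) ∂(surfaceMeasure Ω) ≤
      ∫ x, D' * φ x ^ 2 ∂(surfaceMeasure Ω) := by
    refine setIntegral_mono_on ?_ (i4.const_mul _) isClosed_frontier.measurableSet
      fun x hx => ?_
    · exact integrable_surfaceMeasure_of_continuousOn hb ((hc.pow 2).continuousOn.mul
        (continuousOn_id.inner (continuousOn_outerNormal hΩ hN)))
    · have h3 := real_inner_le_norm x (N x)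
      rw [(hN x hx).1, mul_one] at h3
      have h4 := h3.trans (hD' x (frontier_subset_closure hx))
      nlinarith [sq_nonneg (φ x)]
  rw [integral_sub (i1.const_mul _) (i2.const_mul _), integral_const_mul, integral_const_mul,
    ← h] at h1
  rw [integral_const_mul] at h2
  have j2 : 0 ≤ ∫ x in Ω, ‖gradient φ x‖ ^ 2 := integral_nonneg fun x => by positivity
  have j4 : 0 ≤ ∫ x, φ x ^ 2 ∂(surfaceMeasure Ω) := integral_nonneg fun x => sq_nonneg _
  nlinarith [mul_nonneg hD0 j2, mul_nonneg (sq_nonneg D') j4]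

/-- A smooth vector field which is uniformly transversal to the boundary. -/
theorem exists_transversal_field (hΩ : IsOpen Ω)
    (hN : ∀ p ∈ frontier Ω, IsOuterNormalAt Ω p (N p)) :
    ∃ V : 𝔼 → 𝔼, ContDiff ℝ 1 V ∧ ∀ x ∈ frontier Ω, 1 / 2 ≤ inner ℝ (V x) (N x) := by
  set T : 𝔼 → Set 𝔼 := fun x => {v | x ∈ frontier Ω → 1 / 2 ≤ inner ℝ v (N x)} with hT
  have hconv : ∀ x, Convex ℝ (T x) := by
    intro x a ha b hb s t hs ht hst hx
    rw [inner_add_left, real_inner_smul_left, real_inner_smul_left]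
    have h1 := ha hx
    have h2 := hb hx
    have h3 : t = 1 - s := by linarith
    subst h3
    nlinarith
  have hloc : ∀ x, ∃ c, ∀ᶠ y in 𝓝 x, c ∈ T y := by
    intro x
    by_cases hx : x ∈ frontier Ω
    · refine ⟨N x, ?_⟩
      have h1 : Tendsto (fun y => inner ℝ (N x) (N y)) (𝓝[frontier Ω] x)
          (𝓝 (inner ℝ (N x) (N x))) :=
        tendsto_const_nhds.inner (continuousOn_outerNormal hΩ hN x hx)
      rw [real_inner_self_eq_norm_sq, (hN x hx).1] at h1
      have h2 := h1.eventually (lt_mem_nhds (show (1 / 2 : ℝ) < 1 ^ 2 by norm_num))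
      rw [eventually_nhdsWithin_iff] at h2
      filter_upwards [h2] with y hy hyf using (hy hyf).le
    · refine ⟨0, ?_⟩
      filter_upwards [isClosed_frontier.isOpen_compl.mem_nhds hx] with y hy hyf
      exact absurd hyf hy
  obtain ⟨g, hg⟩ := exists_contMDiffMap_forall_mem_convex_of_local_const (n := 1)
    (modelWithCornersSelf ℝ 𝔼) hconv hloc
  exact ⟨g, contMDiff_iff_contDiff.1 g.contMDiff, hg⟩

/-- The trace is controlled by an arbitrarily small multiple of the energy, up to a multiple of the
`L²(Ω)` norm. -/
theorem exists_trace_interpolation (hΩ : IsOpen Ω) (hb : Bornology.IsBounded Ω)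
    (hN : ∀ p ∈ frontier Ω, IsOuterNormalAt Ω p (N p)) {ε : ℝ} (hε : 0 < ε) :
    ∃ C : ℝ, ∀ φ : 𝔼 → ℝ, ContDiff ℝ 1 φ → ∫ x, φ x ^ 2 ∂(surfaceMeasure Ω) ≤
      ε * (∫ x in Ω, ‖gradient φ x‖ ^ 2) + C * ∫ x in Ω, φ x ^ 2 := by
  have hfin := isFiniteMeasure_surfaceMeasure hΩ hb hN
  obtain ⟨V, hV, hVN⟩ := exists_transversal_field hΩ hN
  set dv : 𝔼 → ℝ := fun x => ∑ i, fderiv ℝ V x (EuclideanSpace.single i 1) i with hdv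
  have hdvc : Continuous dv := by
    have := hV.continuous_fderiv one_ne_zero
    fun_prop
  obtain ⟨M₁, hM₁⟩ := hb.isCompact_closure.exists_bound_of_continuousOn hdvc.continuousOn
  obtain ⟨M₂, hM₂⟩ := hb.isCompact_closure.exists_bound_of_continuousOn hV.continuous.continuousOn
  refine ⟨2 * M₁ + 4 * M₂ ^ 2 / ε, fun φ hφ => ?_⟩
  have h := integral_sq_mul_field hΩ hb hN hφ hV
  have hgc := hφ.continuous_gradient one_ne_zero
  have hc := hφ.continuous
  have i1 : IntegrableOn (fun x => φ x ^ 2) Ω := (hc.pow 2).integrableOn_of_isBounded hb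
  have i2 : IntegrableOn (fun x => ‖gradient φ x‖ ^ 2) Ω :=
    (hgc.norm.pow 2).integrableOn_of_isBounded hb
  have i3 : IntegrableOn (fun x => φ x ^ 2 * dv x + 2 * φ x * inner ℝ (V x) (gradient φ x)) Ω :=
    (((hc.pow 2).mul hdvc).add ((continuous_const.mul hc).mul
      (hV.continuous.inner hgc))).integrableOn_of_isBounded hb
  have i4 : Integrable (fun x => φ x ^ 2) (surfaceMeasure Ω) :=
    integrable_surfaceMeasure_of_continuousOn hb (hc.pow 2).continuousOn
  have h1 : ∫ x in Ω, (φ x ^ 2 * dv x + 2 * φ x * inner ℝ (V x) (gradient φ x)) ≤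
      ∫ x in Ω, ((M₁ + 2 * M₂ ^ 2 / ε) * φ x ^ 2 + ε / 2 * ‖gradient φ x‖ ^ 2) := by
    refine setIntegral_mono_on i3 ((i1.const_mul _).add (i2.const_mul _)) hΩ.measurableSet
      fun x hx => ?_
    have h2 := abs_real_inner_le_norm (V x) (gradient φ x)
    have h3 : ‖V x‖ * ‖gradient φ x‖ ≤ M₂ * ‖gradient φ x‖ := by
      gcongr
      exact hM₂ x (subset_closure hx)
    have h4 := abs_le.1 (h2.trans h3)
    have h5 := (abs_le.1 (hM₁ x (subset_closure hx))).2
    set q := inner ℝ (V x) (gradient φ x)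
    set g := ‖gradient φ x‖
    have h6 : q ^ 2 ≤ (M₂ * g) ^ 2 := sq_le_sq' h4.1 h4.2
    -- Young's inequality, with the weight `ε / 2` on the gradient
    have h7 : 2 * φ x * q ≤ 2 * M₂ ^ 2 / ε * φ x ^ 2 + ε / 2 * g ^ 2 := by
      have h8 : 2 * M₂ ^ 2 / ε * φ x ^ 2 + ε / 2 * g ^ 2 - 2 * φ x * (M₂ * g) =
          (2 * M₂ * φ x - ε * g) ^ 2 / (2 * ε) := by field_simp; ring
      have h9 : 2 * M₂ ^ 2 / ε * φ x ^ 2 + ε / 2 * g ^ 2 + 2 * φ x * (M₂ * g) =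
          (2 * M₂ * φ x + ε * g) ^ 2 / (2 * ε) := by field_simp; ring
      have h10 : 0 ≤ (2 * M₂ * φ x - ε * g) ^ 2 / (2 * ε) := by positivity
      have h11 : 0 ≤ (2 * M₂ * φ x + ε * g) ^ 2 / (2 * ε) := by positivity
      rcases le_total 0 (φ x) with hp | hp <;> nlinarith
    nlinarith [sq_nonneg (φ x)]
  have h2 : ∫ x, 1 / 2 * φ x ^ 2 ∂(surfaceMeasure Ω) ≤
      ∫ x, φ x ^ 2 * inner ℝ (V x) (N x) ∂(surfaceMeasure Ω) := by
    refine setIntegral_mono_on (i4.const_mul _) ?_ isClosed_frontier.measurableSet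
      fun x hx => ?_
    · exact integrable_surfaceMeasure_of_continuousOn hb ((hc.pow 2).continuousOn.mul
        (hV.continuous.continuousOn.inner (continuousOn_outerNormal hΩ hN)))
    · nlinarith [sq_nonneg (φ x), hVN x hx]
  rw [integral_add (i1.const_mul _) (i2.const_mul _), integral_const_mul, integral_const_mul,
    ← h] at h1
  rw [integral_const_mul] at h2
  have h3 : 2 * M₁ + 4 * M₂ ^ 2 / ε = 2 * (M₁ + 2 * M₂ ^ 2 / ε) := by ring
  rw [h3]
  linarith

end

/-! ### Translations, local averages and compactness in `L²` -/

theorem sq_integral_le_integral_sq {α : Type*} [MeasurableSpace α] {μ : Measure α}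
    [IsProbabilityMeasure μ] {f : α → ℝ} (hf : Integrable f μ)
    (hf2 : Integrable (fun x => f x ^ 2) μ) : (∫ x, f x ∂μ) ^ 2 ≤ ∫ x, f x ^ 2 ∂μ := by
  set m := ∫ x, f x ∂μ with hm
  have h : 0 ≤ ∫ x, (f x - m) ^ 2 ∂μ := integral_nonneg fun x => sq_nonneg _
  have h1 : ∫ x, (f x - m) ^ 2 ∂μ = (∫ x, f x ^ 2 ∂μ) - m ^ 2 := by
    have h2 : ∀ x, (f x - m) ^ 2 = f x ^ 2 - (2 * m) * f x + m ^ 2 := fun x => by ring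
    simp_rw [h2]
    have i1 : Integrable (fun x => f x ^ 2 - 2 * m * f x) μ := hf2.sub (hf.const_mul _)
    rw [integral_add i1 (integrable_const _), integral_sub hf2 (hf.const_mul _),
      integral_const_mul, ← hm]
    simp
    ring
  linarith

theorem sq_sub_translate_le {φ : 𝔼 → ℝ} (hφ : ContDiff ℝ 1 φ) (x z : 𝔼) :
    (φ x - φ (x - z)) ^ 2 ≤ ‖z‖ ^ 2 * ∫ θ in Ioc (0 : ℝ) 1, ‖gradient φ (x - θ • z)‖ ^ 2 := by
  have hgc := hφ.continuous_gradient one_ne_zero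
  have hl : Continuous fun θ : ℝ => x - θ • z := by fun_prop
  have hderiv : ∀ θ : ℝ, HasDerivAt (fun θ : ℝ => φ (x - θ • z))
      (-inner ℝ (gradient φ (x - θ • z)) z) θ := fun θ => by
    have h1 : HasDerivAt (fun θ : ℝ => x - θ • z) (-z) θ := by
      simpa using ((hasDerivAt_id θ).smul_const z).const_sub x
    have h2 := (hφ.differentiable one_ne_zero (x - θ • z)).hasFDerivAt.comp_hasDerivAt θ h1
    rw [map_neg, ← inner_gradient] at h2
    exact h2
  have hc1 : Continuous fun θ : ℝ => -inner ℝ (gradient φ (x - θ • z)) z :=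
    ((hgc.comp hl).inner continuous_const).neg
  have hftc := intervalIntegral.integral_eq_sub_of_hasDerivAt (a := 0) (b := 1)
    (fun θ _ => hderiv θ) (hc1.intervalIntegrable 0 1)
  rw [intervalIntegral.integral_of_le zero_le_one] at hftc
  simp only [one_smul, zero_smul, sub_zero] at hftc
  have hprob : IsProbabilityMeasure ((volume : Measure ℝ).restrict (Ioc (0 : ℝ) 1)) :=
    ⟨by simp⟩
  have hint : ∀ {g : ℝ → ℝ}, Continuous g → IntegrableOn g (Ioc (0 : ℝ) 1) := fun hg =>
    (hg.continuousOn.integrableOn_compact isCompact_Icc).mono_set Ioc_subset_Icc_self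
  have h1 := sq_integral_le_integral_sq (hint hc1) (hint (hc1.pow 2))
  rw [hftc] at h1
  calc (φ x - φ (x - z)) ^ 2 = (φ (x - z) - φ x) ^ 2 := by ring
    _ ≤ _ := h1
    _ ≤ ∫ θ in Ioc (0 : ℝ) 1, ‖z‖ ^ 2 * ‖gradient φ (x - θ • z)‖ ^ 2 := by
      refine setIntegral_mono (hint (hc1.pow 2))
        ((hint (((hgc.comp hl).norm).pow 2)).const_mul _) fun θ => ?_
      have h2 := abs_real_inner_le_norm (gradient φ (x - θ • z)) z
      simp only [neg_sq]
      rw [← sq_abs, ← mul_pow, mul_comm ‖z‖]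
      gcongr
    _ = _ := integral_const_mul _ _

/-- Translations inside `Ω` move a function in `L²` by at most the length of the translation times
the energy. -/
theorem lintegral_sq_sub_translate_le {φ : 𝔼 → ℝ} (hφ : ContDiff ℝ 1 φ) {Ω U : Set 𝔼}
    (hΩ : MeasurableSet Ω) (hU : MeasurableSet U) (z : 𝔼)
    (hz : ∀ x ∈ U, ∀ θ ∈ Icc (0 : ℝ) 1, x - θ • z ∈ Ω) :
    ∫⁻ x in U, ENNReal.ofReal ((φ x - φ (x - z)) ^ 2) ≤
      ENNReal.ofReal (‖z‖ ^ 2) * ∫⁻ x in Ω, ENNReal.ofReal (‖gradient φ x‖ ^ 2) := by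
  have hgc := hφ.continuous_gradient one_ne_zero
  set g : 𝔼 → ℝ≥0∞ := fun x => ENNReal.ofReal (‖gradient φ x‖ ^ 2) with hg
  have hgm : Measurable g := by
    have : Continuous fun x => ‖gradient φ x‖ ^ 2 := by fun_prop
    exact this.measurable.ennreal_ofReal
  have h1 : ∀ x, ENNReal.ofReal ((φ x - φ (x - z)) ^ 2) ≤
      ENNReal.ofReal (‖z‖ ^ 2) * ∫⁻ θ in Ioc (0 : ℝ) 1, g (x - θ • z) := by
    intro x
    have hc : Continuous fun θ : ℝ => ‖gradient φ (x - θ • z)‖ ^ 2 := by fun_prop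
    rw [hg, ← ofReal_integral_eq_lintegral_ofReal
      ((hc.continuousOn.integrableOn_compact isCompact_Icc).mono_set Ioc_subset_Icc_self)
      (Eventually.of_forall fun θ => by positivity), ← ENNReal.ofReal_mul (by positivity)]
    exact ENNReal.ofReal_le_ofReal (sq_sub_translate_le hφ x z)
  have hm2 : Measurable fun q : 𝔼 × ℝ => g (q.1 - q.2 • z) := by
    apply hgm.comp
    fun_prop
  calc ∫⁻ x in U, ENNReal.ofReal ((φ x - φ (x - z)) ^ 2)
      ≤ ∫⁻ x in U, ENNReal.ofReal (‖z‖ ^ 2) * ∫⁻ θ in Ioc (0 : ℝ) 1, g (x - θ • z) :=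
        lintegral_mono h1
    _ = ENNReal.ofReal (‖z‖ ^ 2) * ∫⁻ x in U, ∫⁻ θ in Ioc (0 : ℝ) 1, g (x - θ • z) :=
        lintegral_const_mul' _ _ ENNReal.ofReal_ne_top
    _ = ENNReal.ofReal (‖z‖ ^ 2) * ∫⁻ θ in Ioc (0 : ℝ) 1, ∫⁻ x in U, g (x - θ • z) := by
        rw [lintegral_lintegral_swap hm2.aemeasurable]
    _ ≤ ENNReal.ofReal (‖z‖ ^ 2) * ∫⁻ θ in Ioc (0 : ℝ) 1, ∫⁻ x in Ω, g x := by
        refine mul_le_mul_right (setLIntegral_mono' measurableSet_Ioc fun θ hθ => ?_) _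
        rw [← lintegral_indicator hU, ← lintegral_indicator hΩ,
          ← lintegral_sub_right_eq_self (Ω.indicator g) (θ • z)]
        refine lintegral_mono fun x => ?_
        by_cases hx : x ∈ U
        · rw [indicator_of_mem hx, indicator_of_mem (hz x hx θ ⟨hθ.1.le, hθ.2⟩)]
        · rw [indicator_of_notMem hx]
          exact zero_le
    _ = _ := by simp

/-- The average of `φ` over the set `x - s Q`. -/
noncomputable def translateAverage (Q : Set 𝔼) (s : ℝ) (φ : 𝔼 → ℝ) (x : 𝔼) : ℝ :=
  ∫ z, φ (x - s • z) ∂(ProbabilityTheory.cond volume Q)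

section Average

variable {Q : Set (EuclideanSpace ℝ (Fin n))}

theorem integrable_cond {Q : Set 𝔼} (hQb : Bornology.IsBounded Q) {f : 𝔼 → ℝ}
    (hf : Continuous f) : Integrable f (ProbabilityTheory.cond volume Q) := by
  by_cases h : volume Q = 0
  · have : ProbabilityTheory.cond (volume : Measure 𝔼) Q = 0 := by
      rw [ProbabilityTheory.cond, Measure.restrict_eq_zero.2 h, smul_zero]
    rw [this]
    exact integrable_zero_measure
  · exact (hf.integrableOn_of_isBounded hQb).smul_measure (ENNReal.inv_ne_top.2 h)

/-- Averages are close to the function, in terms of the energy, if `x - s Q` stays in `Ω`. -/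
theorem lintegral_sq_sub_average_le {φ : 𝔼 → ℝ} (hφ : ContDiff ℝ 1 φ) {Ω U : Set 𝔼}
    (hΩ : MeasurableSet Ω) (hU : MeasurableSet U) (hQ : MeasurableSet Q)
    (hQ0 : volume Q ≠ 0) (hQ2 : Q ⊆ ball 0 2) {s : ℝ} (hs : 0 ≤ s)
    (hcone : ∀ x ∈ U, ∀ z ∈ Q, ∀ θ ∈ Icc (0 : ℝ) s, x - θ • z ∈ Ω) :
    ∫⁻ x in U, ENNReal.ofReal ((φ x - translateAverage Q s φ x) ^ 2) ≤
      ENNReal.ofReal (4 * s ^ 2) * ∫⁻ x in Ω, ENNReal.ofReal (‖gradient φ x‖ ^ 2) := by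
  have hQb : Bornology.IsBounded Q := isBounded_ball.subset hQ2
  have hQt : volume Q ≠ ⊤ := hQb.measure_lt_top.ne
  have hprob : IsProbabilityMeasure (ProbabilityTheory.cond (volume : Measure 𝔼) Q) :=
    ProbabilityTheory.cond_isProbabilityMeasure_of_finite hQ0 hQt
  set κ := ProbabilityTheory.cond (volume : Measure 𝔼) Q with hκ
  have hc := hφ.continuous
  have h1 : ∀ x, ENNReal.ofReal ((φ x - translateAverage Q s φ x) ^ 2) ≤
      ∫⁻ z, ENNReal.ofReal ((φ x - φ (x - s • z)) ^ 2) ∂κ := by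
    intro x
    have hc1 : Continuous fun z => φ x - φ (x - s • z) := by fun_prop
    have hc2 : Continuous fun z => φ (x - s • z) := by fun_prop
    have hc3 : Integrable (fun z => (φ x - φ (x - s • z)) ^ 2) κ :=
      integrable_cond hQb (hc1.pow 2)
    rw [← ofReal_integral_eq_lintegral_ofReal hc3
      (Eventually.of_forall fun z => sq_nonneg _)]
    refine ENNReal.ofReal_le_ofReal ?_
    have h2 := sq_integral_le_integral_sq (integrable_cond hQb hc1) hc3
    rw [integral_sub (integrable_const _) (integrable_cond hQb hc2)] at h2
    simpa [translateAverage] using h2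
  have hm : Measurable fun q : 𝔼 × 𝔼 => ENNReal.ofReal ((φ q.1 - φ (q.1 - s • q.2)) ^ 2) := by
    have : Continuous fun q : 𝔼 × 𝔼 => (φ q.1 - φ (q.1 - s • q.2)) ^ 2 := by fun_prop
    exact this.measurable.ennreal_ofReal
  calc ∫⁻ x in U, ENNReal.ofReal ((φ x - translateAverage Q s φ x) ^ 2)
      ≤ ∫⁻ x in U, ∫⁻ z, ENNReal.ofReal ((φ x - φ (x - s • z)) ^ 2) ∂κ := lintegral_mono h1
    _ = ∫⁻ z, (∫⁻ x in U, ENNReal.ofReal ((φ x - φ (x - s • z)) ^ 2)) ∂κ :=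
        lintegral_lintegral_swap hm.aemeasurable
    _ ≤ ∫⁻ z, ENNReal.ofReal (4 * s ^ 2) *
          (∫⁻ x in Ω, ENNReal.ofReal (‖gradient φ x‖ ^ 2)) ∂κ := by
        refine lintegral_mono_ae ?_
        filter_upwards [ProbabilityTheory.ae_cond_mem hQ] with z hz
        refine (lintegral_sq_sub_translate_le hφ hΩ hU (s • z) fun x hx θ hθ => ?_).trans ?_
        · rw [smul_smul]
          exact hcone x hx z hz _ ⟨mul_nonneg hθ.1 hs, mul_le_of_le_one_left hs hθ.2⟩
        · gcongr
          have hz2 : ‖z‖ ≤ 2 := by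
            have := hQ2 hz
            rw [mem_ball_zero_iff] at this
            exact this.le
          rw [norm_smul, mul_pow, Real.norm_eq_abs, sq_abs]
          nlinarith [norm_nonneg z, sq_nonneg s, mul_nonneg (sq_nonneg s)
            (sub_nonneg.2 (show ‖z‖ ^ 2 ≤ 4 by nlinarith [norm_nonneg z]))]
    _ = _ := by simp

/-- The average as an integral of `φ` over a subset of `Ω`. -/
theorem translateAverage_eq (hQ : MeasurableSet Q) {s : ℝ} (hs : 0 < s) (φ : 𝔼 → ℝ) (x : 𝔼) :
    translateAverage Q s φ x = ((volume Q)⁻¹.toReal * (s ^ n)⁻¹) *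
      ∫ y in {y : 𝔼 | s⁻¹ • (x - y) ∈ Q}, φ y := by
  have hT : MeasurableSet {y : 𝔼 | s⁻¹ • (x - y) ∈ Q} := by
    have : Continuous fun y : 𝔼 => s⁻¹ • (x - y) := by fun_prop
    exact this.measurable hQ
  set F : 𝔼 → ℝ := {y : 𝔼 | s⁻¹ • (x - y) ∈ Q}.indicator φ with hF
  have h1 : ∀ z, Q.indicator (fun z => φ (x - s • z)) z = F (x - s • z) := by
    intro z
    have h2 : s⁻¹ • (x - (x - s • z)) = z := by
      rw [sub_sub_cancel, smul_smul, inv_mul_cancel₀ hs.ne', one_smul]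
    by_cases hz : z ∈ Q
    · rw [indicator_of_mem hz, hF, indicator_of_mem (by rw [mem_ofPred_eq, h2]; exact hz)]
    · rw [indicator_of_notMem hz, hF, indicator_of_notMem (by rw [mem_ofPred_eq, h2]; exact hz)]
  rw [translateAverage, ProbabilityTheory.cond, integral_smul_measure, ← integral_indicator hQ,
    ← integral_indicator hT]
  simp_rw [h1]
  rw [Measure.integral_comp_smul volume (fun z => F (x - z)) s, integral_sub_left_eq_self F]
  simp only [smul_eq_mul, finrank_euclideanSpace_fin]
  rw [abs_of_pos (by positivity)]
  ring

end Average

/-- An interior cone condition, uniform near each point of the closure. -/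
theorem exists_interior_cone {Ω : Set 𝔼} {N : 𝔼 → 𝔼} (hΩ : IsOpen Ω)
    (hN : ∀ p ∈ frontier Ω, IsOuterNormalAt Ω p (N p)) {p : 𝔼} (hp : p ∈ closure Ω) :
    ∃ e : 𝔼, ‖e‖ ≤ 1 ∧ ∃ r > 0, ∃ s₀ > 0, ∀ x ∈ Ω ∩ ball p r, ∀ z ∈ ball e (1 / 4),
      ∀ θ ∈ Icc (0 : ℝ) s₀, x - θ • z ∈ Ω := by
  by_cases hpΩ : p ∈ Ω
  · obtain ⟨r, hr, hball⟩ := Metric.isOpen_iff.1 hΩ p hpΩ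
    refine ⟨0, by simp, r / 2, by positivity, r / 2, by positivity, fun x hx z hz θ hθ => ?_⟩
    apply hball
    have h1 := mem_ball_iff_norm.1 hx.2
    rw [mem_ball_zero_iff] at hz
    rw [mem_ball_iff_norm]
    have h2 : x - θ • z - p = (x - p) - θ • z := by abel
    rw [h2]
    refine (norm_sub_le _ _).trans_lt ?_
    rw [norm_smul, Real.norm_eq_abs, abs_of_nonneg hθ.1]
    nlinarith [norm_nonneg z, hθ.1, hθ.2]
  · have hpf : p ∈ frontier Ω := by rw [hΩ.frontier_eq]; exact ⟨hp, hpΩ⟩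
    obtain ⟨h1, h2⟩ := hN p hpf
    obtain ⟨R, hR, hc⟩ := h2 (1 / 2) (by norm_num)
    refine ⟨N p, h1.le, R / 2, by positivity, R / 4, by positivity, fun x hx z hz θ hθ => ?_⟩
    by_contra hy
    have hxp := mem_ball_iff_norm.1 hx.2
    rw [mem_ball_iff_norm] at hz
    have hz2 : ‖z‖ ≤ 5 / 4 := by
      have := norm_le_norm_add_norm_sub' z (N p)
      rw [h1] at this
      linarith
    have hne : x - θ • z ≠ x := by
      intro h
      rw [h] at hy
      exact hy hx.1
    have hyb : x - θ • z ∈ ball p R := by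
      rw [mem_ball_iff_norm]
      have h2 : x - θ • z - p = (x - p) - θ • z := by abel
      rw [h2]
      refine (norm_sub_le _ _).trans_lt ?_
      rw [norm_smul, Real.norm_eq_abs, abs_of_nonneg hθ.1]
      nlinarith [norm_nonneg z, hθ.1, hθ.2]
    refine hc _ hyb x (ball_subset_ball (by linarith) hx.2) hy hne ?_ (subset_closure hx.1)
    rw [sub_sub_cancel, norm_smul, inner_smul_right, Real.norm_eq_abs, abs_of_nonneg hθ.1]
    have h3 : inner ℝ (N p) z = 1 + inner ℝ (N p) (z - N p) := by
      rw [inner_sub_right, real_inner_self_eq_norm_sq, h1]; ring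
    have h4 := abs_le.1 (abs_real_inner_le_norm (N p) (z - N p))
    rw [h1, one_mul] at h4
    have h5 : 1 / 2 * ‖z‖ ≤ inner ℝ (N p) z := by linarith [h4.1]
    nlinarith [hθ.1]

theorem norm_sq_toLp {α F : Type*} [MeasurableSpace α] {μ : Measure α} [NormedAddCommGroup F]
    [InnerProductSpace ℝ F] {f : α → F} (hf : MemLp f 2 μ) :
    ‖hf.toLp f‖ ^ 2 = ∫ x, ‖f x‖ ^ 2 ∂μ := by
  rw [← real_inner_self_eq_norm_sq, L2.inner_def]
  refine integral_congr_ae ?_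
  filter_upwards [hf.coeFn_toLp] with x hx
  rw [hx, real_inner_self_eq_norm_sq]

/-- Bounded sequences in `L²` have subsequences with convergent integrals over all measurable sets,
by weak compactness. -/
theorem exists_subseq_setIntegral {μ : Measure 𝔼} [IsFiniteMeasure μ] {f : ℕ → 𝔼 → ℝ}
    (hf : ∀ k, MemLp (f k) 2 μ) {M : ℝ} (hM : ∀ k, ∫ x, f k x ^ 2 ∂μ ≤ M) :
    ∃ s : ℕ → ℕ, StrictMono s ∧ ∀ T, MeasurableSet T →
      CauchySeq fun k => ∫ x in T, f (s k) x ∂μ := by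
  have hfact : Fact ((2 : ℝ≥0∞) ≠ ⊤) := ⟨by norm_num⟩
  set F : ℕ → Lp ℝ 2 μ := fun k => (hf k).toLp (f k) with hF
  have hFn : ∀ k, ‖F k‖ ≤ √M := fun k => by
    refine Real.le_sqrt_of_sq_le ?_
    rw [hF, norm_sq_toLp]
    simpa using hM k
  set x : ℕ → WeakDual ℝ (Lp ℝ 2 μ) := fun k => StrongDual.toWeakDual (innerSL ℝ (F k)) with hx
  obtain ⟨a, -, s, hs, hlim⟩ := WeakDual.isSeqCompact_closedBall ℝ (Lp ℝ 2 μ) 0 (√M)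
    (x := x) (fun k => by
      rw [mem_preimage, mem_closedBall_zero_iff]
      change ‖innerSL ℝ (F k)‖ ≤ _
      rw [innerSL_apply_norm]
      exact hFn k)
  refine ⟨s, hs, fun T hT => ?_⟩
  set y := indicatorConstLp 2 hT (measure_ne_top μ T) (1 : ℝ)
  have h1 := ((WeakDual.eval_continuous y).tendsto a).comp hlim
  have h2 : ∀ k, x (s k) y = ∫ x in T, f (s k) x ∂μ := fun k => by
    change inner ℝ (F (s k)) y = _
    rw [real_inner_comm, L2.inner_indicatorConstLp_one]
    exact setIntegral_congr_ae hT ((hf (s k)).coeFn_toLp.mono fun x hx _ => hx)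
  refine Tendsto.cauchySeq (x := a y) ?_
  refine h1.congr fun k => ?_
  exact h2 k

section

variable {Ω : Set (EuclideanSpace ℝ (Fin n))}
  {N : EuclideanSpace ℝ (Fin n) → EuclideanSpace ℝ (Fin n)}

theorem memLp_interior (hb : Bornology.IsBounded Ω) {F : Type*} [NormedAddCommGroup F]
    {f : 𝔼 → F} (hf : Continuous f) : MemLp f 2 (interiorMeasure Ω) := by
  rw [interiorMeasure]
  have : IsFiniteMeasure ((volume : Measure 𝔼).restrict Ω) :=
    ⟨by rw [Measure.restrict_apply_univ]; exact hb.measure_lt_top⟩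
  obtain ⟨C, hC⟩ := hb.isCompact_closure.exists_bound_of_continuousOn hf.continuousOn
  refine MemLp.mono_measure (Measure.restrict_mono subset_closure le_rfl) ?_
  have : IsFiniteMeasure ((volume : Measure 𝔼).restrict (closure Ω)) :=
    ⟨by rw [Measure.restrict_apply_univ]; exact hb.isCompact_closure.measure_lt_top⟩
  exact MemLp.of_bound hf.aestronglyMeasurable C
    ((ae_restrict_iff' isClosed_closure.measurableSet).2 (Eventually.of_forall hC))

theorem setIntegral_eq_toReal_lintegral {U : Set 𝔼} {f : 𝔼 → ℝ} (hf : Measurable f) :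
    ∫ x in U, f x ^ 2 = (∫⁻ x in U, ENNReal.ofReal (f x ^ 2)).toReal :=
  integral_eq_lintegral_of_nonneg_ae (Eventually.of_forall fun _ => sq_nonneg _)
    (hf.pow_const 2).aestronglyMeasurable

theorem lintegral_gradient_eq (hb : Bornology.IsBounded Ω) {φ : 𝔼 → ℝ} (hφ : ContDiff ℝ 1 φ) :
    ∫⁻ x in Ω, ENNReal.ofReal (‖gradient φ x‖ ^ 2) =
      ENNReal.ofReal (∫ x in Ω, ‖gradient φ x‖ ^ 2) := by
  have hgc := hφ.continuous_gradient one_ne_zero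
  have hi : IntegrableOn (fun x => ‖gradient φ x‖ ^ 2) Ω :=
    (hgc.norm.pow 2).integrableOn_of_isBounded hb
  rw [ofReal_integral_eq_lintegral_ofReal hi (Eventually.of_forall fun x => by positivity)]

theorem setIntegral_sq_sub_le {U : Set 𝔼} {f g : 𝔼 → ℝ} {M : ℝ}
    (hf : IntegrableOn (fun x => f x ^ 2) U) (hg : IntegrableOn (fun x => g x ^ 2) U)
    (hfg : IntegrableOn (fun x => (f x - g x) ^ 2) U)
    (hfM : ∫ x in U, f x ^ 2 ≤ M) (hgM : ∫ x in U, g x ^ 2 ≤ M) :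
    ∫ x in U, (f x - g x) ^ 2 ≤ 4 * M := by
  have h : ∫ x in U, (f x - g x) ^ 2 ≤ ∫ x in U, (2 * f x ^ 2 + 2 * g x ^ 2) :=
    integral_mono hfg ((hf.const_mul 2).add (hg.const_mul 2)) fun x => by
      simp only
      nlinarith [sq_nonneg (f x + g x)]
  rw [integral_add (hf.const_mul 2) (hg.const_mul 2), integral_const_mul, integral_const_mul] at h
  linarith

theorem gradient_sub {f g : 𝔼 → ℝ} (hf : ContDiff ℝ 1 f) (hg : ContDiff ℝ 1 g) (x : 𝔼) :
    gradient (fun x => f x - g x) x = gradient f x - gradient g x := by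
  rw [gradient, fderiv_fun_sub (hf.differentiable one_ne_zero x)
    (hg.differentiable one_ne_zero x), map_sub]
  rfl

/-- Local form of the compact embedding of `H¹(Ω)` into `L²(Ω)`: averages over translated balls are
uniformly close to the functions, and converge pointwise along a weakly convergent sequence. -/
theorem exists_ball_tendsto_lintegral (hΩ : IsOpen Ω) (hb : Bornology.IsBounded Ω)
    (hN : ∀ p ∈ frontier Ω, IsOuterNormalAt Ω p (N p)) {φ : ℕ → 𝔼 → ℝ}
    (hφ : ∀ k, ContDiff ℝ 1 (φ k)) {M : ℝ} (hA : ∀ k, ∫ x in Ω, φ k x ^ 2 ≤ M)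
    (hG : ∀ k, ∫ x in Ω, ‖gradient (φ k) x‖ ^ 2 ≤ M)
    (hw : ∀ T ⊆ Ω, MeasurableSet T → CauchySeq fun k => ∫ x in T, φ k x) {p : 𝔼}
    (hp : p ∈ closure Ω) :
    ∃ r > 0, Tendsto (fun q : ℕ × ℕ => ∫⁻ x in Ω ∩ ball p r,
      ENNReal.ofReal ((φ q.1 x - φ q.2 x) ^ 2)) atTop (𝓝 0) := by
  obtain ⟨e, he, r, hr, s₀, hs₀, hcone⟩ := exists_interior_cone hΩ hN hp
  refine ⟨r, hr, ?_⟩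
  set Q : Set 𝔼 := ball e (1 / 4) with hQdef
  have hQ : MeasurableSet Q := measurableSet_ball
  have hQ0 : volume Q ≠ 0 := (measure_ball_pos volume e (by norm_num)).ne'
  have hQ2 : Q ⊆ ball 0 2 := fun z hz => by
    rw [mem_ball_iff_norm] at hz
    rw [mem_ball_zero_iff]
    have := norm_le_norm_add_norm_sub' z e
    linarith
  have hQt : volume Q ≠ ⊤ := measure_ball_lt_top.ne
  have hprob : IsProbabilityMeasure (ProbabilityTheory.cond (volume : Measure 𝔼) Q) :=
    ProbabilityTheory.cond_isProbabilityMeasure_of_finite hQ0 hQt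
  set U := Ω ∩ ball p r with hUdef
  have hU : MeasurableSet U := hΩ.measurableSet.inter measurableSet_ball
  have hUΩ : U ⊆ Ω := inter_subset_left
  have hM0 : 0 ≤ M := (integral_nonneg fun x => by positivity).trans (hG 0)
  set ψ : ℕ × ℕ → 𝔼 → ℝ := fun q x => φ q.1 x - φ q.2 x with hψ
  have hψd : ∀ q, ContDiff ℝ 1 (ψ q) := fun q => (hφ _).sub (hφ _)
  have hψc : ∀ q, Continuous (ψ q) := fun q => (hψd q).continuous
  have hψG : ∀ q, ∫ x in Ω, ‖gradient (ψ q) x‖ ^ 2 ≤ 4 * M := fun q => by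
    have hg1 := (hφ q.1).continuous_gradient one_ne_zero
    have hg2 := (hφ q.2).continuous_gradient one_ne_zero
    have i1 : IntegrableOn (fun x => ‖gradient (φ q.1) x‖ ^ 2) Ω :=
      (hg1.norm.pow 2).integrableOn_of_isBounded hb
    have i2 : IntegrableOn (fun x => ‖gradient (φ q.2) x‖ ^ 2) Ω :=
      (hg2.norm.pow 2).integrableOn_of_isBounded hb
    have i3 : IntegrableOn (fun x => ‖gradient (ψ q) x‖ ^ 2) Ω :=
      (((hψd q).continuous_gradient one_ne_zero).norm.pow 2).integrableOn_of_isBounded hb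
    have h : ∫ x in Ω, ‖gradient (ψ q) x‖ ^ 2 ≤
        ∫ x in Ω, (2 * ‖gradient (φ q.1) x‖ ^ 2 + 2 * ‖gradient (φ q.2) x‖ ^ 2) := by
      refine integral_mono i3 ((i1.const_mul 2).add (i2.const_mul 2)) fun x => ?_
      simp only [hψ]
      rw [gradient_sub (hφ _) (hφ _)]
      have := norm_sub_le (gradient (φ q.1) x) (gradient (φ q.2) x)
      nlinarith [sq_nonneg (‖gradient (φ q.1) x‖ - ‖gradient (φ q.2) x‖),
        norm_nonneg (gradient (φ q.1) x - gradient (φ q.2) x)]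
    rw [integral_add (i1.const_mul 2) (i2.const_mul 2), integral_const_mul,
      integral_const_mul] at h
    linarith [hG q.1, hG q.2]
  have hψA : ∀ q, ∫ x in Ω, ψ q x ^ 2 ≤ 4 * M := fun q =>
    setIntegral_sq_sub_le (((hφ q.1).continuous.pow 2).integrableOn_of_isBounded hb)
      (((hφ q.2).continuous.pow 2).integrableOn_of_isBounded hb)
      (((hψc q).pow 2).integrableOn_of_isBounded hb) (hA _) (hA _)
  -- pointwise convergence and domination of the averages
  have havg : ∀ s ∈ Ioc 0 s₀, Tendsto (fun q => ∫⁻ x in U,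
      ENNReal.ofReal (translateAverage Q s (ψ q) x ^ 2)) atTop (𝓝 0) := by
    intro s hs
    set c := (volume Q)⁻¹.toReal * (s ^ n)⁻¹ with hc
    have hc0 : 0 ≤ c := by have := hs.1; positivity
    set T : 𝔼 → Set 𝔼 := fun x => {y : 𝔼 | s⁻¹ • (x - y) ∈ Q} with hTdef
    have hTm : ∀ x, MeasurableSet (T x) := fun x => by
      have : Continuous fun y : 𝔼 => s⁻¹ • (x - y) := by fun_prop
      exact this.measurable hQ
    have hTΩ : ∀ x ∈ U, T x ⊆ Ω := fun x hx y hy => by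
      have h1 := hcone x hx _ hy s ⟨hs.1.le, hs.2⟩
      rwa [smul_smul, mul_inv_cancel₀ hs.1.ne', one_smul, sub_sub_cancel] at h1
    have heq : ∀ q x, translateAverage Q s (ψ q) x = c * ∫ y in T x, ψ q y := fun q x =>
      translateAverage_eq hQ hs.1 (ψ q) x
    have hzero : (0 : ℝ≥0∞) = ∫⁻ x in U, 0 := by simp
    rw [hzero]
    have hbound : ∀ q, ∀ x ∈ U, |∫ y in T x, ψ q y| ≤ (volume Ω).toReal + 4 * M := by
      intro q x hx
      have i2 : IntegrableOn (fun y => ψ q y ^ 2) Ω :=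
        ((hψc q).pow 2).integrableOn_of_isBounded hb
      have i1 : IntegrableOn (fun _ => (1 : ℝ)) Ω := integrableOn_const hb.measure_lt_top.ne
      have i0 : IntegrableOn (fun y => |ψ q y|) Ω := (hψc q).abs.integrableOn_of_isBounded hb
      calc |∫ y in T x, ψ q y| ≤ ∫ y in T x, |ψ q y| := abs_integral_le_integral_abs
        _ ≤ ∫ y in Ω, |ψ q y| := setIntegral_mono_set i0
            (Eventually.of_forall fun _ => abs_nonneg _) (hTΩ x hx).eventuallyLE
        _ ≤ ∫ y in Ω, (1 + ψ q y ^ 2) := by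
          refine integral_mono i0 (i1.add i2) fun y => ?_
          simp only
          nlinarith [sq_abs (ψ q y), sq_nonneg (|ψ q y| - 1)]
        _ = (volume Ω).toReal + ∫ y in Ω, ψ q y ^ 2 := by
          rw [integral_add i1 i2]
          simp [Measure.real]
        _ ≤ _ := by linarith [hψA q]
    refine tendsto_lintegral_filter_of_dominated_convergence
      (fun _ => ENNReal.ofReal ((c * ((volume Ω).toReal + 4 * M)) ^ 2)) ?_ ?_ ?_ ?_
    · refine Eventually.of_forall fun q => ?_
      have hm : StronglyMeasurable (translateAverage Q s (ψ q)) := by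
        have hcont : Continuous fun w : 𝔼 × 𝔼 => ψ q (w.1 - s • w.2) := by
          have := hψc q
          fun_prop
        exact hcont.stronglyMeasurable.integral_prod_right'
      exact ENNReal.measurable_ofReal.comp (hm.measurable.pow_const 2)
    · refine Eventually.of_forall fun q => (ae_restrict_iff' hU).2 (Eventually.of_forall
        fun x hx => ENNReal.ofReal_le_ofReal ?_)
      rw [heq, ← sq_abs, abs_mul, abs_of_nonneg hc0]
      have := hbound q x hx
      gcongr
    · rw [lintegral_const]
      exact ENNReal.mul_ne_top ENNReal.ofReal_ne_top (by
        rw [Measure.restrict_apply_univ]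
        exact (hb.subset hUΩ).measure_lt_top.ne)
    · refine (ae_restrict_iff' hU).2 (Eventually.of_forall fun x hx => ?_)
      have h1 := hw (T x) (hTΩ x hx) (hTm x)
      rw [cauchySeq_iff_tendsto_dist_atTop_0] at h1
      have h2 : Tendsto (fun q : ℕ × ℕ => ENNReal.ofReal
          (c ^ 2 * dist (∫ y in T x, φ q.1 y) (∫ y in T x, φ q.2 y) ^ 2)) atTop
          (𝓝 (ENNReal.ofReal (c ^ 2 * 0 ^ 2))) :=
        (ENNReal.continuous_ofReal.tendsto _).comp ((h1.pow 2).const_mul _)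
      simp only [ne_eq, OfNat.ofNat_ne_zero, not_false_eq_true, zero_pow, mul_zero,
        ENNReal.ofReal_zero] at h2
      refine h2.congr fun q => ?_
      have i : ∀ k, IntegrableOn (φ k) (T x) := fun k =>
        (hφ k).continuous.integrableOn_of_isBounded (hb.subset (hTΩ x hx))
      rw [heq, Real.dist_eq, sq_abs, ← integral_sub (i _) (i _), mul_pow c]
  rw [ENNReal.tendsto_nhds_zero]
  intro ε hε
  by_cases hεt : ε = ⊤
  · exact Eventually.of_forall fun q => hεt ▸ le_top
  set δ := ε.toReal with hδ
  have hδ0 : 0 < δ := ENNReal.toReal_pos hε.ne' hεt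
  -- the scale of the averages is chosen so that they are `ε / 2`-close to the functions
  set s := min s₀ (min 1 (δ / (64 * (M + 1)))) with hsdef
  have hs0 : 0 < s := lt_min hs₀ (lt_min one_pos (by positivity))
  have hs : s ∈ Ioc 0 s₀ := ⟨hs0, min_le_left _ _⟩
  have hs1 : s ≤ 1 := (min_le_right _ _).trans (min_le_left _ _)
  have hs2 : s * (64 * (M + 1)) ≤ δ := by
    rw [← le_div_iff₀ (by positivity)]
    exact (min_le_right _ _).trans (min_le_right _ _)
  have hev := (ENNReal.tendsto_nhds_zero.1 (havg s hs)) (ENNReal.ofReal (δ / 4))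
    (ENNReal.ofReal_pos.2 (by positivity))
  filter_upwards [hev] with q hq
  have h1 := lintegral_sq_sub_average_le (hψd q) hΩ.measurableSet hU hQ hQ0 hQ2 hs0.le
    fun x hx z hz θ hθ => hcone x hx z hz θ ⟨hθ.1, hθ.2.trans hs.2⟩
  rw [lintegral_gradient_eq hb (hψd q), ← ENNReal.ofReal_mul (by positivity)] at h1
  have h2 : ENNReal.ofReal (4 * s ^ 2 * ∫ x in Ω, ‖gradient (ψ q) x‖ ^ 2) ≤
      ENNReal.ofReal (δ / 4) := by
    refine ENNReal.ofReal_le_ofReal ?_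
    have h3 : 4 * s ^ 2 * ∫ x in Ω, ‖gradient (ψ q) x‖ ^ 2 ≤ 4 * s ^ 2 * (4 * M) := by
      gcongr
      exact hψG q
    nlinarith [mul_nonneg hs0.le hM0, mul_nonneg (mul_nonneg hs0.le hM0) (sub_nonneg.2 hs1)]
  have hm : Measurable fun x => ENNReal.ofReal ((ψ q x - translateAverage Q s (ψ q) x) ^ 2) := by
    have hm : StronglyMeasurable (translateAverage Q s (ψ q)) := by
      have hcont : Continuous fun w : 𝔼 × 𝔼 => ψ q (w.1 - s • w.2) := by
        have := hψc q
        fun_prop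
      exact hcont.stronglyMeasurable.integral_prod_right'
    exact ENNReal.measurable_ofReal.comp (((hψc q).measurable.sub hm.measurable).pow_const 2)
  calc ∫⁻ x in U, ENNReal.ofReal (ψ q x ^ 2)
      ≤ ∫⁻ x in U, (2 * ENNReal.ofReal ((ψ q x - translateAverage Q s (ψ q) x) ^ 2) +
          2 * ENNReal.ofReal (translateAverage Q s (ψ q) x ^ 2)) := by
        refine lintegral_mono fun x => ?_
        have h2' : (2 : ℝ≥0∞) = ENNReal.ofReal 2 := by simp
        rw [h2', ← ENNReal.ofReal_mul (by norm_num), ← ENNReal.ofReal_mul (by norm_num),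
          ← ENNReal.ofReal_add (by positivity) (by positivity)]
        refine ENNReal.ofReal_le_ofReal ?_
        nlinarith [sq_nonneg (ψ q x - 2 * translateAverage Q s (ψ q) x)]
    _ = 2 * (∫⁻ x in U, ENNReal.ofReal ((ψ q x - translateAverage Q s (ψ q) x) ^ 2)) +
        2 * ∫⁻ x in U, ENNReal.ofReal (translateAverage Q s (ψ q) x ^ 2) := by
        rw [lintegral_add_left (hm.const_mul 2), lintegral_const_mul' _ _ (by norm_num),
          lintegral_const_mul' _ _ (by norm_num)]
    _ ≤ 2 * ENNReal.ofReal (δ / 4) + 2 * ENNReal.ofReal (δ / 4) := by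
        gcongr
        exact h1.trans h2
    _ = ε := by
        have h2' : (2 : ℝ≥0∞) = ENNReal.ofReal 2 := by simp
        rw [h2', ← ENNReal.ofReal_mul (by norm_num), ← ENNReal.ofReal_add (by positivity)
          (by positivity)]
        rw [show 2 * (δ / 4) + 2 * (δ / 4) = δ by ring, hδ, ENNReal.ofReal_toReal hεt]

/-- **Rellich's theorem** for smooth functions: a sequence bounded in `H¹(Ω)` has a subsequence
which is Cauchy in `L²(Ω)`. -/
theorem exists_subseq_cauchy_L2 (hΩ : IsOpen Ω) (hb : Bornology.IsBounded Ω)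
    (hN : ∀ p ∈ frontier Ω, IsOuterNormalAt Ω p (N p)) {φ : ℕ → 𝔼 → ℝ}
    (hφ : ∀ k, ContDiff ℝ 1 (φ k)) {M : ℝ} (hA : ∀ k, ∫ x in Ω, φ k x ^ 2 ≤ M)
    (hG : ∀ k, ∫ x in Ω, ‖gradient (φ k) x‖ ^ 2 ≤ M) :
    ∃ s : ℕ → ℕ, StrictMono s ∧ Tendsto (fun q : ℕ × ℕ =>
      ∫ x in Ω, (φ (s q.1) x - φ (s q.2) x) ^ 2) atTop (𝓝 0) := by
  have hfin : IsFiniteMeasure (interiorMeasure Ω) :=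
    ⟨by rw [interiorMeasure, Measure.restrict_apply_univ]; exact hb.measure_lt_top⟩
  obtain ⟨s, hs, hw⟩ := exists_subseq_setIntegral
    (fun k => memLp_interior hb (hφ k).continuous) hA
  refine ⟨s, hs, ?_⟩
  have hw' : ∀ T ⊆ Ω, MeasurableSet T → CauchySeq fun k => ∫ x in T, φ (s k) x := by
    intro T hT hTm
    have := hw T hTm
    rwa [interiorMeasure, Measure.restrict_restrict hTm, inter_eq_left.2 hT] at this
  have hloc := fun (p : 𝔼) (hp : p ∈ closure Ω) => exists_ball_tendsto_lintegral hΩ hb hN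
    (fun k => hφ (s k)) (fun k => hA (s k)) (fun k => hG (s k)) hw' hp
  choose! r hr hloc using hloc
  obtain ⟨t, htK, htc⟩ := hb.isCompact_closure.elim_nhds_subcover (fun p => ball p (r p))
    fun p hp => ball_mem_nhds p (hr p hp)
  have hsum : Tendsto (fun q : ℕ × ℕ => ∑ p ∈ t, ∫⁻ x in Ω ∩ ball p (r p),
      ENNReal.ofReal ((φ (s q.1) x - φ (s q.2) x) ^ 2)) atTop (𝓝 0) := by
    have := tendsto_finsetSum t fun p hp => hloc p (htK p hp)
    simpa using this
  have hle : ∀ q : ℕ × ℕ, ∫⁻ x in Ω, ENNReal.ofReal ((φ (s q.1) x - φ (s q.2) x) ^ 2) ≤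
      ∑ p ∈ t, ∫⁻ x in Ω ∩ ball p (r p),
        ENNReal.ofReal ((φ (s q.1) x - φ (s q.2) x) ^ 2) := by
    intro q
    have h1 : Ω ⊆ ⋃ p : t, Ω ∩ ball (p : 𝔼) (r p) := fun x hx => by
      have := htc (subset_closure hx)
      simp only [mem_iUnion] at this ⊢
      obtain ⟨p, hp, hxp⟩ := this
      exact ⟨⟨p, hp⟩, hx, hxp⟩
    refine (lintegral_mono_set h1).trans ((lintegral_iUnion_le _ _).trans ?_)
    rw [tsum_fintype]
    exact (Finset.sum_coe_sort t (fun p => ∫⁻ x in Ω ∩ ball p (r p),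
      ENNReal.ofReal ((φ (s q.1) x - φ (s q.2) x) ^ 2))).le
  have h0 := tendsto_of_tendsto_of_tendsto_of_le_of_le tendsto_const_nhds hsum
    (fun _ => zero_le) hle
  have h1 := (ENNReal.tendsto_toReal ENNReal.zero_ne_top).comp h0
  rw [ENNReal.toReal_zero] at h1
  refine h1.congr fun q => ?_
  exact (setIntegral_eq_toReal_lintegral
    (((hφ _).continuous.sub (hφ _).continuous).measurable)).symm

end

/-! ### Minimisation of a Rayleigh quotient -/

/-- Existence of a minimiser of the Rayleigh quotient `‖g φ‖² / ‖b φ‖²` in an abstract setting: if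
`b` is compact with respect to the norm given by `g` and `b`, a minimising sequence has a
subsequence along which `b φ` converges, and the parallelogram identity makes `g φ` converge as
well. The limit satisfies the Euler–Lagrange equation. -/
theorem exists_rayleigh_minimizer {V X Y Z : Type*} [AddCommGroup V] [Module ℝ V]
    [NormedAddCommGroup X] [InnerProductSpace ℝ X] [CompleteSpace X]
    [NormedAddCommGroup Y] [InnerProductSpace ℝ Y] [CompleteSpace Y]
    [NormedAddCommGroup Z] [InnerProductSpace ℝ Z] [CompleteSpace Z]
    (a : V →ₗ[ℝ] X) (g : V →ₗ[ℝ] Y) (b : V →ₗ[ℝ] Z) {C : ℝ}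
    (hF : ∀ φ, ‖a φ‖ ^ 2 ≤ C * (‖g φ‖ ^ 2 + ‖b φ‖ ^ 2))
    (hK : ∀ (φ : ℕ → V) (M : ℝ), (∀ k, ‖g (φ k)‖ ^ 2 ≤ M ∧ ‖b (φ k)‖ ^ 2 ≤ M) →
      ∃ s : ℕ → ℕ, StrictMono s ∧ CauchySeq fun k => b (φ (s k)))
    (hne : ∃ φ, b φ ≠ 0) :
    ∃ (l : ℝ) (φ : ℕ → V) (x : X) (y : Y) (z : Z), 0 ≤ l ∧
      (∀ ψ, l * ‖b ψ‖ ^ 2 ≤ ‖g ψ‖ ^ 2) ∧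
      Tendsto (fun k => a (φ k)) atTop (𝓝 x) ∧ Tendsto (fun k => g (φ k)) atTop (𝓝 y) ∧
      Tendsto (fun k => b (φ k)) atTop (𝓝 z) ∧ ‖z‖ = 1 ∧ ‖y‖ ^ 2 = l ∧
      ∀ ψ, inner ℝ y (g ψ) = l * inner ℝ z (b ψ) := by
  set S : Set ℝ := {t | ∃ φ, ‖b φ‖ = 1 ∧ ‖g φ‖ ^ 2 = t} with hS
  have hSne : S.Nonempty := by
    obtain ⟨φ, hφ⟩ := hne
    refine ⟨_, ‖b φ‖⁻¹ • φ, ?_, rfl⟩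
    rw [map_smul, norm_smul, norm_inv, norm_norm, inv_mul_cancel₀ (norm_ne_zero_iff.2 hφ)]
  have hSb : BddBelow S := ⟨0, by rintro _ ⟨φ, -, rfl⟩; positivity⟩
  set l := sInf S with hl
  have hl0 : 0 ≤ l := le_csInf hSne (by rintro _ ⟨φ, -, rfl⟩; positivity)
  have hmin : ∀ ψ, l * ‖b ψ‖ ^ 2 ≤ ‖g ψ‖ ^ 2 := by
    intro ψ
    by_cases h : b ψ = 0
    · rw [h]; simp
    have hpos : 0 < ‖b ψ‖ := norm_pos_iff.2 h
    have h1 : l ≤ ‖g (‖b ψ‖⁻¹ • ψ)‖ ^ 2 := csInf_le hSb ⟨_, by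
      rw [map_smul, norm_smul, norm_inv, norm_norm, inv_mul_cancel₀ hpos.ne'], rfl⟩
    rw [map_smul, norm_smul, norm_inv, norm_norm, mul_pow, inv_pow, ← div_eq_inv_mul,
      le_div_iff₀ (by positivity)] at h1
    exact h1
  obtain ⟨t, -, ht, htS⟩ := exists_seq_tendsto_sInf hSne hSb
  choose φ₀ hφ₀b hφ₀g using htS
  rw [← hl] at ht
  obtain ⟨M, hM⟩ := ht.bddAbove_range
  obtain ⟨s, hs, hcb⟩ := hK φ₀ (max M 1) fun k => by
    rw [hφ₀g, hφ₀b]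
    exact ⟨(hM ⟨k, rfl⟩).trans (le_max_left _ _), by simp⟩
  set φ : ℕ → V := fun k => φ₀ (s k) with hφ
  have hgl : Tendsto (fun k => ‖g (φ k)‖ ^ 2) atTop (𝓝 l) := by
    simp only [hφ, hφ₀g]
    exact ht.comp hs.tendsto_atTop
  have hb1 : ∀ k, ‖b (φ k)‖ = 1 := fun k => hφ₀b _
  have hgl1 : Tendsto (fun q : ℕ × ℕ => ‖g (φ q.1)‖ ^ 2) atTop (𝓝 l) := by
    rw [← prod_atTop_atTop_eq]; exact hgl.comp tendsto_fst
  have hgl2 : Tendsto (fun q : ℕ × ℕ => ‖g (φ q.2)‖ ^ 2) atTop (𝓝 l) := by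
    rw [← prod_atTop_atTop_eq]; exact hgl.comp tendsto_snd
  have hbd := cauchySeq_iff_tendsto_dist_atTop_0.1 hcb
  have hgd : Tendsto (fun q : ℕ × ℕ => ‖g (φ q.1 - φ q.2)‖ ^ 2) atTop (𝓝 0) := by
    have hup : ∀ q : ℕ × ℕ, ‖g (φ q.1 - φ q.2)‖ ^ 2 ≤ 2 * ‖g (φ q.1)‖ ^ 2 +
        2 * ‖g (φ q.2)‖ ^ 2 - l * (4 - dist (b (φ q.1)) (b (φ q.2)) ^ 2) := by
      intro q
      have h1 := parallelogram_law_with_norm ℝ (g (φ q.1)) (g (φ q.2))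
      have h2 := parallelogram_law_with_norm ℝ (b (φ q.1)) (b (φ q.2))
      have h3 := hmin (φ q.1 + φ q.2)
      rw [hb1, hb1] at h2
      rw [map_add, map_add] at h3
      rw [map_sub, dist_eq_norm]
      nlinarith
    have hlim : Tendsto (fun q : ℕ × ℕ => 2 * ‖g (φ q.1)‖ ^ 2 +
        2 * ‖g (φ q.2)‖ ^ 2 - l * (4 - dist (b (φ q.1)) (b (φ q.2)) ^ 2)) atTop
        (𝓝 (2 * l + 2 * l - l * (4 - 0 ^ 2))) :=
      ((hgl1.const_mul 2).add (hgl2.const_mul 2)).sub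
        ((tendsto_const_nhds.sub (hbd.pow 2)).const_mul l)
    have h0 : 2 * l + 2 * l - l * (4 - 0 ^ 2) = 0 := by ring
    rw [h0] at hlim
    exact tendsto_of_tendsto_of_tendsto_of_le_of_le tendsto_const_nhds hlim
      (fun _ => by positivity) hup
  have hcg : CauchySeq fun k => g (φ k) := by
    rw [cauchySeq_iff_tendsto_dist_atTop_0]
    have := (Real.continuous_sqrt.tendsto 0).comp hgd
    rw [Real.sqrt_zero] at this
    refine this.congr fun q => ?_
    simp [Real.sqrt_sq, dist_eq_norm]
  have hca : CauchySeq fun k => a (φ k) := by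
    rw [cauchySeq_iff_tendsto_dist_atTop_0]
    have h1 : Tendsto (fun q : ℕ × ℕ => C * (‖g (φ q.1 - φ q.2)‖ ^ 2 +
        dist (b (φ q.1)) (b (φ q.2)) ^ 2)) atTop (𝓝 (C * (0 + 0 ^ 2))) :=
      (hgd.add (hbd.pow 2)).const_mul C
    have h0 : C * (0 + (0 : ℝ) ^ 2) = 0 := by ring
    rw [h0] at h1
    have h2 : Tendsto (fun q : ℕ × ℕ => ‖a (φ q.1 - φ q.2)‖ ^ 2) atTop (𝓝 0) := by
      refine tendsto_of_tendsto_of_tendsto_of_le_of_le tendsto_const_nhds h1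
        (fun _ => by positivity) fun q => ?_
      have := hF (φ q.1 - φ q.2)
      rw [map_sub b] at this
      simpa [dist_eq_norm] using this
    have := (Real.continuous_sqrt.tendsto 0).comp h2
    rw [Real.sqrt_zero] at this
    refine this.congr fun q => ?_
    simp [Real.sqrt_sq, dist_eq_norm]
  obtain ⟨x, hx⟩ := cauchySeq_tendsto_of_complete hca
  obtain ⟨y, hy⟩ := cauchySeq_tendsto_of_complete hcg
  obtain ⟨z, hz⟩ := cauchySeq_tendsto_of_complete hcb
  have hz1 : ‖z‖ = 1 := tendsto_nhds_unique hz.norm (by simp [hφ₀b])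
  have hy1 : ‖y‖ ^ 2 = l := tendsto_nhds_unique (hy.norm.pow 2) hgl
  refine ⟨l, φ, x, y, z, hl0, hmin, hx, hy, hz, hz1, hy1, fun ψ => ?_⟩
  -- the quotient is minimal along the line through the minimiser in direction `ψ`
  have hvar : ∀ c : ℝ, l * ‖z + c • b ψ‖ ^ 2 ≤ ‖y + c • g ψ‖ ^ 2 := by
    intro c
    refine le_of_tendsto_of_tendsto' (((hz.add_const (c • b ψ)).norm.pow 2).const_mul l)
      ((hy.add_const (c • g ψ)).norm.pow 2) fun k => ?_
    have := hmin (φ k + c • ψ)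
    simpa using this
  set A := inner ℝ y (g ψ) - l * inner ℝ z (b ψ) with hA
  set B := ‖g ψ‖ ^ 2 - l * ‖b ψ‖ ^ 2 with hB
  have hquad : ∀ c : ℝ, 0 ≤ 2 * c * A + c ^ 2 * B := by
    intro c
    have h := hvar c
    rw [norm_add_sq_real, norm_add_sq_real, hz1, hy1, norm_smul, norm_smul, inner_smul_right,
      inner_smul_right, mul_pow, mul_pow, Real.norm_eq_abs, sq_abs] at h
    rw [hA, hB]
    nlinarith
  have hB0 : 0 ≤ B := by
    have := hmin ψ
    linarith
  have h1 := hquad (-A / (B + 1))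
  have hA0 : A = 0 := by
    have h2 : 2 * (-A / (B + 1)) * A + (-A / (B + 1)) ^ 2 * B =
        -(A ^ 2 * (B + 2)) / (B + 1) ^ 2 := by
      field_simp
      ring
    rw [h2, neg_div, neg_nonneg] at h1
    have h3 : A ^ 2 * (B + 2) ≤ 0 := by
      rwa [div_le_iff₀ (by positivity), zero_mul] at h1
    nlinarith [sq_nonneg A]
  linarith

/-! ### Functions with vanishing gradient -/

/-- A Poincaré inequality on balls, from the double integral of `(φ x - φ y)²`. -/
theorem exists_poincare_ball {Ω : Set 𝔼} (hΩ : IsOpen Ω) (hb : Bornology.IsBounded Ω) {p : 𝔼}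
    {r : ℝ} (hball : ball p (3 * r) ⊆ Ω) :
    ∃ C : ℝ, ∀ φ : 𝔼 → ℝ, ContDiff ℝ 1 φ →
      (volume (ball p r)).toReal * (∫ x in ball p r, φ x ^ 2) - (∫ x in ball p r, φ x) ^ 2 ≤
        C * ∫ x in Ω, ‖gradient φ x‖ ^ 2 := by
  rcases le_or_gt r 0 with hr | hr
  · exact ⟨0, fun φ _ => by simp [ball_eq_empty.2 hr]⟩
  set P := ball p r with hP
  have hPb : Bornology.IsBounded P := isBounded_ball
  set B : Set 𝔼 := ball 0 (2 * r) with hB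
  refine ⟨(2 * r) ^ 2 * (volume B).toReal / 2, fun φ hφ => ?_⟩
  have hc := hφ.continuous
  have i1 : IntegrableOn φ P := hc.integrableOn_of_isBounded hPb
  have i2 : IntegrableOn (fun x => φ x ^ 2) P := (hc.pow 2).integrableOn_of_isBounded hPb
  have i0 : ∀ t : ℝ, IntegrableOn (fun _ => t) P := fun t =>
    integrableOn_const measure_ball_lt_top.ne
  set v := (volume P).toReal
  set I := ∫ x in P, φ x
  set A := ∫ x in P, φ x ^ 2
  set G := ∫ x in Ω, ‖gradient φ x‖ ^ 2
  have hG0 : 0 ≤ G := integral_nonneg fun x => by positivity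
  have hconst : ∀ t : ℝ, ∫ _ in P, t = v * t := fun t => by
    simp [v, Measure.real]
  have hin : ∀ x, ∫ y in P, (φ x - φ y) ^ 2 = v * φ x ^ 2 - 2 * I * φ x + A := by
    intro x
    have h : ∀ y, (φ x - φ y) ^ 2 = φ x ^ 2 - 2 * φ x * φ y + φ y ^ 2 := fun y => by ring
    simp_rw [h]
    have j : IntegrableOn (fun y => φ x ^ 2 - 2 * φ x * φ y) P := (i0 _).sub (i1.const_mul _)
    rw [integral_add j i2, integral_sub (i0 _) (i1.const_mul _), integral_const_mul, hconst]
    ring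
  have hout : ∫ x in P, (v * φ x ^ 2 - 2 * I * φ x + A) = 2 * (v * A - I ^ 2) := by
    have j : IntegrableOn (fun x => v * φ x ^ 2 - 2 * I * φ x) P :=
      (i2.const_mul _).sub (i1.const_mul _)
    rw [integral_add j (i0 _), integral_sub (i2.const_mul _) (i1.const_mul _), integral_const_mul,
      integral_const_mul, hconst]
    ring
  have hin0 : ∀ x, 0 ≤ v * φ x ^ 2 - 2 * I * φ x + A := fun x => by
    rw [← hin]; exact integral_nonneg fun y => sq_nonneg _
  have hlin : ENNReal.ofReal (2 * (v * A - I ^ 2)) ≤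
      ENNReal.ofReal ((2 * r) ^ 2 * (volume B).toReal * G) := by
    have hm : Measurable fun q : 𝔼 × 𝔼 => ENNReal.ofReal ((φ q.1 - φ (q.1 - q.2)) ^ 2) := by
      have : Continuous fun q : 𝔼 × 𝔼 => (φ q.1 - φ (q.1 - q.2)) ^ 2 := by fun_prop
      exact this.measurable.ennreal_ofReal
    have iout : IntegrableOn (fun x => v * φ x ^ 2 - 2 * I * φ x + A) P :=
      ((i2.const_mul _).sub (i1.const_mul _)).add (i0 _)
    rw [← hout, ofReal_integral_eq_lintegral_ofReal iout (Eventually.of_forall hin0)]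
    calc ∫⁻ x in P, ENNReal.ofReal (v * φ x ^ 2 - 2 * I * φ x + A)
        ≤ ∫⁻ x in P, ∫⁻ z in B, ENNReal.ofReal ((φ x - φ (x - z)) ^ 2) := by
          refine setLIntegral_mono' measurableSet_ball fun x hx => ?_
          have hcx : Continuous fun y => (φ x - φ y) ^ 2 := by fun_prop
          rw [← hin, ofReal_integral_eq_lintegral_ofReal (hcx.integrableOn_of_isBounded hPb)
            (Eventually.of_forall fun y => sq_nonneg _), ← lintegral_indicator measurableSet_ball,
            ← lintegral_indicator measurableSet_ball, ← lintegral_sub_left_eq_self _ x]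
          refine lintegral_mono fun z => ?_
          by_cases hz : x - z ∈ P
          · have hzB : z ∈ B := by
              rw [hB, mem_ball_zero_iff]
              rw [hP, mem_ball_iff_norm] at hx hz
              have h1 : z = (x - p) - (x - z - p) := by abel
              rw [h1]
              exact (norm_sub_le _ _).trans_lt (by linarith)
            rw [indicator_of_mem hz, indicator_of_mem hzB]
          · rw [indicator_of_notMem hz]
            exact zero_le
      _ = ∫⁻ z in B, ∫⁻ x in P, ENNReal.ofReal ((φ x - φ (x - z)) ^ 2) :=
          lintegral_lintegral_swap hm.aemeasurable
      _ ≤ ∫⁻ z in B, ENNReal.ofReal ((2 * r) ^ 2 * G) := by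
          refine setLIntegral_mono' measurableSet_ball fun z hz => ?_
          rw [hB, mem_ball_zero_iff] at hz
          refine (lintegral_sq_sub_translate_le hφ hΩ.measurableSet measurableSet_ball z ?_).trans
            ?_
          · intro x hx θ hθ
            apply hball
            rw [mem_ball_iff_norm] at hx
            rw [mem_ball_iff_norm]
            have h2 : x - θ • z - p = (x - p) - θ • z := by abel
            rw [h2]
            refine (norm_sub_le _ _).trans_lt ?_
            rw [norm_smul, Real.norm_eq_abs, abs_of_nonneg hθ.1]
            nlinarith [norm_nonneg z, hθ.1, hθ.2]
          · rw [lintegral_gradient_eq hb hφ, ← ENNReal.ofReal_mul (by positivity)]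
            refine ENNReal.ofReal_le_ofReal ?_
            gcongr
      _ = ENNReal.ofReal ((2 * r) ^ 2 * (volume B).toReal * G) := by
          rw [lintegral_const, Measure.restrict_apply_univ,
            ← ENNReal.ofReal_toReal (a := volume B) measure_ball_lt_top.ne,
            ← ENNReal.ofReal_mul (by positivity), ENNReal.toReal_ofReal ENNReal.toReal_nonneg]
          congr 1
          ring
  have h := (ENNReal.ofReal_le_ofReal_iff (by positivity)).1 hlin
  linarith

/-- If smooth functions converge in `L²(Ω)` and their energies tend to zero, then the limit is
constant on small balls. -/
theorem ae_const_ball_of_tendsto {Ω : Set 𝔼} (hΩ : IsOpen Ω) (hb : Bornology.IsBounded Ω)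
    {φ : ℕ → 𝔼 → ℝ} (hφ : ∀ k, ContDiff ℝ 1 (φ k)) {u : 𝔼 → ℝ}
    (hu : MemLp u 2 (interiorMeasure Ω))
    (hlim : Tendsto (fun k => eLpNorm (fun x => φ k x - u x) 2 (interiorMeasure Ω)) atTop (𝓝 0))
    (hG : Tendsto (fun k => ∫ x in Ω, ‖gradient (φ k) x‖ ^ 2) atTop (𝓝 0)) {p : 𝔼} {r : ℝ}
    (hr : 0 < r) (hball : ball p (3 * r) ⊆ Ω) :
    ∃ c : ℝ, ∀ᵐ x ∂(volume.restrict (ball p r)), u x = c := by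
  obtain ⟨C, hC⟩ := exists_poincare_ball hΩ hb hball
  set P := ball p r with hP
  have hPΩ : P ⊆ Ω := (ball_subset_ball (by linarith)).trans hball
  set μ := (volume : Measure 𝔼).restrict P with hμ
  have hfin : IsFiniteMeasure μ := ⟨by rw [hμ, Measure.restrict_apply_univ]
                                       exact measure_ball_lt_top⟩
  have hμle : μ ≤ interiorMeasure Ω := Measure.restrict_mono hPΩ le_rfl
  have hφm : ∀ k, MemLp (φ k) 2 μ := fun k => (memLp_interior hb (hφ k).continuous).mono_measure hμle
  have hum : MemLp u 2 μ := hu.mono_measure hμle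
  have hL : Tendsto (fun k => (hφm k).toLp (φ k)) atTop (𝓝 (hum.toLp u)) := by
    rw [Lp.tendsto_Lp_iff_tendsto_eLpNorm'']
    exact tendsto_of_tendsto_of_tendsto_of_le_of_le tendsto_const_nhds hlim
      (fun _ => zero_le) fun k => eLpNorm_mono_measure _ hμle
  have h1m : MemLp (fun _ : 𝔼 => (1 : ℝ)) 2 μ := memLp_const 1
  have hinner : ∀ {f : 𝔼 → ℝ} (hf : MemLp f 2 μ),
      inner ℝ (h1m.toLp _) (hf.toLp f) = ∫ x, f x ∂μ := fun hf => by
    rw [L2.inner_def]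
    refine integral_congr_ae ?_
    filter_upwards [hf.coeFn_toLp, h1m.coeFn_toLp] with x hx hx1
    rw [hx, hx1]
    simp
  have hsq : ∀ {f : 𝔼 → ℝ} (hf : MemLp f 2 μ), ‖hf.toLp f‖ ^ 2 = ∫ x, f x ^ 2 ∂μ := fun hf => by
    rw [norm_sq_toLp]
    simp
  set v := (volume P).toReal with hv
  have hvpos : 0 < v := ENNReal.toReal_pos (measure_ball_pos volume p hr).ne'
    measure_ball_lt_top.ne
  have hle : v * ‖hum.toLp u‖ ^ 2 - (inner ℝ (h1m.toLp _) (hum.toLp u)) ^ 2 ≤ C * 0 := by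
    refine le_of_tendsto_of_tendsto' (((hL.norm.pow 2).const_mul v).sub
      ((tendsto_const_nhds.inner hL).pow 2)) (hG.const_mul C) fun k => ?_
    rw [hsq, hinner]
    exact hC (φ k) (hφ k)
  rw [hsq, hinner, mul_zero] at hle
  set I := ∫ x, u x ∂μ with hI
  have hui : Integrable u μ := hum.integrable (by norm_num)
  have hui2 : Integrable (fun x => u x ^ 2) μ := hum.integrable_sq
  refine ⟨I / v, ?_⟩
  have hz : ∫ x, (u x - I / v) ^ 2 ∂μ = 0 := by
    refine le_antisymm ?_ (integral_nonneg fun x => sq_nonneg _)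
    have h : ∀ x, (u x - I / v) ^ 2 = u x ^ 2 - 2 * (I / v) * u x + (I / v) ^ 2 := fun x => by ring
    simp_rw [h]
    have j : Integrable (fun x => u x ^ 2 - 2 * (I / v) * u x) μ := hui2.sub (hui.const_mul _)
    rw [integral_add j (integrable_const _), integral_sub hui2 (hui.const_mul _),
      integral_const_mul, ← hI]
    have hcst : ∫ _, (I / v) ^ 2 ∂μ = v * (I / v) ^ 2 := by
      simp [hμ, hv, Measure.real]
    rw [hcst]
    have : (∫ x, u x ^ 2 ∂μ) - 2 * (I / v) * I + v * (I / v) ^ 2 =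
        (v * (∫ x, u x ^ 2 ∂μ) - I ^ 2) / v := by field_simp; ring
    rw [this]
    exact div_nonpos_of_nonpos_of_nonneg hle hvpos.le
  have hi : Integrable (fun x => (u x - I / v) ^ 2) μ := (hum.sub (memLp_const _)).integrable_sq
  have := (integral_eq_zero_iff_of_nonneg (fun x => sq_nonneg _) hi).1 hz
  filter_upwards [this] with x hx
  have : u x - I / v = 0 := by simpa using hx
  linarith

/-- On a connected open set the limit is constant. -/
theorem ae_const_of_tendsto {Ω : Set 𝔼} (hΩ : IsOpen Ω) (hb : Bornology.IsBounded Ω)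
    (hconn : IsPreconnected Ω)
    {φ : ℕ → 𝔼 → ℝ} (hφ : ∀ k, ContDiff ℝ 1 (φ k)) {u : 𝔼 → ℝ}
    (hu : MemLp u 2 (interiorMeasure Ω))
    (hlim : Tendsto (fun k => eLpNorm (fun x => φ k x - u x) 2 (interiorMeasure Ω)) atTop (𝓝 0))
    (hG : Tendsto (fun k => ∫ x in Ω, ‖gradient (φ k) x‖ ^ 2) atTop (𝓝 0)) :
    ∃ c : ℝ, ∀ᵐ x ∂(interiorMeasure Ω), u x = c := by
  have hloc : ∀ p : 𝔼, ∃ r > 0, p ∈ Ω → ball p r ⊆ Ω ∧ ∃ c : ℝ,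
      ∀ᵐ x ∂(volume.restrict (ball p r)), u x = c := by
    intro p
    by_cases hp : p ∈ Ω
    · obtain ⟨R, hR, hball⟩ := Metric.isOpen_iff.1 hΩ p hp
      refine ⟨R / 3, by positivity, fun _ => ⟨(ball_subset_ball (by linarith)).trans hball, ?_⟩⟩
      exact ae_const_ball_of_tendsto hΩ hb hφ hu hlim hG (by positivity)
        (by rwa [mul_div_cancel₀ R (by norm_num : (3 : ℝ) ≠ 0)])
    · exact ⟨1, one_pos, fun h => absurd h hp⟩
  choose r hr hloc using hloc
  have hc : ∀ p : 𝔼, ∃ c : ℝ, p ∈ Ω → ∀ᵐ x ∂(volume.restrict (ball p (r p))), u x = c := by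
    intro p
    by_cases hp : p ∈ Ω
    · obtain ⟨c, hc⟩ := (hloc p hp).2
      exact ⟨c, fun _ => hc⟩
    · exact ⟨0, fun h => absurd h hp⟩
  choose c hc using hc
  have heq : ∀ x ∈ Ω, ∀ y ∈ Ω, c x = c y := by
    intro x hx y hy
    refine hconn.induction₂ (fun x y => c x = c y) (fun x hx => ?_)
      (fun _ _ _ _ _ _ h1 h2 => h1.trans h2) (fun _ _ _ _ h => h.symm) hx hy
    have hmem : ball x (r x) ∩ Ω ∈ 𝓝[Ω] x :=
      inter_mem (mem_nhdsWithin_of_mem_nhds (ball_mem_nhds x (hr x))) self_mem_nhdsWithin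
    filter_upwards [hmem] with y hy
    set W := ball x (r x) ∩ ball y (r y)
    have hW : IsOpen W := isOpen_ball.inter isOpen_ball
    have hW0 : volume W ≠ 0 := (hW.measure_pos volume ⟨y, hy.1, mem_ball_self (hr y)⟩).ne'
    have h1 : ∀ᵐ z ∂(volume.restrict W), u z = c x :=
      ae_restrict_of_ae_restrict_of_subset inter_subset_left (hc x hx)
    have h2 : ∀ᵐ z ∂(volume.restrict W), u z = c y :=
      ae_restrict_of_ae_restrict_of_subset inter_subset_right (hc y hy.2)
    have hne : (ae ((volume : Measure 𝔼).restrict W)).NeBot := by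
      rw [ae_neBot, Ne, Measure.restrict_eq_zero]
      exact hW0
    obtain ⟨z, hz1, hz2⟩ := (h1.and h2).exists
    exact hz1.symm.trans hz2
  rcases Ω.eq_empty_or_nonempty with h | ⟨p₀, hp₀⟩
  · exact ⟨0, by simp [h, interiorMeasure]⟩
  refine ⟨c p₀, ?_⟩
  rw [interiorMeasure, ae_restrict_iff' hΩ.measurableSet, ae_iff]
  refine measure_null_of_locally_null _ fun x hx => ?_
  have hxΩ : x ∈ Ω := by
    by_contra h
    exact hx fun h' => absurd h' h
  refine ⟨_, inter_mem_nhdsWithin _ (ball_mem_nhds x (hr x)), ?_⟩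
  have h1 := hc x hxΩ
  rw [ae_restrict_iff' measurableSet_ball, ae_iff] at h1
  refine measure_mono_null ?_ h1
  rintro z ⟨hz1, hz2⟩ hz3
  exact hz1 fun _ => (hz3 hz2).trans (heq x hxΩ p₀ hp₀)

section

/-! ### Passing to the limit in `L²` -/

section Limits

variable {α F : Type*} [MeasurableSpace α] {μ : Measure α} [NormedAddCommGroup F]
  [InnerProductSpace ℝ F] {f : ℕ → α → F} {g : α → F}

omit [InnerProductSpace ℝ F] in
theorem tendsto_toLp (hf : ∀ k, MemLp (f k) 2 μ) (hg : MemLp g 2 μ)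
    (h : Tendsto (fun k => eLpNorm (fun x => f k x - g x) 2 μ) atTop (𝓝 0)) :
    Tendsto (fun k => (hf k).toLp (f k)) atTop (𝓝 (hg.toLp g)) :=
  (Lp.tendsto_Lp_iff_tendsto_eLpNorm'' f hf g hg).2 h

theorem inner_toLp {f g : α → F} (hf : MemLp f 2 μ) (hg : MemLp g 2 μ) :
    inner ℝ (hf.toLp f) (hg.toLp g) = ∫ x, inner ℝ (f x) (g x) ∂μ := by
  rw [L2.inner_def]
  refine integral_congr_ae ?_
  filter_upwards [hf.coeFn_toLp, hg.coeFn_toLp] with x h1 h2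
  rw [h1, h2]

theorem tendsto_integral_inner (hf : ∀ k, MemLp (f k) 2 μ) (hg : MemLp g 2 μ)
    (h : Tendsto (fun k => eLpNorm (fun x => f k x - g x) 2 μ) atTop (𝓝 0)) {ψ : α → F}
    (hψ : MemLp ψ 2 μ) :
    Tendsto (fun k => ∫ x, inner ℝ (f k x) (ψ x) ∂μ) atTop (𝓝 (∫ x, inner ℝ (g x) (ψ x) ∂μ)) := by
  have h1 : Tendsto (fun k => inner ℝ ((hf k).toLp (f k)) (hψ.toLp ψ)) atTop
      (𝓝 (inner ℝ (hg.toLp g) (hψ.toLp ψ))) :=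
    (tendsto_toLp hf hg h).inner tendsto_const_nhds
  simpa only [inner_toLp] using h1

theorem tendsto_integral_norm_sq (hf : ∀ k, MemLp (f k) 2 μ) (hg : MemLp g 2 μ)
    (h : Tendsto (fun k => eLpNorm (fun x => f k x - g x) 2 μ) atTop (𝓝 0)) :
    Tendsto (fun k => ∫ x, ‖f k x‖ ^ 2 ∂μ) atTop (𝓝 (∫ x, ‖g x‖ ^ 2 ∂μ)) := by
  have := (tendsto_toLp hf hg h).norm.pow 2
  simpa only [norm_sq_toLp] using this

theorem tendsto_integral_mul {f : ℕ → α → ℝ} {g : α → ℝ} (hf : ∀ k, MemLp (f k) 2 μ)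
    (hg : MemLp g 2 μ)
    (h : Tendsto (fun k => eLpNorm (fun x => f k x - g x) 2 μ) atTop (𝓝 0)) {ψ : α → ℝ}
    (hψ : MemLp ψ 2 μ) :
    Tendsto (fun k => ∫ x, f k x * ψ x ∂μ) atTop (𝓝 (∫ x, g x * ψ x ∂μ)) := by
  have := tendsto_integral_inner hf hg h hψ
  simpa only [RCLike.inner_apply, conj_trivial, mul_comm] using this

theorem tendsto_integral_sq {f : ℕ → α → ℝ} {g : α → ℝ} (hf : ∀ k, MemLp (f k) 2 μ)
    (hg : MemLp g 2 μ)
    (h : Tendsto (fun k => eLpNorm (fun x => f k x - g x) 2 μ) atTop (𝓝 0)) :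
    Tendsto (fun k => ∫ x, f k x ^ 2 ∂μ) atTop (𝓝 (∫ x, g x ^ 2 ∂μ)) := by
  have := tendsto_integral_norm_sq hf hg h
  simpa only [Real.norm_eq_abs, sq_abs] using this

theorem ae_eq_zero_of_integral_sq {g : α → ℝ} (hg : MemLp g 2 μ) (h : ∫ x, g x ^ 2 ∂μ = 0) :
    g =ᵐ[μ] 0 := by
  have h1 := (integral_eq_zero_iff_of_nonneg (fun x => sq_nonneg (g x)) hg.integrable_sq).1 h
  filter_upwards [h1] with x hx
  simpa using hx

end Limits

variable {Ω : Set (EuclideanSpace ℝ (Fin n))}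
  {N : EuclideanSpace ℝ (Fin n) → EuclideanSpace ℝ (Fin n)}

theorem memLp_surface [IsFiniteMeasure (surfaceMeasure Ω)] (hb : Bornology.IsBounded Ω)
    {F : Type*} [NormedAddCommGroup F] [SecondCountableTopology F] {f : 𝔼 → F}
    (hf : Continuous f) : MemLp f 2 (surfaceMeasure Ω) := by
  obtain ⟨C, hC⟩ := (hb.isCompact_closure.of_isClosed_subset isClosed_frontier
    frontier_subset_closure).exists_bound_of_continuousOn hf.continuousOn
  exact MemLp.of_bound hf.aestronglyMeasurable C
    ((ae_restrict_iff' isClosed_frontier.measurableSet).2 (Eventually.of_forall hC))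

/-! ### Inequalities and identities for functions with a trace -/

section Trace

variable {u t : EuclideanSpace ℝ (Fin n) → ℝ}
  {G : EuclideanSpace ℝ (Fin n) → EuclideanSpace ℝ (Fin n)}

/-- The Friedrichs inequality for functions with a trace. -/
theorem exists_friedrichs_of_isTrace (hn : 1 ≤ n) (hΩ : IsOpen Ω) (hb : Bornology.IsBounded Ω)
    (hN : ∀ p ∈ frontier Ω, IsOuterNormalAt Ω p (N p)) (hu : MemLp u 2 (interiorMeasure Ω))
    (hG : MemLp G 2 (interiorMeasure Ω)) (ht : IsTrace Ω u G t) :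
    ∃ C : ℝ, ∫ x in Ω, u x ^ 2 ≤
      C * ((∫ x in Ω, ‖G x‖ ^ 2) + ∫ x, t x ^ 2 ∂(surfaceMeasure Ω)) := by
  have := isFiniteMeasure_surfaceMeasure hΩ hb hN
  obtain ⟨C, hC⟩ := exists_friedrichs hn hΩ hb hN
  obtain ⟨φ, hφ, h1, h2, h3⟩ := ht.approx
  have hgrad : ∀ k, Continuous (gradient (φ k)) := fun k =>
    (hφ k).continuous_gradient (by simp)
  refine ⟨C, le_of_tendsto_of_tendsto'
    (tendsto_integral_sq (fun k => memLp_interior hb (hφ k).continuous) hu h1)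
    (((tendsto_integral_norm_sq (fun k => memLp_interior hb (hgrad k)) hG h2).add
      (tendsto_integral_sq (fun k => memLp_surface hb (hφ k).continuous) ht.memLp h3)).const_mul C)
    fun k => hC (φ k) ((hφ k).of_le (by simp))⟩

/-- The boundary values of a function in `H¹` are controlled by an arbitrarily small multiple of
its Dirichlet energy and a multiple of its `L²` norm. -/
theorem exists_trace_interpolation_of_isTrace (hΩ : IsOpen Ω) (hb : Bornology.IsBounded Ω)
    (hN : ∀ p ∈ frontier Ω, IsOuterNormalAt Ω p (N p)) (hu : MemLp u 2 (interiorMeasure Ω))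
    (hG : MemLp G 2 (interiorMeasure Ω)) (ht : IsTrace Ω u G t) {ε : ℝ} (hε : 0 < ε) :
    ∃ C : ℝ, ∫ x, t x ^ 2 ∂(surfaceMeasure Ω) ≤
      ε * (∫ x in Ω, ‖G x‖ ^ 2) + C * ∫ x in Ω, u x ^ 2 := by
  have := isFiniteMeasure_surfaceMeasure hΩ hb hN
  obtain ⟨C, hC⟩ := exists_trace_interpolation hΩ hb hN hε
  obtain ⟨φ, hφ, h1, h2, h3⟩ := ht.approx
  have hgrad : ∀ k, Continuous (gradient (φ k)) := fun k =>
    (hφ k).continuous_gradient (by simp)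
  refine ⟨C, le_of_tendsto_of_tendsto'
    (tendsto_integral_sq (fun k => memLp_surface hb (hφ k).continuous) ht.memLp h3)
    (((tendsto_integral_norm_sq (fun k => memLp_interior hb (hgrad k)) hG h2).const_mul ε).add
      ((tendsto_integral_sq (fun k => memLp_interior hb (hφ k).continuous) hu h1).const_mul C))
    fun k => hC (φ k) ((hφ k).of_le (by simp))⟩

/-- The divergence theorem for functions with a trace. -/
theorem integral_fderiv_eq_of_isTrace (hΩ : IsOpen Ω) (hb : Bornology.IsBounded Ω)
    (hN : ∀ p ∈ frontier Ω, IsOuterNormalAt Ω p (N p)) (hu : MemLp u 2 (interiorMeasure Ω))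
    (hG : MemLp G 2 (interiorMeasure Ω)) (ht : IsTrace Ω u G t) {ψ : 𝔼 → ℝ}
    (hψ : ContDiff ℝ 1 ψ) (w : 𝔼) :
    (∫ x in Ω, ψ x * inner ℝ (G x) w) + (∫ x in Ω, u x * fderiv ℝ ψ x w) =
      ∫ x, t x * (ψ x * inner ℝ (N x) w) ∂(surfaceMeasure Ω) := by
  have := isFiniteMeasure_surfaceMeasure hΩ hb hN
  obtain ⟨φ, hφ, h1, h2, h3⟩ := ht.approx
  have hφ1 : ∀ k, ContDiff ℝ 1 (φ k) := fun k => (hφ k).of_le (by simp)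
  have hgrad : ∀ k, Continuous (gradient (φ k)) := fun k =>
    (hφ k).continuous_gradient (by simp)
  have hdψ : Continuous fun x => fderiv ℝ ψ x w :=
    (hψ.continuous_fderiv (by simp)).clm_apply continuous_const
  have hNw : ContinuousOn (fun x => ψ x * inner ℝ (N x) w) (frontier Ω) :=
    hψ.continuous.continuousOn.mul ((continuousOn_outerNormal hΩ hN).inner continuousOn_const)
  have hNm : MemLp (fun x => ψ x * inner ℝ (N x) w) 2 (surfaceMeasure Ω) := by
    obtain ⟨C, hC⟩ := (hb.isCompact_closure.of_isClosed_subset isClosed_frontier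
      frontier_subset_closure).exists_bound_of_continuousOn hNw
    exact MemLp.of_bound (integrable_surfaceMeasure_of_continuousOn hb hNw).aestronglyMeasurable C
      ((ae_restrict_iff' isClosed_frontier.measurableSet).2 (Eventually.of_forall hC))
  have l1 : Tendsto (fun k => ∫ x in Ω, ψ x * inner ℝ (gradient (φ k) x) w) atTop
      (𝓝 (∫ x in Ω, ψ x * inner ℝ (G x) w)) := by
    have hψw : Continuous fun x => ψ x • w := hψ.continuous.smul continuous_const
    have := tendsto_integral_inner (fun k => memLp_interior hb (hgrad k)) hG h2
      (memLp_interior hb hψw)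
    simpa only [inner_smul_right, interiorMeasure] using this
  have l2 : Tendsto (fun k => ∫ x in Ω, φ k x * fderiv ℝ ψ x w) atTop
      (𝓝 (∫ x in Ω, u x * fderiv ℝ ψ x w)) :=
    tendsto_integral_mul (fun k => memLp_interior hb (hφ k).continuous) hu h1
      (memLp_interior hb hdψ)
  have l3 := tendsto_integral_mul (fun k => memLp_surface hb (hφ k).continuous) ht.memLp h3 hNm
  refine tendsto_nhds_unique (l1.add l2) (l3.congr fun k => ?_)
  have h4 := integral_fderiv_eq_surface hΩ hb hN ((hφ1 k).mul hψ) w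
  have h5 : ∀ x, fderiv ℝ (fun x => φ k x * ψ x) x w =
      ψ x * inner ℝ (gradient (φ k) x) w + φ k x * fderiv ℝ ψ x w := by
    intro x
    rw [fderiv_fun_mul ((hφ1 k).differentiable (by simp) x) (hψ.differentiable (by simp) x),
      inner_gradient]
    simp [add_comm]
  simp_rw [h5] at h4
  rw [← integral_add]
  · rw [h4]
    exact integral_congr_ae (Eventually.of_forall fun x => by ring)
  · exact (hψ.continuous.mul ((hgrad k).inner continuous_const)).integrableOn_of_isBounded hb
  · exact ((hφ k).continuous.mul hdψ).integrableOn_of_isBounded hb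

/-- The limit of the gradients in the definition of the trace is the weak gradient. -/
theorem hasWeakGradient_of_isTrace (hΩ : IsOpen Ω) (hb : Bornology.IsBounded Ω)
    (hN : ∀ p ∈ frontier Ω, IsOuterNormalAt Ω p (N p)) (hu : MemLp u 2 (interiorMeasure Ω))
    (hG : MemLp G 2 (interiorMeasure Ω)) (ht : IsTrace Ω u G t) : HasWeakGradient Ω u G := by
  intro ψ hψ hψc hψΩ
  have hψ1 : ContDiff ℝ 1 ψ := hψ.of_le (by simp)
  have hg : Continuous (gradient ψ) := hψ.continuous_gradient (by simp)
  have i1 : Integrable (fun x => u x • gradient ψ x) (interiorMeasure Ω) :=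
    memLp_one_iff_integrable.1 ((memLp_interior hb hg).smul hu)
  have i2 : Integrable (fun x => ψ x • G x) (interiorMeasure Ω) :=
    memLp_one_iff_integrable.1 (hG.smul (memLp_interior hb hψ.continuous))
  refine ext_inner_left ℝ fun w => ?_
  rw [inner_neg_right, ← integral_inner i1, ← integral_inner i2, eq_neg_iff_add_eq_zero]
  have h := integral_fderiv_eq_of_isTrace hΩ hb hN hu hG ht hψ1 w
  have h0 : ∫ x, t x * (ψ x * inner ℝ (N x) w) ∂(surfaceMeasure Ω) = 0 := by
    refine integral_eq_zero_of_ae ((ae_restrict_iff' isClosed_frontier.measurableSet).2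
      (Eventually.of_forall fun x hx => ?_))
    have : ψ x = 0 := by
      by_contra h0
      have := hψΩ (subset_tsupport ψ h0)
      rw [hΩ.frontier_eq] at hx
      exact hx.2 this
    simp [this]
  rw [h0, add_comm] at h
  rw [← h]
  congr 1
  · exact integral_congr_ae (Eventually.of_forall fun x => by
      simp only [inner_smul_right, real_inner_comm (gradient ψ x) w, inner_gradient])
  · exact integral_congr_ae (Eventually.of_forall fun x => by
      simp only [inner_smul_right, real_inner_comm (G x) w])

end Trace

end

section

/-! ### Existence of the first nonzero eigenvalue -/

/-- The space of smooth functions on `ℝⁿ`. -/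
def smoothFunctions (n : ℕ) : Submodule ℝ (EuclideanSpace ℝ (Fin n) → ℝ) where
  carrier := {φ | ContDiff ℝ ∞ φ}
  add_mem' h1 h2 := by
    rw [mem_ofPred_eq] at *
    exact h1.add h2
  zero_mem' := by
    rw [mem_ofPred_eq]
    exact contDiff_const
  smul_mem' c _ h := by
    rw [mem_ofPred_eq] at *
    exact h.const_smul c

theorem mem_smoothFunctions {φ : 𝔼 → ℝ} : φ ∈ smoothFunctions n ↔ ContDiff ℝ ∞ φ := by
  rw [← SetLike.mem_coe]
  exact mem_ofPred_eq ▸ Iff.rfl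

theorem smoothFunctions.contDiff (φ : smoothFunctions n) : ContDiff ℝ ∞ φ.1 :=
  mem_smoothFunctions.1 φ.2

theorem gradient_add {f g : 𝔼 → ℝ} (hf : ContDiff ℝ 1 f) (hg : ContDiff ℝ 1 g) (x : 𝔼) :
    gradient (f + g) x = gradient f x + gradient g x := by
  refine ext_inner_right ℝ fun v => ?_
  rw [inner_add_left, inner_gradient, inner_gradient, inner_gradient,
    fderiv_add (hf.differentiable (by simp) x) (hg.differentiable (by simp) x)]
  rfl

theorem gradient_const_smul {f : 𝔼 → ℝ} (hf : ContDiff ℝ 1 f) (c : ℝ) (x : 𝔼) :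
    gradient (c • f) x = c • gradient f x := by
  refine ext_inner_right ℝ fun v => ?_
  rw [inner_smul_left, inner_gradient, inner_gradient,
    fderiv_const_smul (hf.differentiable (by simp) x)]
  rfl

theorem gradient_sub_const (f : 𝔼 → ℝ) (c : ℝ) (x : 𝔼) :
    gradient (fun x => f x - c) x = gradient f x := by
  rw [gradient, gradient, fderiv_sub_const]

/-- The map sending a smooth function to its class in `L²(μ)`. -/
noncomputable def smoothToLp (μ : Measure (EuclideanSpace ℝ (Fin n)))
    (h : ∀ f : EuclideanSpace ℝ (Fin n) → ℝ, Continuous f → MemLp f 2 μ) :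
    smoothFunctions n →ₗ[ℝ] Lp ℝ 2 μ where
  toFun φ := (h φ.1 (smoothFunctions.contDiff φ).continuous).toLp φ.1
  map_add' _ _ := rfl
  map_smul' _ _ := rfl

/-- The map sending a smooth function to the class of its gradient in `L²(μ)`. -/
noncomputable def smoothGradientToLp (μ : Measure (EuclideanSpace ℝ (Fin n)))
    (h : ∀ f : EuclideanSpace ℝ (Fin n) → EuclideanSpace ℝ (Fin n), Continuous f → MemLp f 2 μ) :
    smoothFunctions n →ₗ[ℝ] Lp (EuclideanSpace ℝ (Fin n)) 2 μ where
  toFun φ := (h _ ((smoothFunctions.contDiff φ).continuous_gradient (by simp))).toLp (gradient φ.1)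
  map_add' φ ψ := by
    rw [← MemLp.toLp_add]
    exact MemLp.toLp_congr _ _ (Eventually.of_forall fun x =>
      gradient_add ((smoothFunctions.contDiff φ).of_le (by simp)) ((smoothFunctions.contDiff ψ).of_le (by simp)) x)
  map_smul' c φ := by
    rw [RingHom.id_apply, ← MemLp.toLp_const_smul]
    exact MemLp.toLp_congr _ _ (Eventually.of_forall fun x =>
      gradient_const_smul ((smoothFunctions.contDiff φ).of_le (by simp)) c x)

/-- Integration as a functional on smooth functions. -/
noncomputable def smoothIntegral (μ : Measure (EuclideanSpace ℝ (Fin n)))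
    (h : ∀ f : EuclideanSpace ℝ (Fin n) → ℝ, Continuous f → Integrable f μ) :
    smoothFunctions n →ₗ[ℝ] ℝ where
  toFun φ := ∫ x, φ.1 x ∂μ
  map_add' φ ψ := integral_add (h _ (smoothFunctions.contDiff φ).continuous) (h _ (smoothFunctions.contDiff ψ).continuous)
  map_smul' c _ := integral_const_mul c _

variable {Ω : Set (EuclideanSpace ℝ (Fin n))}
  {N : EuclideanSpace ℝ (Fin n) → EuclideanSpace ℝ (Fin n)}

/-- The boundary is not concentrated at a point. -/
theorem exists_coord_sub_ne_zero (hn : 1 ≤ n) (hΩ : IsOpen Ω) (hne : Ω.Nonempty)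
    (hb : Bornology.IsBounded Ω) (hN : ∀ p ∈ frontier Ω, IsOuterNormalAt Ω p (N p)) (m : ℝ) :
    ¬ ∀ᵐ x ∂(surfaceMeasure Ω), x (⟨0, hn⟩ : Fin n) - m = 0 := by
  intro h
  set i : Fin n := ⟨0, hn⟩
  have hf : ContDiff ℝ 1 fun x : 𝔼 => x i - m := by fun_prop
  have h1 := integral_fderiv_eq_surface hΩ hb hN hf (EuclideanSpace.single i 1)
  have h2 : ∀ x : 𝔼, fderiv ℝ (fun x : 𝔼 => x i - m) x (EuclideanSpace.single i 1) = 1 := by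
    intro x
    rw [fderiv_sub_const]
    have : fderiv ℝ (fun x : 𝔼 => x i) x = EuclideanSpace.proj i :=
      (EuclideanSpace.proj (𝕜 := ℝ) i).fderiv
    rw [this]
    simp
  have h3 : ∫ x, (x i - m) * inner ℝ (N x) (EuclideanSpace.single i 1) ∂(surfaceMeasure Ω) = 0 :=
    integral_eq_zero_of_ae (by
      filter_upwards [h] with x hx
      simp [hx])
  rw [h3] at h1
  simp only [h2, integral_const, smul_eq_mul, mul_one] at h1
  rw [measureReal_restrict_apply_univ, measureReal_eq_zero_iff hb.measure_lt_top.ne] at h1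
  exact (hΩ.measure_pos volume hne).ne' h1

theorem surfaceMeasure_real_pos (hn : 1 ≤ n) (hΩ : IsOpen Ω) (hne : Ω.Nonempty)
    (hb : Bornology.IsBounded Ω) (hN : ∀ p ∈ frontier Ω, IsOuterNormalAt Ω p (N p)) :
    0 < (surfaceMeasure Ω).real univ := by
  have := isFiniteMeasure_surfaceMeasure hΩ hb hN
  refine lt_of_le_of_ne measureReal_nonneg fun h => ?_
  refine exists_coord_sub_ne_zero hn hΩ hne hb hN 0 ?_
  rw [eq_comm, measureReal_eq_zero_iff, Measure.measure_univ_eq_zero] at h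
  rw [h]
  simp

/-- Boundedness of the Dirichlet energy and of the boundary values implies precompactness of the
boundary values in `L²`. -/
theorem exists_subseq_cauchy_surface (hn : 1 ≤ n) (hΩ : IsOpen Ω)
    (hb : Bornology.IsBounded Ω) (hN : ∀ p ∈ frontier Ω, IsOuterNormalAt Ω p (N p))
    {φ : ℕ → 𝔼 → ℝ} (hφ : ∀ k, ContDiff ℝ 1 (φ k)) {M : ℝ}
    (hG : ∀ k, ∫ x in Ω, ‖gradient (φ k) x‖ ^ 2 ≤ M)
    (hB : ∀ k, ∫ x, φ k x ^ 2 ∂(surfaceMeasure Ω) ≤ M) :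
    ∃ s : ℕ → ℕ, StrictMono s ∧ Tendsto (fun q : ℕ × ℕ =>
      ∫ x, (φ (s q.1) x - φ (s q.2) x) ^ 2 ∂(surfaceMeasure Ω)) atTop (𝓝 0) := by
  obtain ⟨C, hC⟩ := exists_friedrichs hn hΩ hb hN
  have hM0 : 0 ≤ M := (integral_nonneg fun _ => sq_nonneg _).trans (hB 0)
  have hA : ∀ k, ∫ x in Ω, φ k x ^ 2 ≤ max M (|C| * (M + M)) := by
    intro k
    refine ((hC (φ k) (hφ k)).trans ?_).trans (le_max_right _ _)
    have h0 : 0 ≤ (∫ x in Ω, ‖gradient (φ k) x‖ ^ 2) + ∫ x, φ k x ^ 2 ∂(surfaceMeasure Ω) :=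
      add_nonneg (integral_nonneg fun _ => sq_nonneg _) (integral_nonneg fun _ => sq_nonneg _)
    exact (mul_le_mul_of_nonneg_right (le_abs_self C) h0).trans
      (mul_le_mul_of_nonneg_left (add_le_add (hG k) (hB k)) (abs_nonneg C))
  obtain ⟨s, hs, hlim⟩ := exists_subseq_cauchy_L2 hΩ hb hN hφ hA
    fun k => (hG k).trans (le_max_left _ _)
  refine ⟨s, hs, ?_⟩
  rw [Metric.tendsto_nhds]
  intro ε hε
  obtain ⟨D, hD⟩ := exists_trace_interpolation hΩ hb hN (ε := ε / (2 * (4 * M + 1)))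
    (by positivity)
  have h1 : Tendsto (fun q : ℕ × ℕ => D * ∫ x in Ω, (φ (s q.1) x - φ (s q.2) x) ^ 2) atTop
      (𝓝 (D * 0)) := hlim.const_mul D
  rw [mul_zero] at h1
  filter_upwards [h1.eventually (gt_mem_nhds (half_pos hε))] with q hq
  rw [Real.dist_eq, sub_zero, abs_of_nonneg (integral_nonneg fun _ => sq_nonneg _)]
  have hdiff : ContDiff ℝ 1 fun x => φ (s q.1) x - φ (s q.2) x := (hφ _).sub (hφ _)
  have h2 := hD _ hdiff
  have hgi : ∀ f : 𝔼 → ℝ, ContDiff ℝ 1 f → IntegrableOn (fun x => ‖gradient f x‖ ^ 2) Ω :=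
    fun f hf => ((hf.continuous_gradient (by simp)).norm.pow 2).integrableOn_of_isBounded hb
  have h3 : ∫ x in Ω, ‖gradient (fun x => φ (s q.1) x - φ (s q.2) x) x‖ ^ 2 ≤ 4 * M := by
    have h4 : ∫ x in Ω, ‖gradient (fun x => φ (s q.1) x - φ (s q.2) x) x‖ ^ 2 ≤
        ∫ x in Ω, (2 * ‖gradient (φ (s q.1)) x‖ ^ 2 + 2 * ‖gradient (φ (s q.2)) x‖ ^ 2) := by
      refine integral_mono (hgi _ hdiff)
        (((hgi _ (hφ _)).const_mul 2).add ((hgi _ (hφ _)).const_mul 2)) fun x => ?_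
      dsimp only
      rw [gradient_sub (hφ _) (hφ _)]
      have h5 := parallelogram_law_with_norm ℝ (gradient (φ (s q.1)) x) (gradient (φ (s q.2)) x)
      nlinarith [norm_nonneg (gradient (φ (s q.1)) x + gradient (φ (s q.2)) x)]
    rw [integral_add ((hgi _ (hφ _)).const_mul 2) ((hgi _ (hφ _)).const_mul 2),
      integral_const_mul, integral_const_mul] at h4
    linarith [hG (s q.1), hG (s q.2)]
  have h6 : ε / (2 * (4 * M + 1)) *
      (∫ x in Ω, ‖gradient (fun x => φ (s q.1) x - φ (s q.2) x) x‖ ^ 2) ≤ ε / 2 := by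
    calc _ ≤ ε / (2 * (4 * M + 1)) * (4 * M) := mul_le_mul_of_nonneg_left h3 (by positivity)
      _ ≤ ε / (2 * (4 * M + 1)) * (4 * M + 1) :=
          mul_le_mul_of_nonneg_left (by linarith) (by positivity)
      _ = ε / 2 := by field_simp
  linarith

end

section

variable {Ω : Set (EuclideanSpace ℝ (Fin n))}
  {N : EuclideanSpace ℝ (Fin n) → EuclideanSpace ℝ (Fin n)}

theorem IsSteklovSolution.energy_eq (hΩ : IsOpen Ω) (hb : Bornology.IsBounded Ω)
    (hN : ∀ p ∈ frontier Ω, IsOuterNormalAt Ω p (N p)) {ν : ℝ} {u t : 𝔼 → ℝ} {G : 𝔼 → 𝔼}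
    (h : IsSteklovSolution Ω ν u G t) :
    ∫ x in Ω, ‖G x‖ ^ 2 = ν * ∫ x, t x ^ 2 ∂(surfaceMeasure Ω) := by
  have := isFiniteMeasure_surfaceMeasure hΩ hb hN
  obtain ⟨φ, hφ, h1, h2, h3⟩ := h.isTrace.approx
  have hgrad : ∀ k, Continuous (gradient (φ k)) := fun k =>
    (hφ k).continuous_gradient (by simp)
  have l1 := tendsto_integral_inner (fun k => memLp_interior hb (hgrad k)) h.memH1.memLp_grad h2
    h.memH1.memLp_grad
  have l2 := (tendsto_integral_mul (fun k => memLp_surface hb (hφ k).continuous) h.isTrace.memLp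
    h3 h.isTrace.memLp).const_mul ν
  have l3 := tendsto_nhds_unique l1 (l2.congr fun k => by
    simp only [real_inner_comm (G _), mul_comm (φ k _)]
    exact (h.weakForm _ (hφ k)).symm)
  simp only [real_inner_self_eq_norm_sq, ← pow_two] at l3
  exact l3

theorem IsSteklovSolution.integral_trace_eq_zero {ν : ℝ} (hν : ν ≠ 0) {u t : 𝔼 → ℝ}
    {G : 𝔼 → 𝔼} (h : IsSteklovSolution Ω ν u G t) : ∫ x, t x ∂(surfaceMeasure Ω) = 0 := by
  have h1 := h.weakForm (fun _ => 1) contDiff_const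
  simp only [gradient_fun_const, inner_zero_right, integral_zero, mul_one] at h1
  exact (mul_eq_zero.1 h1.symm).resolve_left hν

/-- An eigenfunction with vanishing boundary values has vanishing energy, hence is zero. -/
theorem IsSteklovSolution.integral_trace_sq_pos (hn : 1 ≤ n) (hΩ : IsOpen Ω)
    (hb : Bornology.IsBounded Ω) (hN : ∀ p ∈ frontier Ω, IsOuterNormalAt Ω p (N p)) {ν : ℝ}
    {u t : 𝔼 → ℝ} {G : 𝔼 → 𝔼} (h : IsSteklovSolution Ω ν u G t)
    (hu : ¬ u =ᵐ[interiorMeasure Ω] 0) : 0 < ∫ x, t x ^ 2 ∂(surfaceMeasure Ω) := by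
  refine lt_of_le_of_ne (integral_nonneg fun _ => sq_nonneg _) fun h0 => hu ?_
  obtain ⟨C, hC⟩ := exists_friedrichs_of_isTrace hn hΩ hb hN h.memH1.memLp h.memH1.memLp_grad
    h.isTrace
  rw [h.energy_eq hΩ hb hN, ← h0, mul_zero, add_zero, mul_zero] at hC
  exact ae_eq_zero_of_integral_sq h.memH1.memLp
    (le_antisymm hC (integral_nonneg fun _ => sq_nonneg _))

/-- A constant in the Rayleigh inequality for smooth functions is a lower bound for the nonzero
eigenvalues. -/
theorem le_of_mem_nonzeroSteklovEigenvalues (hn : 1 ≤ n) (hΩ : IsOpen Ω) (hne : Ω.Nonempty)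
    (hb : Bornology.IsBounded Ω) (hN : ∀ p ∈ frontier Ω, IsOuterNormalAt Ω p (N p)) {l ν : ℝ}
    (hl : ∀ φ : 𝔼 → ℝ, ContDiff ℝ ∞ φ → ∫ x, φ x ∂(surfaceMeasure Ω) = 0 →
      l * ∫ x, φ x ^ 2 ∂(surfaceMeasure Ω) ≤ ∫ x in Ω, ‖gradient φ x‖ ^ 2)
    (hν : ν ∈ nonzeroSteklovEigenvalues Ω) : l ≤ ν := by
  have := isFiniteMeasure_surfaceMeasure hΩ hb hN
  rw [nonzeroSteklovEigenvalues, mem_ofPred_eq] at hν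
  obtain ⟨hν0, u, G, t, h, hu⟩ := hν
  have hpos := h.integral_trace_sq_pos hn hΩ hb hN hu
  have hmean := h.integral_trace_eq_zero hν0
  have hen := h.energy_eq hΩ hb hN
  set S := (surfaceMeasure Ω).real univ with hS
  have hS0 : 0 < S := surfaceMeasure_real_pos hn hΩ hne hb hN
  obtain ⟨φ, hφ, h1, h2, h3⟩ := h.isTrace.approx
  have hgrad : ∀ k, Continuous (gradient (φ k)) := fun k =>
    (hφ k).continuous_gradient (by simp)
  have hm : ∀ k, MemLp (φ k) 2 (surfaceMeasure Ω) := fun k => memLp_surface hb (hφ k).continuous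
  have l1 := tendsto_integral_norm_sq (fun k => memLp_interior hb (hgrad k))
    h.memH1.memLp_grad h2
  have l2 := tendsto_integral_sq hm h.isTrace.memLp h3
  have l3 : Tendsto (fun k => ∫ x, φ k x ∂(surfaceMeasure Ω)) atTop
      (𝓝 (∫ x, t x ∂(surfaceMeasure Ω))) := by
    simpa using tendsto_integral_mul hm h.isTrace.memLp h3 (memLp_const (1 : ℝ))
  rw [hmean] at l3
  -- the Rayleigh inequality holds for `φ k` minus its boundary mean, which tends to zero
  have hlim := le_of_tendsto_of_tendsto'
    ((l2.sub ((l3.pow 2).div_const S)).const_mul l) l1 fun k => by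
      set m := (∫ x, φ k x ∂(surfaceMeasure Ω)) / S with hmdef
      have i1 : Integrable (φ k) (surfaceMeasure Ω) := (hm k).integrable (by norm_num)
      have i2 : Integrable (fun x => φ k x ^ 2) (surfaceMeasure Ω) := (hm k).integrable_sq
      have e1 : ∫ x, (φ k x - m) ∂(surfaceMeasure Ω) = 0 := by
        rw [integral_sub i1 (integrable_const _), integral_const, smul_eq_mul, ← hS, hmdef]
        field_simp
        ring
      have e2 : ∫ x, (φ k x - m) ^ 2 ∂(surfaceMeasure Ω) =
          (∫ x, φ k x ^ 2 ∂(surfaceMeasure Ω)) -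
            (∫ x, φ k x ∂(surfaceMeasure Ω)) ^ 2 / S := by
        have e3 : ∀ x, (φ k x - m) ^ 2 = φ k x ^ 2 - 2 * m * φ k x + m ^ 2 := fun x => by ring
        simp_rw [e3]
        have i3 : Integrable (fun x => φ k x ^ 2 - 2 * m * φ k x) (surfaceMeasure Ω) :=
          i2.sub (i1.const_mul _)
        rw [integral_add i3 (integrable_const _), integral_sub i2 (i1.const_mul _),
          integral_const_mul, integral_const, smul_eq_mul, ← hS, hmdef]
        field_simp
        ring
      have e4 := hl (fun x => φ k x - m) ((hφ k).sub contDiff_const) e1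
      rw [e2] at e4
      simp only [gradient_sub_const] at e4
      exact e4
  change _ ≤ ∫ x in Ω, ‖G x‖ ^ 2 at hlim
  rw [hen] at hlim
  simp only [ne_eq, OfNat.ofNat_ne_zero, not_false_eq_true, zero_pow, zero_div, sub_zero] at hlim
  exact le_of_mul_le_mul_right hlim hpos

theorem integral_sub_mean (hn : 1 ≤ n) (hΩ : IsOpen Ω) (hne : Ω.Nonempty)
    (hb : Bornology.IsBounded Ω) (hN : ∀ p ∈ frontier Ω, IsOuterNormalAt Ω p (N p)) {φ : 𝔼 → ℝ}
    (hφ : Continuous φ) :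
    ∫ x, (φ x - (∫ x, φ x ∂(surfaceMeasure Ω)) / (surfaceMeasure Ω).real univ)
      ∂(surfaceMeasure Ω) = 0 := by
  have := isFiniteMeasure_surfaceMeasure hΩ hb hN
  have hS0 := surfaceMeasure_real_pos hn hΩ hne hb hN
  rw [integral_sub ((memLp_surface hb hφ).integrable (by norm_num)) (integrable_const _),
    integral_const, smul_eq_mul, mul_div_cancel₀ _ hS0.ne', sub_self]

/-- A minimiser of the Rayleigh quotient among the functions with mean zero on the boundary,
together with a minimising sequence. -/
theorem exists_rayleigh_minimizer_of_domain (hn : 1 ≤ n) (hΩ : IsOpen Ω) (hne : Ω.Nonempty)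
    (hb : Bornology.IsBounded Ω) (hN : ∀ p ∈ frontier Ω, IsOuterNormalAt Ω p (N p)) :
    ∃ (l : ℝ) (φ : ℕ → 𝔼 → ℝ) (u t : 𝔼 → ℝ) (G : 𝔼 → 𝔼), 0 ≤ l ∧
      MemLp u 2 (interiorMeasure Ω) ∧ MemLp G 2 (interiorMeasure Ω) ∧
      MemLp t 2 (surfaceMeasure Ω) ∧ (∀ k, ContDiff ℝ ∞ (φ k)) ∧
      (∀ k, ∫ x, φ k x ∂(surfaceMeasure Ω) = 0) ∧
      Tendsto (fun k => eLpNorm (fun x => φ k x - u x) 2 (interiorMeasure Ω)) atTop (𝓝 0) ∧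
      Tendsto (fun k => eLpNorm (fun x => gradient (φ k) x - G x) 2 (interiorMeasure Ω)) atTop
        (𝓝 0) ∧
      Tendsto (fun k => eLpNorm (fun x => φ k x - t x) 2 (surfaceMeasure Ω)) atTop (𝓝 0) ∧
      ∫ x in Ω, ‖G x‖ ^ 2 = l ∧ ∫ x, t x ^ 2 ∂(surfaceMeasure Ω) = 1 ∧
      (∀ ψ : 𝔼 → ℝ, ContDiff ℝ ∞ ψ → ∫ x, ψ x ∂(surfaceMeasure Ω) = 0 →
        l * ∫ x, ψ x ^ 2 ∂(surfaceMeasure Ω) ≤ ∫ x in Ω, ‖gradient ψ x‖ ^ 2) ∧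
      (∀ ψ : 𝔼 → ℝ, ContDiff ℝ ∞ ψ → ∫ x, ψ x ∂(surfaceMeasure Ω) = 0 →
        ∫ x, inner ℝ (G x) (gradient ψ x) ∂(interiorMeasure Ω) =
          l * ∫ x, t x * ψ x ∂(surfaceMeasure Ω)) := by
  have := isFiniteMeasure_surfaceMeasure hΩ hb hN
  set σ := surfaceMeasure Ω with hσ
  have hI : ∀ f : 𝔼 → ℝ, Continuous f → MemLp f 2 (interiorMeasure Ω) :=
    fun f hf => memLp_interior hb hf
  have hI' : ∀ f : 𝔼 → 𝔼, Continuous f → MemLp f 2 (interiorMeasure Ω) :=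
    fun f hf => memLp_interior hb hf
  have hB : ∀ f : 𝔼 → ℝ, Continuous f → MemLp f 2 σ := fun f hf => memLp_surface hb hf
  have hB1 : ∀ f : 𝔼 → ℝ, Continuous f → Integrable f σ :=
    fun f hf => (hB f hf).integrable (by norm_num)
  obtain ⟨V, hV⟩ : ∃ V : Submodule ℝ (smoothFunctions n), ∀ φ, φ ∈ V ↔ ∫ x, φ.1 x ∂σ = 0 :=
    ⟨LinearMap.ker (smoothIntegral σ hB1), fun _ => Iff.rfl⟩
  have hs : ∀ φ : V, ContDiff ℝ ∞ φ.1.1 := fun φ => smoothFunctions.contDiff φ.1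
  have hs1 : ∀ φ : V, ContDiff ℝ 1 φ.1.1 := fun φ => (hs φ).of_le (by simp)
  have hmean : ∀ φ : V, ∫ x, φ.1.1 x ∂σ = 0 := fun φ => (hV φ.1).1 φ.2
  have hsg : ∀ φ : V, Continuous (gradient φ.1.1) := fun φ =>
    (hs φ).continuous_gradient (by simp)
  obtain ⟨a, ha⟩ : ∃ a : V →ₗ[ℝ] Lp ℝ 2 (interiorMeasure Ω),
      ∀ φ : V, a φ = (hI _ (hs φ).continuous).toLp φ.1.1 :=
    ⟨(smoothToLp (interiorMeasure Ω) hI).comp V.subtype, fun _ => rfl⟩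
  obtain ⟨g, hg⟩ : ∃ g : V →ₗ[ℝ] Lp 𝔼 2 (interiorMeasure Ω),
      ∀ φ : V, g φ = (hI' _ (hsg φ)).toLp (gradient φ.1.1) :=
    ⟨(smoothGradientToLp (interiorMeasure Ω) hI').comp V.subtype, fun _ => rfl⟩
  obtain ⟨b, hbe⟩ : ∃ b : V →ₗ[ℝ] Lp ℝ 2 σ,
      ∀ φ : V, b φ = (hB _ (hs φ).continuous).toLp φ.1.1 :=
    ⟨(smoothToLp σ hB).comp V.subtype, fun _ => rfl⟩
  have na : ∀ φ : V, ‖a φ‖ ^ 2 = ∫ x in Ω, φ.1.1 x ^ 2 := fun φ => by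
    rw [ha, norm_sq_toLp]
    simp only [Real.norm_eq_abs, sq_abs, interiorMeasure]
  have nb : ∀ φ : V, ‖b φ‖ ^ 2 = ∫ x, φ.1.1 x ^ 2 ∂σ := fun φ => by
    rw [hbe, norm_sq_toLp]
    simp only [Real.norm_eq_abs, sq_abs]
  have ng : ∀ φ : V, ‖g φ‖ ^ 2 = ∫ x in Ω, ‖gradient φ.1.1 x‖ ^ 2 := fun φ => by
    rw [hg, norm_sq_toLp, interiorMeasure]
  obtain ⟨C, hC⟩ := exists_friedrichs hn hΩ hb hN
  have hF : ∀ φ : V, ‖a φ‖ ^ 2 ≤ C * (‖g φ‖ ^ 2 + ‖b φ‖ ^ 2) := fun φ => by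
    rw [na, nb, ng]
    exact hC _ (hs1 φ)
  have hK : ∀ (φ : ℕ → V) (M : ℝ), (∀ k, ‖g (φ k)‖ ^ 2 ≤ M ∧ ‖b (φ k)‖ ^ 2 ≤ M) →
      ∃ s : ℕ → ℕ, StrictMono s ∧ CauchySeq fun k => b (φ (s k)) := by
    intro φ M hM
    obtain ⟨s, hs', hlim⟩ := exists_subseq_cauchy_surface hn hΩ hb hN
      (φ := fun k => (φ k).1.1) (fun k => hs1 (φ k)) (M := M)
      (fun k => by rw [← ng]; exact (hM k).1) (fun k => by rw [← nb]; exact (hM k).2)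
    refine ⟨s, hs', ?_⟩
    rw [cauchySeq_iff_tendsto_dist_atTop_0]
    have h1 := (Real.continuous_sqrt.tendsto 0).comp hlim
    rw [Real.sqrt_zero] at h1
    refine h1.congr fun q => ?_
    rw [dist_eq_norm, ← map_sub, ← Real.sqrt_sq (norm_nonneg _), nb]
    rfl
  have hbne : ∃ φ, b φ ≠ 0 := by
    have hco : ContDiff ℝ ∞ fun x : 𝔼 => x (⟨0, hn⟩ : Fin n) := by fun_prop
    set m := (∫ x : 𝔼, x (⟨0, hn⟩ : Fin n) ∂σ) / σ.real univ
    have hsub := hco.sub (contDiff_const (c := m))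
    refine ⟨⟨⟨_, mem_smoothFunctions.2 hsub⟩,
      (hV _).2 (integral_sub_mean hn hΩ hne hb hN hco.continuous)⟩, fun h0 => ?_⟩
    have h1 := nb ⟨⟨_, mem_smoothFunctions.2 hsub⟩,
      (hV _).2 (integral_sub_mean hn hΩ hne hb hN hco.continuous)⟩
    rw [h0, norm_zero, zero_pow two_ne_zero] at h1
    exact exists_coord_sub_ne_zero hn hΩ hne hb hN m
      (ae_eq_zero_of_integral_sq (hB _ hsub.continuous) h1.symm)
  -- giving the three spaces explicitly avoids an expensive unification
  have key := @exists_rayleigh_minimizer V (Lp ℝ 2 (interiorMeasure Ω))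
    (Lp 𝔼 2 (interiorMeasure Ω)) (Lp ℝ 2 σ) _ _ _ _ _ _ _ _ _ _ _
  obtain ⟨l, φ, x, y, z, hl0, hmin, hx, hy, hz, hz1, hyl, hEL⟩ := @key a g b C hF hK hbne
  refine ⟨l, fun k => (φ k).1.1, x, z, y, hl0, Lp.memLp x, Lp.memLp y, Lp.memLp z,
    fun k => hs (φ k), fun k => hmean (φ k), ?_, ?_, ?_, ?_, ?_, fun ψ hψ hψ0 => ?_,
    fun ψ hψ hψ0 => ?_⟩
  · refine (Lp.tendsto_Lp_iff_tendsto_eLpNorm'' _ (fun k => hI _ (hs (φ k)).continuous) x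
      (Lp.memLp x)).1 ?_
    rw [Lp.toLp_coeFn]
    simpa only [ha] using hx
  · refine (Lp.tendsto_Lp_iff_tendsto_eLpNorm'' _ (fun k => hI' _ (hsg (φ k))) y
      (Lp.memLp y)).1 ?_
    rw [Lp.toLp_coeFn]
    simpa only [hg] using hy
  · refine (Lp.tendsto_Lp_iff_tendsto_eLpNorm'' _ (fun k => hB _ (hs (φ k)).continuous) z
      (Lp.memLp z)).1 ?_
    rw [Lp.toLp_coeFn]
    simpa only [hbe] using hz
  · have := norm_sq_toLp (Lp.memLp y)
    rw [Lp.toLp_coeFn, hyl] at this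
    exact this.symm
  · have := norm_sq_toLp (Lp.memLp z)
    rw [Lp.toLp_coeFn, hz1] at this
    simpa only [one_pow, Real.norm_eq_abs, sq_abs, eq_comm] using this
  · have := hmin ⟨⟨ψ, mem_smoothFunctions.2 hψ⟩, (hV _).2 hψ0⟩
    rwa [nb, ng] at this
  · have h1 := hEL ⟨⟨ψ, mem_smoothFunctions.2 hψ⟩, (hV _).2 hψ0⟩
    rw [hg, hbe] at h1
    have h2 := inner_toLp (Lp.memLp y) (hI' _ (hψ.continuous_gradient (by simp)))
    have h3 := inner_toLp (Lp.memLp z) (hB _ hψ.continuous)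
    rw [Lp.toLp_coeFn] at h2 h3
    rw [← h2, h1, h3]
    congr 1
    exact integral_congr_ae (Eventually.of_forall fun p => by
      simp only [RCLike.inner_apply, conj_trivial, mul_comm])

/-- The Rayleigh quotient has a positive minimum among the functions with mean zero on the
boundary, which is an eigenvalue. -/
theorem exists_pos_eigenvalue_rayleigh (hn : 1 ≤ n) (hΩ : IsOpen Ω) (hconn : IsConnected Ω)
    (hb : Bornology.IsBounded Ω) (hN : ∀ p ∈ frontier Ω, IsOuterNormalAt Ω p (N p)) :
    ∃ l : ℝ, 0 < l ∧ IsSteklovEigenvalue Ω l ∧ ∀ φ : 𝔼 → ℝ, ContDiff ℝ ∞ φ →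
      ∫ x, φ x ∂(surfaceMeasure Ω) = 0 →
        l * ∫ x, φ x ^ 2 ∂(surfaceMeasure Ω) ≤ ∫ x in Ω, ‖gradient φ x‖ ^ 2 := by
  have := isFiniteMeasure_surfaceMeasure hΩ hb hN
  have hne := hconn.nonempty
  have hI : ∀ f : 𝔼 → ℝ, Continuous f → MemLp f 2 (interiorMeasure Ω) :=
    fun f hf => memLp_interior hb hf
  have hB : ∀ f : 𝔼 → ℝ, Continuous f → MemLp f 2 (surfaceMeasure Ω) :=
    fun f hf => memLp_surface hb hf
  have hB1 : ∀ f : 𝔼 → ℝ, Continuous f → Integrable f (surfaceMeasure Ω) :=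
    fun f hf => (hB f hf).integrable (by norm_num)
  obtain ⟨l, φ, x, z, y, hl0, hxm, hym, hzm2, hs, hmean, hx2, hy2, hz2, hyl', hzl', hmin, hEL⟩ :=
    exists_rayleigh_minimizer_of_domain hn hΩ hne hb hN
  have hs1 : ∀ k, ContDiff ℝ 1 (φ k) := fun k => (hs k).of_le (by simp)
  have htr : IsTrace Ω x y z := ⟨hzm2, φ, hs, hx2, hy2, hz2⟩
  have hzm : ∫ p, z p ∂(surfaceMeasure Ω) = 0 := by
    have h1 := tendsto_integral_mul (fun k => hB _ (hs k).continuous) hzm2 hz2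
      (memLp_const (1 : ℝ))
    simp only [mul_one, hmean] at h1
    exact tendsto_nhds_unique h1 tendsto_const_nhds
  -- If the minimum were zero, `φ k` would tend to a constant `c`, and the traces of `φ k - c` to
  -- zero. But the `L²` norm of `φ k - c` on the boundary is at least that of `φ k`, which has mean
  -- zero, and the latter tends to one.
  have hlpos : 0 < l := by
    refine lt_of_le_of_ne hl0 fun h0 => ?_
    have hg0 : Tendsto (fun k => ∫ p in Ω, ‖gradient (φ k) p‖ ^ 2) atTop (𝓝 0) := by
      have := tendsto_integral_norm_sq
        (fun k => memLp_interior hb ((hs k).continuous_gradient (by simp))) hym hy2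
      change Tendsto _ _ (𝓝 (∫ p in Ω, ‖y p‖ ^ 2)) at this
      rwa [hyl', ← h0] at this
    obtain ⟨c, hc⟩ := ae_const_of_tendsto hΩ hb hconn.isPreconnected hs1
      hxm hx2 hg0
    have hsub : ∀ k, ContDiff ℝ 1 fun p => (φ k) p - c := fun k =>
      (hs1 k).sub contDiff_const
    have hx3 : Tendsto (fun k => ∫ p in Ω, ((φ k) p - c) ^ 2) atTop (𝓝 0) := by
      have := tendsto_integral_sq (f := fun k p => (φ k) p - c) (g := fun _ => 0)
        (fun k => hI _ (hsub k).continuous) (MemLp.zero (ε := ℝ)) (by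
          refine hx2.congr fun k => eLpNorm_congr_ae ?_
          filter_upwards [hc] with p hp
          rw [hp, sub_zero])
      simpa [interiorMeasure] using this
    obtain ⟨D, hD⟩ := exists_trace_interpolation hΩ hb hN one_pos
    have hlow : ∀ k, ∫ p, (φ k) p ^ 2 ∂(surfaceMeasure Ω) ≤
        1 * (∫ p in Ω, ‖gradient (φ k) p‖ ^ 2) + D * ∫ p in Ω, ((φ k) p - c) ^ 2 := by
      intro k
      have h1 := hD _ (hsub k)
      simp only [gradient_sub_const] at h1
      refine le_trans ?_ h1
      have h2 : ∀ p, ((φ k) p - c) ^ 2 =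
          (φ k) p ^ 2 - 2 * c * (φ k) p + c ^ 2 := fun p => by ring
      have i1 := hB1 _ (hs k).continuous
      have i2 : Integrable (fun p => (φ k) p ^ 2) (surfaceMeasure Ω) :=
        hB1 _ ((hs k).continuous.pow 2)
      have i3 : Integrable (fun p => (φ k) p ^ 2 - 2 * c * (φ k) p) (surfaceMeasure Ω) :=
        i2.sub (i1.const_mul _)
      simp_rw [h2]
      rw [integral_add i3 (integrable_const _), integral_sub i2 (i1.const_mul _),
        integral_const_mul, hmean, integral_const, smul_eq_mul]
      have : 0 ≤ (surfaceMeasure Ω).real univ * c ^ 2 := by positivity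
      linarith
    have := le_of_tendsto_of_tendsto'
      (tendsto_integral_sq (fun k => hB _ (hs k).continuous) hzm2 hz2)
      ((hg0.const_mul 1).add (hx3.const_mul D)) hlow
    rw [hzl'] at this
    norm_num at this
  refine ⟨l, hlpos, ⟨x, y, z, ⟨⟨hxm, hym, hasWeakGradient_of_isTrace hΩ hb hN
    hxm hym htr⟩, htr, fun ψ hψ => ?_⟩, fun h0 => ?_⟩, fun ψ hψ hψ0 => ?_⟩
  -- subtracting the boundary mean from `ψ` changes neither side, as the trace has mean zero
  · set m := (∫ p, ψ p ∂(surfaceMeasure Ω)) / (surfaceMeasure Ω).real univ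
    have h2 := hEL _ (hψ.sub contDiff_const) (integral_sub_mean hn hΩ hne hb hN hψ.continuous)
    simp only [gradient_sub_const] at h2
    have i1 : Integrable (fun p => z p * ψ p) (surfaceMeasure Ω) :=
      hzm2.integrable_mul (hB _ hψ.continuous)
    have i2 : Integrable (fun p => z p) (surfaceMeasure Ω) := hzm2.integrable (by norm_num)
    have h4 : ∫ p, z p * (ψ p - m) ∂(surfaceMeasure Ω) = ∫ p, z p * ψ p ∂(surfaceMeasure Ω) := by
      have h5 : ∀ p, z p * (ψ p - m) = z p * ψ p - z p * m := fun p => by ring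
      simp_rw [h5]
      rw [integral_sub i1 (i2.mul_const _), integral_mul_const, hzm, zero_mul, sub_zero]
    rw [h2, h4]
  -- the trace has norm one and the energy is `l`, so vanishing of `x` would give `1 ≤ 1 / 2`
  · obtain ⟨D, hD⟩ := exists_trace_interpolation_of_isTrace hΩ hb hN hxm hym
      htr (ε := 1 / (2 * l)) (by positivity)
    have h1 : ∫ p in Ω, x p ^ 2 = 0 := by
      refine integral_eq_zero_of_ae ?_
      have h0' : ∀ᵐ p ∂(volume.restrict Ω), x p = 0 := h0
      filter_upwards [h0'] with p hp
      simp [hp]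
    rw [h1, hyl', hzl'] at hD
    field_simp at hD
    norm_num at hD
  · exact hmin ψ hψ hψ0

end

/-! ### Radial vector fields -/

theorem hasFDerivAt_norm_sub_sq (c x : 𝔼) :
    HasFDerivAt (fun x : 𝔼 => ‖x - c‖ ^ 2) (2 • innerSL ℝ (x - c)) x := by
  have h1 : HasFDerivAt (fun x : 𝔼 => x - c) (ContinuousLinearMap.id ℝ 𝔼) x :=
    (hasFDerivAt_id x).sub_const c
  simpa using h1.norm_sq

/-- The divergence of the radial field `h(|x - c|²) (x - c)`. -/
theorem sum_fderiv_radial {h : ℝ → ℝ} {h' : ℝ} (c x : 𝔼) (hh : HasDerivAt h h' (‖x - c‖ ^ 2)) :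
    ∑ i, fderiv ℝ (fun x : 𝔼 => h (‖x - c‖ ^ 2) * (x i - c i)) x (EuclideanSpace.single i 1) =
      n * h (‖x - c‖ ^ 2) + 2 * ‖x - c‖ ^ 2 * h' := by
  have h1 := hh.comp_hasFDerivAt x (hasFDerivAt_norm_sub_sq c x)
  have h2 : ∀ i, HasFDerivAt (fun x : 𝔼 => x i - c i) (EuclideanSpace.proj i : 𝔼 →L[ℝ] ℝ) x :=
    fun i => (EuclideanSpace.proj (𝕜 := ℝ) i).hasFDerivAt.sub_const (c i)
  have h3 : ∀ i, fderiv ℝ (fun x : 𝔼 => h (‖x - c‖ ^ 2) * (x i - c i)) x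
      (EuclideanSpace.single i 1) = h (‖x - c‖ ^ 2) + 2 * h' * ((x - c) i * (x - c) i) := by
    intro i
    have h4 := (h1.mul (h2 i)).fderiv
    simp only [Function.comp_def] at h4
    have h5 : (fun x : 𝔼 => h (‖x - c‖ ^ 2) * (x i - c i)) =
      (fun x : 𝔼 => h (‖x - c‖ ^ 2)) * fun x => x i - c i := rfl
    rw [h5, h4]
    simp [EuclideanSpace.inner_single_right]
    ring
  simp_rw [h3]
  rw [Finset.sum_add_distrib, ← Finset.mul_sum, sum_mul_apply, real_inner_self_eq_norm_sq]
  simp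
  ring

theorem isOuterNormalAt_ball (c : 𝔼) {R : ℝ} (hR : 0 < R) :
    ∀ p ∈ frontier (ball c R), IsOuterNormalAt (ball c R) p (R⁻¹ • (p - c)) := by
  intro p hp
  rw [frontier_ball c hR.ne', mem_sphere_iff_norm] at hp
  have hd : gradient (fun x : 𝔼 => ‖x - c‖ ^ 2 - R ^ 2) p = (2 : ℝ) • (p - c) := by
    refine ext_inner_right ℝ fun v => ?_
    rw [inner_gradient, ((hasFDerivAt_norm_sub_sq c p).sub_const (R ^ 2)).fderiv]
    simp [inner_smul_left, inner_sub_left]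
  have hpc : p - c ≠ 0 := by
    rw [← norm_pos_iff, hp]
    exact hR
  have h := isOuterNormalAt_of_defining (Ω := ball c R) (U := univ) (p := p)
    (ρ := fun x : 𝔼 => ‖x - c‖ ^ 2 - R ^ 2) isOpen_univ (mem_univ _) ?_ ?_ ?_
  · rw [hd, norm_smul, hp, smul_smul] at h
    convert h using 2
    simp
  · exact (((contDiff_id.sub contDiff_const).norm_sq ℝ).sub contDiff_const).contDiffOn
  · intro h0
    have h1 := inner_gradient (fun x : 𝔼 => ‖x - c‖ ^ 2 - R ^ 2) p (p - c)
    rw [h0, hd, inner_smul_left, real_inner_self_eq_norm_sq, hp] at h1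
    simp [hR.ne'] at h1
  · intro x _
    rw [mem_ball_iff_norm, sub_neg, sq_lt_sq₀ (norm_nonneg _) hR.le]

section Ball

variable (c : EuclideanSpace ℝ (Fin n)) {R : ℝ}

/-- The divergence theorem on a ball for the radial field `h(|y|²) y`. -/
theorem integral_ball_radial (hR : 0 < R) {h h' : ℝ → ℝ}
    (hh : ∀ q, 0 ≤ q → HasDerivAt h (h' q) q)
    (hc : ContDiff ℝ 1 fun x : 𝔼 => h (‖x - c‖ ^ 2)) :
    ∫ x in ball c R, (n * h (‖x - c‖ ^ 2) + 2 * ‖x - c‖ ^ 2 * h' (‖x - c‖ ^ 2)) =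
      (surfaceMeasure (ball c R)).real univ * (h (R ^ 2) * R) := by
  have hd := divergence_theorem isOpen_ball isBounded_ball (isOuterNormalAt_ball c hR)
    (F := fun i x => h (‖x - c‖ ^ 2) * (x i - c i)) fun i =>
      hc.mul (by fun_prop)
  simp_rw [fun x => sum_fderiv_radial c x (hh (‖x - c‖ ^ 2) (sq_nonneg _))] at hd
  rw [hd]
  have h1 : ∀ᵐ x ∂(surfaceMeasure (ball c R)), ∑ i, h (‖x - c‖ ^ 2) * (x i - c i) *
      (R⁻¹ • (x - c)) i = h (R ^ 2) * R := by
    refine (ae_restrict_iff' isClosed_frontier.measurableSet).2 (Eventually.of_forall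
      fun x hx => ?_)
    rw [frontier_ball c hR.ne', mem_sphere_iff_norm] at hx
    have h2 : ∀ i, h (‖x - c‖ ^ 2) * (x i - c i) * (R⁻¹ • (x - c)) i =
        h (R ^ 2) * R⁻¹ * ((x - c) i * (x - c) i) := by
      intro i
      rw [hx]
      simp
      ring
    simp_rw [h2]
    rw [← Finset.mul_sum, sum_mul_apply, real_inner_self_eq_norm_sq, hx]
    field_simp
  rw [integral_congr_ae h1, integral_const, smul_eq_mul]

/-- The area of a sphere of radius `R` is `n / R` times the volume of the ball. -/
theorem surfaceMeasure_ball_eq (hR : 0 < R) :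
    (surfaceMeasure (ball c R)).real univ * R = n * (volume (ball c R)).toReal := by
  have h := integral_ball_radial c hR (h := fun _ => 1) (h' := fun _ => 0)
    (fun q _ => hasDerivAt_const q 1) contDiff_const
  rw [one_mul] at h
  rw [← h]
  simp [Measure.real, mul_comm]

end Ball

/-! ### The isoperimetric inequality for the moment of inertia of the boundary -/

/-- The divergence of the field `2R |y|² y / (|y|² + R²)`, as a function of `q = |y|²`. -/
noncomputable def fieldDivergence (n : ℕ) (R q : ℝ) : ℝ :=
  n * (2 * R * q / (q + R ^ 2)) + 2 * q * (2 * R * R ^ 2 / (q + R ^ 2) ^ 2)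

/-- The divergence is less than its value on the sphere inside the ball of radius `R`, and greater
outside. -/
theorem fieldDivergence_sub {R : ℝ} (hR : 0 < R) {q : ℝ} (hq : 0 ≤ q) :
    fieldDivergence n R q - fieldDivergence n R (R ^ 2) =
      (q - R ^ 2) * (R * ((n - 1) * q + (n + 1) * R ^ 2) / (q + R ^ 2) ^ 2) := by
  have : q + R ^ 2 ≠ 0 := by positivity
  rw [fieldDivergence, fieldDivergence]
  field_simp
  ring

theorem hasDerivAt_field {R : ℝ} (hR : 0 < R) {q : ℝ} (hq : 0 ≤ q) :
    HasDerivAt (fun q => 2 * R * q / (q + R ^ 2)) (2 * R * R ^ 2 / (q + R ^ 2) ^ 2) q := by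
  have : q + R ^ 2 ≠ 0 := by positivity
  exact (((hasDerivAt_id q).const_mul (2 * R)).div ((hasDerivAt_id q).add_const (R ^ 2))
    this).congr_deriv (by simp only [id]; ring)

theorem contDiff_field {R : ℝ} (hR : 0 < R) (c : 𝔼) :
    ContDiff ℝ 1 fun x : 𝔼 => 2 * R * ‖x - c‖ ^ 2 / (‖x - c‖ ^ 2 + R ^ 2) := by
  have h : ContDiff ℝ 1 fun x : 𝔼 => ‖x - c‖ ^ 2 := (contDiff_id.sub contDiff_const).norm_sq ℝ
  exact (contDiff_const.mul h).div (h.add contDiff_const) fun x => by positivity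

theorem continuous_fieldDivergence {R : ℝ} (hR : 0 < R) (c : 𝔼) :
    Continuous fun x : 𝔼 => fieldDivergence n R (‖x - c‖ ^ 2) := by
  unfold fieldDivergence
  have h : ∀ x : 𝔼, ‖x - c‖ ^ 2 + R ^ 2 ≠ 0 := fun x => by positivity
  have h' : ∀ x : 𝔼, (‖x - c‖ ^ 2 + R ^ 2) ^ 2 ≠ 0 := fun x => by positivity
  fun_prop (disch := assumption)

theorem integral_ball_fieldDivergence (c : 𝔼) {R : ℝ} (hR : 0 < R) :
    ∫ x in ball c R, fieldDivergence n R (‖x - c‖ ^ 2) =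
      n * R * (volume (ball c R)).toReal := by
  unfold fieldDivergence
  rw [integral_ball_radial c hR (h := fun q => 2 * R * q / (q + R ^ 2))
    (fun q hq => hasDerivAt_field hR hq) (contDiff_field hR c)]
  have h1 : 2 * R * R ^ 2 / (R ^ 2 + R ^ 2) * R = R * R := by
    field_simp
    ring
  rw [h1, ← mul_assoc, surfaceMeasure_ball_eq c hR]
  ring

section

variable {Ω : Set (EuclideanSpace ℝ (Fin n))}
  {N : EuclideanSpace ℝ (Fin n) → EuclideanSpace ℝ (Fin n)}

/-- The divergence theorem for the field `2R |y|² y / (|y|² + R²)`, whose length is at most `|y|²`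
since `2R |y| ≤ |y|² + R²`. -/
theorem integral_fieldDivergence_le (hΩ : IsOpen Ω) (hb : Bornology.IsBounded Ω)
    (hN : ∀ p ∈ frontier Ω, IsOuterNormalAt Ω p (N p)) (c : 𝔼) {R : ℝ} (hR : 0 < R) :
    ∫ x in Ω, fieldDivergence n R (‖x - c‖ ^ 2) ≤ ∫ x, ‖x - c‖ ^ 2 ∂(surfaceMeasure Ω) := by
  have := isFiniteMeasure_surfaceMeasure hΩ hb hN
  have hF : ∀ i : Fin n, ContDiff ℝ 1 fun x : 𝔼 =>
      2 * R * ‖x - c‖ ^ 2 / (‖x - c‖ ^ 2 + R ^ 2) * (x i - c i) := fun i =>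
    (contDiff_field hR c).mul (by fun_prop)
  have hd := divergence_theorem hΩ hb hN hF
  simp_rw [fun x => sum_fderiv_radial (h := fun q => 2 * R * q / (q + R ^ 2)) c x
    (hasDerivAt_field hR (sq_nonneg ‖x - c‖))] at hd
  have hsum : ∀ x, ∑ i, 2 * R * ‖x - c‖ ^ 2 / (‖x - c‖ ^ 2 + R ^ 2) * (x i - c i) * N x i =
      2 * R * ‖x - c‖ ^ 2 / (‖x - c‖ ^ 2 + R ^ 2) * inner ℝ (x - c) (N x) := by
    intro x
    rw [← sum_mul_apply, Finset.mul_sum]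
    exact Finset.sum_congr rfl fun i _ => by simp; ring
  simp_rw [hsum] at hd
  change ∫ x in Ω, fieldDivergence n R (‖x - c‖ ^ 2) = _ at hd
  rw [hd]
  refine integral_mono_ae ?_ ?_ ?_
  · refine integrable_surfaceMeasure_of_continuousOn hb
      ((contDiff_field hR c).continuous.continuousOn.mul (ContinuousOn.inner ?_
        (continuousOn_outerNormal hΩ hN)))
    fun_prop
  · exact integrable_surfaceMeasure_of_continuousOn hb (by fun_prop)
  · refine (ae_restrict_iff' isClosed_frontier.measurableSet).2 (Eventually.of_forall
      fun x hx => ?_)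
    have h1 : inner ℝ (x - c) (N x) ≤ ‖x - c‖ := by
      simpa [(hN x hx).1] using real_inner_le_norm (x - c) (N x)
    have h2 : 0 < ‖x - c‖ ^ 2 + R ^ 2 := by positivity
    calc 2 * R * ‖x - c‖ ^ 2 / (‖x - c‖ ^ 2 + R ^ 2) * inner ℝ (x - c) (N x)
        ≤ 2 * R * ‖x - c‖ ^ 2 / (‖x - c‖ ^ 2 + R ^ 2) * ‖x - c‖ :=
          mul_le_mul_of_nonneg_left h1 (by positivity)
      _ = ‖x - c‖ ^ 2 * (2 * R * ‖x - c‖ / (‖x - c‖ ^ 2 + R ^ 2)) := by ring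
      _ ≤ ‖x - c‖ ^ 2 * 1 := by
          refine mul_le_mul_of_nonneg_left ?_ (by positivity)
          rw [div_le_one h2]
          nlinarith [sq_nonneg (‖x - c‖ - R)]
      _ = ‖x - c‖ ^ 2 := mul_one _

variable {R : ℝ}

/-- The integral of the field divergence over `Ω` exceeds that over the ball of the same volume by
an integral over the part of `Ω` outside the ball. -/
theorem integral_sub_le_fieldDivergence (hn : 1 ≤ n) (hΩ : IsOpen Ω)
    (hb : Bornology.IsBounded Ω) (c : 𝔼) (hR : 0 < R)
    (hvol : volume Ω = volume (ball c R)) :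
    n * R * (volume (ball c R)).toReal + ∫ x in Ω \ ball c R,
      (fieldDivergence n R (‖x - c‖ ^ 2) - fieldDivergence n R (R ^ 2)) ≤
        ∫ x in Ω, fieldDivergence n R (‖x - c‖ ^ 2) := by
  set D : 𝔼 → ℝ := fun x => fieldDivergence n R (‖x - c‖ ^ 2) - fieldDivergence n R (R ^ 2)
    with hD
  set B := ball c R
  have hDc : Continuous D := (continuous_fieldDivergence hR c).sub continuous_const
  have iΩ : IntegrableOn D Ω := hDc.integrableOn_of_isBounded hb
  have iB : IntegrableOn D B := hDc.integrableOn_of_isBounded isBounded_ball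
  have hneg : ∀ x ∈ B, D x ≤ 0 := by
    intro x hx
    rw [mem_ball_iff_norm] at hx
    rw [hD]
    dsimp only
    rw [fieldDivergence_sub hR (sq_nonneg _)]
    have h1 : (1 : ℝ) ≤ n := by exact_mod_cast hn
    refine mul_nonpos_of_nonpos_of_nonneg ?_ (div_nonneg (mul_nonneg hR.le ?_) (sq_nonneg _))
    · nlinarith [norm_nonneg (x - c)]
    · have : 0 ≤ (n : ℝ) - 1 := by linarith
      positivity
  have h1 : (∫ x in Ω ∩ B, D x) + ∫ x in Ω \ B, D x = ∫ x in Ω, D x :=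
    integral_inter_add_sdiff measurableSet_ball iΩ
  -- the divergence is below its boundary value in the ball, so dropping `B \ Ω` can only help
  have h2 : ∫ x in B, D x ≤ ∫ x in Ω ∩ B, D x := by
    have h3 : (∫ x in B ∩ Ω, D x) + ∫ x in B \ Ω, D x = ∫ x in B, D x :=
      integral_inter_add_sdiff hΩ.measurableSet iB
    have h4 : ∫ x in B \ Ω, D x ≤ 0 :=
      setIntegral_nonpos (measurableSet_ball.diff hΩ.measurableSet) fun x hx => hneg x hx.1
    rw [inter_comm] at h3
    linarith
  have hsplit : ∀ U : Set 𝔼, Bornology.IsBounded U → ∫ x in U, D x =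
      (∫ x in U, fieldDivergence n R (‖x - c‖ ^ 2)) -
        (volume U).toReal * fieldDivergence n R (R ^ 2) := by
    intro U hU
    rw [hD, integral_sub ((continuous_fieldDivergence hR c).integrableOn_of_isBounded hU)
      (continuous_const.integrableOn_of_isBounded hU), integral_const]
    simp [Measure.real]
  rw [hsplit B isBounded_ball, integral_ball_fieldDivergence c hR] at h2
  rw [hsplit Ω hb, hvol] at h1
  linarith

theorem fieldDivergence_sub_pos (hn : 1 ≤ n) (c x : 𝔼) (hR : 0 < R) (hx : R < ‖x - c‖) :
    0 < fieldDivergence n R (‖x - c‖ ^ 2) - fieldDivergence n R (R ^ 2) := by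
  rw [fieldDivergence_sub hR (sq_nonneg _)]
  have h1 : (1 : ℝ) ≤ n := by exact_mod_cast hn
  have h2 : 0 ≤ (n : ℝ) - 1 := by linarith
  have h3 : 0 < ‖x - c‖ ^ 2 - R ^ 2 := by nlinarith
  positivity

/-- Among the domains of given volume, balls minimise the moment of inertia of the boundary. -/
theorem le_integral_norm_sub_sq (hn : 1 ≤ n) (hΩ : IsOpen Ω) (hb : Bornology.IsBounded Ω)
    (hN : ∀ p ∈ frontier Ω, IsOuterNormalAt Ω p (N p)) (c : 𝔼) (hR : 0 < R)
    (hvol : volume Ω = volume (ball c R)) :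
    n * R * (volume (ball c R)).toReal ≤ ∫ x, ‖x - c‖ ^ 2 ∂(surfaceMeasure Ω) := by
  have h1 := integral_fieldDivergence_le hΩ hb hN c hR
  have h2 := integral_sub_le_fieldDivergence hn hΩ hb c hR hvol
  have h3 : 0 ≤ ∫ x in Ω \ ball c R,
      (fieldDivergence n R (‖x - c‖ ^ 2) - fieldDivergence n R (R ^ 2)) := by
    refine setIntegral_nonneg (hΩ.measurableSet.diff measurableSet_ball) fun x hx => ?_
    have h4 := hx.2
    rw [mem_ball_iff_norm, not_lt] at h4
    rcases h4.eq_or_lt with h4 | h4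
    · rw [← h4, sub_self]
    · exact (fieldDivergence_sub_pos hn c x hR h4).le
  linarith

/-- Equality in the inequality for the moment of inertia holds for balls only. -/
theorem eq_ball_of_integral_norm_sub_sq_le (hn : 1 ≤ n) (hΩ : IsOpen Ω)
    (hb : Bornology.IsBounded Ω)
    (hN : ∀ p ∈ frontier Ω, IsOuterNormalAt Ω p (N p)) (c : 𝔼) (hR : 0 < R)
    (hvol : volume Ω = volume (ball c R))
    (h : ∫ x, ‖x - c‖ ^ 2 ∂(surfaceMeasure Ω) ≤ n * R * (volume (ball c R)).toReal) :
    Ω = ball c R := by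
  have h1 := integral_fieldDivergence_le hΩ hb hN c hR
  have h2 := integral_sub_le_fieldDivergence hn hΩ hb c hR hvol
  have hm : MeasurableSet (Ω \ ball c R) := hΩ.measurableSet.diff measurableSet_ball
  have hnn : ∀ x ∈ Ω \ ball c R,
      0 ≤ fieldDivergence n R (‖x - c‖ ^ 2) - fieldDivergence n R (R ^ 2) := by
    intro x hx
    have h4 := hx.2
    rw [mem_ball_iff_norm, not_lt] at h4
    rcases h4.eq_or_lt with h4 | h4
    · rw [← h4, sub_self]
    · exact (fieldDivergence_sub_pos hn c x hR h4).le
  have h3 : ∫ x in Ω \ ball c R,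
      (fieldDivergence n R (‖x - c‖ ^ 2) - fieldDivergence n R (R ^ 2)) = 0 :=
    le_antisymm (by linarith) (setIntegral_nonneg hm hnn)
  have hsub : Ω ⊆ ball c R := by
    have hcl : Ω ⊆ closedBall c R := by
      have hopen : IsOpen (Ω \ closedBall c R) := hΩ.sdiff isClosed_closedBall
      have h0 : volume (Ω \ closedBall c R) = 0 := by
        rw [integral_eq_zero_iff_of_nonneg_ae ((ae_restrict_iff' hm).2 (Eventually.of_forall hnn))
          (((continuous_fieldDivergence hR c).sub continuous_const).integrableOn_of_isBounded
            (hb.subset sdiff_subset))] at h3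
        rw [measure_eq_zero_iff_ae_notMem]
        have h4 := (ae_restrict_iff' hm).1 h3
        filter_upwards [h4] with x hx hx'
        have h5 := hx'.2
        rw [mem_closedBall_iff_norm, not_le] at h5
        have h6 := hx ⟨hx'.1, fun h7 => hx'.2 (ball_subset_closedBall h7)⟩
        exact (fieldDivergence_sub_pos hn c x hR h5).ne' h6
      rw [hopen.measure_eq_zero_iff (μ := volume), sdiff_eq_empty] at h0
      exact h0
    have := interior_maximal hcl hΩ
    rwa [interior_closedBall c hR.ne'] at this
  refine hsub.antisymm fun x hx => ?_
  -- the complement of `Ω` in the ball is a null set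
  have hnull : volume (ball c R \ Ω) = 0 := by
    rw [measure_sdiff hsub hΩ.measurableSet.nullMeasurableSet hb.measure_lt_top.ne, hvol, tsub_self]
  have hcl : ball c R ⊆ closure Ω := by
    have hopen : IsOpen (ball c R \ closure Ω) := isOpen_ball.sdiff isClosed_closure
    have h0 : volume (ball c R \ closure Ω) = 0 :=
      measure_mono_null (sdiff_subset_sdiff_right subset_closure) hnull
    rwa [hopen.measure_eq_zero_iff (μ := volume), sdiff_eq_empty] at h0
  by_contra hxΩ
  have hxf : x ∈ frontier Ω := by
    rw [hΩ.frontier_eq]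
    exact ⟨hcl hx, hxΩ⟩
  obtain ⟨hN1, hcone⟩ := hN x hxf
  obtain ⟨r, hr, hcone⟩ := hcone 1 one_pos
  obtain ⟨s, hs, hsball⟩ := Metric.isOpen_iff.1 isOpen_ball x hx
  -- a point on the outer normal at `x` lies in the ball, but not in the closure of `Ω`
  set e := min r s / 2 with he
  have he0 : 0 < e := by positivity
  have hdist : ‖x + e • N x - x‖ = e := by
    rw [add_sub_cancel_left, norm_smul, hN1, mul_one, Real.norm_of_nonneg he0.le]
  have hmem : ∀ ρ, min r s ≤ ρ → x + e • N x ∈ ball x ρ := fun ρ hρ => by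
    rw [mem_ball_iff_norm, hdist]
    linarith
  refine hcone x (mem_ball_self hr) (x + e • N x) (hmem r (min_le_left _ _)) hxΩ ?_ ?_
    (hcl (hsball (hmem s (min_le_right _ _))))
  · intro h0
    rw [← h0, sub_self, norm_zero] at hdist
    exact he0.ne hdist
  · rw [hdist, add_sub_cancel_left, inner_smul_right, real_inner_self_eq_norm_sq, hN1]
    linarith

end

/-! ### The upper bound for the first eigenvalue -/

section

variable {Ω : Set (EuclideanSpace ℝ (Fin n))}
  {N : EuclideanSpace ℝ (Fin n) → EuclideanSpace ℝ (Fin n)}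

/-- The centred coordinate functions, as test functions in the Rayleigh inequality. -/
theorem exists_center_rayleigh (hn : 1 ≤ n) (hΩ : IsOpen Ω) (hne : Ω.Nonempty)
    (hb : Bornology.IsBounded Ω) (hN : ∀ p ∈ frontier Ω, IsOuterNormalAt Ω p (N p)) {l : ℝ}
    (hl : ∀ φ : 𝔼 → ℝ, ContDiff ℝ ∞ φ → ∫ x, φ x ∂(surfaceMeasure Ω) = 0 →
      l * ∫ x, φ x ^ 2 ∂(surfaceMeasure Ω) ≤ ∫ x in Ω, ‖gradient φ x‖ ^ 2) :
    ∃ c : 𝔼, l * ∫ x, ‖x - c‖ ^ 2 ∂(surfaceMeasure Ω) ≤ n * (volume Ω).toReal := by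
  have := isFiniteMeasure_surfaceMeasure hΩ hb hN
  set m : Fin n → ℝ := fun i =>
    (∫ x : 𝔼, x i ∂(surfaceMeasure Ω)) / (surfaceMeasure Ω).real univ with hm
  refine ⟨WithLp.toLp 2 m, ?_⟩
  have hco : ∀ i : Fin n, ContDiff ℝ ∞ fun x : 𝔼 => x i := fun i => by fun_prop
  have hgrad : ∀ (i : Fin n) (x : 𝔼),
      gradient (fun x : 𝔼 => x i - m i) x = EuclideanSpace.single i 1 := by
    intro i x
    refine ext_inner_right ℝ fun v => ?_
    rw [gradient_sub_const, inner_gradient]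
    have h1 : fderiv ℝ (fun x : 𝔼 => x i) x = EuclideanSpace.proj i :=
      (EuclideanSpace.proj (𝕜 := ℝ) i).fderiv
    rw [h1]
    simp [EuclideanSpace.inner_single_left]
  have hi : ∀ i : Fin n, l * ∫ x : 𝔼, (x i - m i) ^ 2 ∂(surfaceMeasure Ω) ≤
      (volume Ω).toReal := by
    intro i
    have h1 := hl (fun x => x i - m i) ((hco i).sub contDiff_const)
      (integral_sub_mean hn hΩ hne hb hN (hco i).continuous)
    simp_rw [hgrad i] at h1
    simpa [Measure.real] using h1
  have hsum : ∀ x : 𝔼, ‖x - WithLp.toLp 2 m‖ ^ 2 = ∑ i, (x i - m i) ^ 2 := by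
    intro x
    rw [← real_inner_self_eq_norm_sq, ← sum_mul_apply]
    exact Finset.sum_congr rfl fun i _ => by simp; ring
  simp_rw [hsum]
  have hint : ∀ i ∈ Finset.univ, Integrable (fun x : 𝔼 => (x i - m i) ^ 2) (surfaceMeasure Ω) :=
    fun i _ => integrable_surfaceMeasure_of_continuousOn hb (by fun_prop)
  rw [integral_finsetSum _ hint, Finset.mul_sum]
  refine (Finset.sum_le_sum fun i _ => hi i).trans ?_
  simp

end

/-- The first nonzero eigenvalue exists, is positive, and is characterised by the Rayleigh
inequality. -/
theorem IsBoundedSmoothDomain.isLeast_firstSteklovEigenvalue {Ω : Set 𝔼} (hn : 1 ≤ n)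
    (hD : IsBoundedSmoothDomain Ω) :
    0 < firstSteklovEigenvalue Ω ∧
      IsLeast (nonzeroSteklovEigenvalues Ω) (firstSteklovEigenvalue Ω) ∧
      ∀ φ : 𝔼 → ℝ, ContDiff ℝ ∞ φ → ∫ x, φ x ∂(surfaceMeasure Ω) = 0 →
        firstSteklovEigenvalue Ω * ∫ x, φ x ^ 2 ∂(surfaceMeasure Ω) ≤
          ∫ x in Ω, ‖gradient φ x‖ ^ 2 := by
  obtain ⟨N, hN⟩ := hD.exists_outerNormal
  obtain ⟨l, hl0, hle, hl⟩ :=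
    exists_pos_eigenvalue_rayleigh hn hD.isOpen hD.isConnected hD.isBounded hN
  have h : IsLeast (nonzeroSteklovEigenvalues Ω) l :=
    ⟨by rw [nonzeroSteklovEigenvalues, mem_ofPred_eq]; exact ⟨hl0.ne', hle⟩, fun ν hν =>
      le_of_mem_nonzeroSteklovEigenvalues hn hD.isOpen hD.isConnected.nonempty hD.isBounded hN hl
        hν⟩
  rw [firstSteklovEigenvalue, h.csInf_eq]
  exact ⟨hl0, h, hl⟩

/-- The bound `1 / R`, with equality only for balls: the Rayleigh inequality for coordinates is
combined with the inequality for the moment of inertia of the boundary. -/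
theorem IsBoundedSmoothDomain.firstSteklovEigenvalue_le {Ω : Set 𝔼} (hn : 1 ≤ n)
    (hD : IsBoundedSmoothDomain Ω) {R : ℝ} (hR : 0 < R)
    (hvol : volume Ω = volume (ball (0 : 𝔼) R)) :
    firstSteklovEigenvalue Ω ≤ 1 / R ∧
      (firstSteklovEigenvalue Ω = 1 / R → ∃ c : 𝔼, Ω = ball c R) := by
  obtain ⟨N, hN⟩ := hD.exists_outerNormal
  obtain ⟨-, -, hl⟩ := hD.isLeast_firstSteklovEigenvalue hn
  have hne := hD.isConnected.nonempty
  obtain ⟨c, hc⟩ := exists_center_rayleigh hn hD.isOpen hne hD.isBounded hN hl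
  have hvol' : volume Ω = volume (ball c R) := by
    rw [hvol, Measure.addHaar_ball_center, ← Measure.addHaar_ball_center volume c]
  have hI := le_integral_norm_sub_sq hn hD.isOpen hD.isBounded hN c hR hvol'
  rw [← hvol'] at hI
  have hv : 0 < (volume Ω).toReal :=
    ENNReal.toReal_pos (hD.isOpen.measure_pos volume hne).ne' hD.isBounded.measure_lt_top.ne
  have hn0 : (0 : ℝ) < n := by exact_mod_cast hn
  set I := ∫ x, ‖x - c‖ ^ 2 ∂(surfaceMeasure Ω) with hIdef
  have hI0 : 0 < I := lt_of_lt_of_le (by positivity) hI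
  refine ⟨?_, fun h => ⟨c, eq_ball_of_integral_norm_sub_sq_le hn hD.isOpen hD.isBounded hN c hR
    hvol' ?_⟩⟩
  · rw [le_div_iff₀ hR]
    by_contra! h
    have h1 : 0 < firstSteklovEigenvalue Ω := by
      by_contra! h2
      nlinarith
    have h2 := mul_le_mul_of_nonneg_left hI h1.le
    have h3 : 0 < n * (volume Ω).toReal := by positivity
    nlinarith
  · rw [h, div_mul_eq_mul_div, one_mul, div_le_iff₀ hR] at hc
    rw [← hvol', ← hIdef]
    linarith

/-! ### Polynomials as functions on Euclidean space -/

open MvPolynomial in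
/-- The polynomial `p` in the variables `x - c`, as a function of `x`. -/
noncomputable def polyFun (c : EuclideanSpace ℝ (Fin n)) (p : MvPolynomial (Fin n) ℝ)
    (x : EuclideanSpace ℝ (Fin n)) : ℝ :=
  eval (fun i => x i - c i) p

/-- The Laplacian on polynomials. -/
noncomputable def polyLaplacian (n : ℕ) :
    MvPolynomial (Fin n) ℝ →ₗ[ℝ] MvPolynomial (Fin n) ℝ :=
  ∑ i, (MvPolynomial.pderiv i).toLinearMap ∘ₗ (MvPolynomial.pderiv i).toLinearMap

theorem polyLaplacian_apply (p : MvPolynomial (Fin n) ℝ) :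
    polyLaplacian n p = ∑ i, MvPolynomial.pderiv i (MvPolynomial.pderiv i p) := by
  simp [polyLaplacian]

section

variable (c : EuclideanSpace ℝ (Fin n)) (p : MvPolynomial (Fin n) ℝ)

theorem contDiff_polyFun {m : WithTop ℕ∞} : ContDiff ℝ m (polyFun c p) := by
  unfold polyFun
  induction p using MvPolynomial.induction_on with
  | C a => simpa using contDiff_const
  | add p q hp hq => simpa using hp.add hq
  | mul_X p i hp =>
    simp only [map_mul, MvPolynomial.eval_X]
    exact hp.mul (by fun_prop)

theorem hasFDerivAt_polyFun (x : 𝔼) : HasFDerivAt (polyFun c p)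
    (∑ i, polyFun c (MvPolynomial.pderiv i p) x • (EuclideanSpace.proj i : 𝔼 →L[ℝ] ℝ)) x := by
  unfold polyFun
  induction p using MvPolynomial.induction_on with
  | C a => simpa using hasFDerivAt_const a x
  | add p q hp hq =>
    simp only [map_add, add_smul, Finset.sum_add_distrib]
    exact hp.add hq
  | mul_X p j hp =>
    have h1 : HasFDerivAt (fun x : 𝔼 => x j - c j) (EuclideanSpace.proj j : 𝔼 →L[ℝ] ℝ) x :=
      (EuclideanSpace.proj (𝕜 := ℝ) j).hasFDerivAt.sub_const (c j)
    have h2 := hp.mul h1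
    simp only [map_mul, MvPolynomial.eval_X]
    refine h2.congr_fderiv ?_
    classical
    simp only [Derivation.leibniz, MvPolynomial.pderiv_X, smul_eq_mul, map_add, map_mul,
      MvPolynomial.eval_X, add_smul, Finset.sum_add_distrib, Finset.smul_sum, mul_smul]
    congr 1
    rw [Finset.sum_eq_single j]
    · simp
    · intro b _ hb
      simp [hb.symm]
    · simp

theorem fderiv_polyFun_single (x : 𝔼) (i : Fin n) :
    fderiv ℝ (polyFun c p) x (EuclideanSpace.single i 1) =
      polyFun c (MvPolynomial.pderiv i p) x := by
  rw [(hasFDerivAt_polyFun c p x).fderiv]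
  simp

theorem inner_gradient_polyFun (v x : 𝔼) : inner ℝ v (gradient (polyFun c p) x) =
    ∑ i, polyFun c (MvPolynomial.pderiv i p) x * v i := by
  rw [real_inner_comm, inner_gradient, (hasFDerivAt_polyFun c p x).fderiv]
  simp

theorem polyFun_polyLaplacian (x : 𝔼) : polyFun c (polyLaplacian n p) x =
    ∑ i, polyFun c (MvPolynomial.pderiv i (MvPolynomial.pderiv i p)) x := by
  simp [polyFun, polyLaplacian_apply]

end

section

variable {Ω : Set (EuclideanSpace ℝ (Fin n))}
  {N : EuclideanSpace ℝ (Fin n) → EuclideanSpace ℝ (Fin n)}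
  {u t : EuclideanSpace ℝ (Fin n) → ℝ} {G : EuclideanSpace ℝ (Fin n) → EuclideanSpace ℝ (Fin n)}

/-- Green's first identity for a function with a trace and a polynomial. -/
theorem integral_polyLaplacian_of_isTrace (hΩ : IsOpen Ω) (hb : Bornology.IsBounded Ω)
    (hN : ∀ p ∈ frontier Ω, IsOuterNormalAt Ω p (N p)) (hu : MemLp u 2 (interiorMeasure Ω))
    (hG : MemLp G 2 (interiorMeasure Ω)) (ht : IsTrace Ω u G t) (c : 𝔼)
    (p : MvPolynomial (Fin n) ℝ) :
    (∫ x in Ω, inner ℝ (G x) (gradient (polyFun c p) x)) +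
        ∫ x in Ω, u x * polyFun c (polyLaplacian n p) x =
      ∫ x, t x * inner ℝ (N x) (gradient (polyFun c p) x) ∂(surfaceMeasure Ω) := by
  have := isFiniteMeasure_surfaceMeasure hΩ hb hN
  have hc : ∀ q, Continuous (polyFun c q) := fun q => (contDiff_polyFun c q (m := 0)).continuous
  have hi := fun i => integral_fderiv_eq_of_isTrace hΩ hb hN hu hG ht
    (contDiff_polyFun c (MvPolynomial.pderiv i p)) (EuclideanSpace.single i 1)
  simp only [fderiv_polyFun_single, EuclideanSpace.inner_single_right, one_mul, conj_trivial] at hi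
  simp only [inner_gradient_polyFun, polyFun_polyLaplacian, Finset.mul_sum]
  have hGi : ∀ i, MemLp (fun x => G x i) 2 (interiorMeasure Ω) := fun i =>
    (EuclideanSpace.proj (𝕜 := ℝ) i : 𝔼 →L[ℝ] ℝ).comp_memLp' hG
  have hNi : ∀ i, ContinuousOn (fun x => polyFun c (MvPolynomial.pderiv i p) x * N x i)
      (frontier Ω) := fun i =>
    (hc _).continuousOn.mul
      ((EuclideanSpace.proj (𝕜 := ℝ) i : 𝔼 →L[ℝ] ℝ).continuous.comp_continuousOn
        (continuousOn_outerNormal hΩ hN))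
  have hNm : ∀ i, MemLp (fun x => polyFun c (MvPolynomial.pderiv i p) x * N x i) 2
      (surfaceMeasure Ω) := fun i => by
    obtain ⟨C, hC⟩ := (hb.isCompact_closure.of_isClosed_subset isClosed_frontier
      frontier_subset_closure).exists_bound_of_continuousOn (hNi i)
    exact MemLp.of_bound (integrable_surfaceMeasure_of_continuousOn hb
      (hNi i)).aestronglyMeasurable C
      ((ae_restrict_iff' isClosed_frontier.measurableSet).2 (Eventually.of_forall hC))
  have s1 : ∫ x in Ω, ∑ i, polyFun c (MvPolynomial.pderiv i p) x * G x i =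
      ∑ i, ∫ x in Ω, polyFun c (MvPolynomial.pderiv i p) x * G x i :=
    integral_finsetSum _ fun i _ => (memLp_interior hb (hc _)).integrable_mul (hGi i)
  have s2 : ∫ x in Ω, ∑ i,
      u x * polyFun c (MvPolynomial.pderiv i (MvPolynomial.pderiv i p)) x =
      ∑ i, ∫ x in Ω, u x * polyFun c (MvPolynomial.pderiv i (MvPolynomial.pderiv i p)) x :=
    integral_finsetSum _ fun i _ => hu.integrable_mul (memLp_interior hb (hc _))
  have s3 : ∫ x, ∑ i, t x * (polyFun c (MvPolynomial.pderiv i p) x * N x i)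
      ∂(surfaceMeasure Ω) =
      ∑ i, ∫ x, t x * (polyFun c (MvPolynomial.pderiv i p) x * N x i) ∂(surfaceMeasure Ω) :=
    integral_finsetSum _ fun i _ => ht.memLp.integrable_mul (hNm i)
  rw [s1, s2, s3, ← Finset.sum_add_distrib]
  exact Finset.sum_congr rfl fun i _ => hi i

theorem isTrace_of_contDiff [IsFiniteMeasure (surfaceMeasure Ω)] (hb : Bornology.IsBounded Ω)
    {φ : 𝔼 → ℝ} (hφ : ContDiff ℝ ∞ φ) : IsTrace Ω φ (gradient φ) φ :=
  ⟨memLp_surface hb hφ.continuous, fun _ => φ, fun _ => hφ, by simp, by simp, by simp⟩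

end

/-! ### The Poisson problem for polynomials on a ball -/

theorem totalDegree_pderiv_le {σ : Type*} {S : Type*} [CommSemiring S] (i : σ)
    (p : MvPolynomial σ S) : (MvPolynomial.pderiv i p).totalDegree ≤ p.totalDegree - 1 := by
  refine Finset.sup_le fun m hm => ?_
  rw [MvPolynomial.mem_support_iff, MvPolynomial.coeff_pderiv] at hm
  have h1 : m + Finsupp.single i 1 ∈ p.support :=
    MvPolynomial.mem_support_iff.2 (left_ne_zero_of_mul hm)
  have h2 := MvPolynomial.le_totalDegree h1
  rw [Finsupp.sum_add_index' (fun _ => rfl) (fun _ _ _ => rfl),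
    Finsupp.sum_single_index rfl] at h2
  omega

theorem totalDegree_polyLaplacian_le (p : MvPolynomial (Fin n) ℝ) :
    (polyLaplacian n p).totalDegree ≤ p.totalDegree - 2 := by
  rw [polyLaplacian_apply]
  refine MvPolynomial.totalDegree_finsetSum_le fun i _ => ?_
  have h1 := totalDegree_pderiv_le i p
  have h2 := totalDegree_pderiv_le i (MvPolynomial.pderiv i p)
  omega

open MvPolynomial in
/-- The polynomial `R² - |y|²`. -/
noncomputable def ballPoly (n : ℕ) (R : ℝ) : MvPolynomial (Fin n) ℝ :=
  C (R ^ 2) - ∑ i, X i ^ 2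

theorem totalDegree_ballPoly_le (R : ℝ) : (ballPoly n R).totalDegree ≤ 2 := by
  rw [ballPoly]
  refine (MvPolynomial.totalDegree_sub _ _).trans (max_le (by rw [MvPolynomial.totalDegree_C]; omega) ?_)
  exact MvPolynomial.totalDegree_finsetSum_le fun i _ =>
    (MvPolynomial.totalDegree_X_pow _ _).le

theorem pderiv_ballPoly (R : ℝ) (i : Fin n) :
    MvPolynomial.pderiv i (ballPoly n R) = -2 * MvPolynomial.X i := by
  classical
  rw [ballPoly, map_sub, map_sum, MvPolynomial.pderiv_C, zero_sub, Finset.sum_eq_single i]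
  · rw [MvPolynomial.pderiv_pow, MvPolynomial.pderiv_X_self]
    push_cast
    ring
  · intro j _ hj
    rw [MvPolynomial.pderiv_pow, MvPolynomial.pderiv_X_of_ne hj, mul_zero]
  · simp

theorem sum_sub_mul_self (c x : 𝔼) : ∑ i, (x i - c i) * (x i - c i) = ‖x - c‖ ^ 2 := by
  rw [← real_inner_self_eq_norm_sq, ← sum_mul_apply]
  simp

theorem polyFun_ballPoly (R : ℝ) (c x : 𝔼) :
    polyFun c (ballPoly n R) x = R ^ 2 - ‖x - c‖ ^ 2 := by
  rw [← sum_sub_mul_self]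
  simp [polyFun, ballPoly, pow_two]

theorem polyFun_mul (c x : 𝔼) (p q : MvPolynomial (Fin n) ℝ) :
    polyFun c (p * q) x = polyFun c p x * polyFun c q x := map_mul _ _ _

/-- The normal derivative of a homogeneous polynomial on a sphere. -/
theorem inner_normal_gradient_of_isHomogeneous (c x : 𝔼) (R : ℝ) {p : MvPolynomial (Fin n) ℝ}
    {k : ℕ} (hp : p.IsHomogeneous k) :
    inner ℝ (R⁻¹ • (x - c)) (gradient (polyFun c p) x) = k / R * polyFun c p x := by
  have h := congrArg (MvPolynomial.eval fun i => x i - c i) hp.sum_X_mul_pderiv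
  rw [map_sum] at h
  simp only [map_mul, MvPolynomial.eval_X, nsmul_eq_mul, map_natCast] at h
  rw [inner_smul_left, inner_gradient_polyFun]
  have h2 : ∑ i, polyFun c (MvPolynomial.pderiv i p) x * (x - c) i = k * polyFun c p x := by
    rw [polyFun, ← h]
    exact Finset.sum_congr rfl fun i _ => by simp [polyFun, mul_comm]
  rw [h2]
  simp
  ring

/-- The normal derivative on the sphere of a multiple of `R² - |y|²`. -/
theorem inner_normal_gradient_ballPoly_mul (c x : 𝔼) {R : ℝ} (hR : 0 < R) (hx : ‖x - c‖ = R)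
    (w : MvPolynomial (Fin n) ℝ) :
    inner ℝ (R⁻¹ • (x - c)) (gradient (polyFun c (ballPoly n R * w)) x) =
      -2 * R * polyFun c w x := by
  rw [inner_smul_left, inner_gradient_polyFun]
  have h0 : polyFun c (ballPoly n R) x = 0 := by rw [polyFun_ballPoly, hx, sub_self]
  have h1 : ∀ i, polyFun c (MvPolynomial.pderiv i (ballPoly n R * w)) x * (x - c) i =
      -2 * polyFun c w x * ((x i - c i) * (x i - c i)) := by
    intro i
    rw [MvPolynomial.pderiv_mul, pderiv_ballPoly]
    have h2 : polyFun c (-2 * MvPolynomial.X i * w +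
        ballPoly n R * MvPolynomial.pderiv i w) x = -2 * (x i - c i) * polyFun c w x +
          polyFun c (ballPoly n R) x * polyFun c (MvPolynomial.pderiv i w) x := by
      simp [polyFun]
    rw [h2, h0]
    simp
    ring
  simp_rw [h1]
  rw [← Finset.mul_sum, sum_sub_mul_self, hx]
  simp
  field_simp

/-- A polynomial which vanishes on a ball is zero. -/
theorem eq_zero_of_polyFun_eq_zero (hn : 1 ≤ n) (c : 𝔼) {R : ℝ} (hR : 0 < R)
    {p : MvPolynomial (Fin n) ℝ} (hp : ∀ x ∈ ball c R, polyFun c p x = 0) : p = 0 := by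
  refine MvPolynomial.funext_set (fun _ => Ioo 0 (R / n)) (fun _ => Ioo_infinite ?_) fun y hy => ?_
  · have : (0 : ℝ) < n := by exact_mod_cast hn
    positivity
  · have hn0 : (0 : ℝ) < n := by exact_mod_cast hn
    have hn1 : (1 : ℝ) ≤ n := by exact_mod_cast hn
    have hx : WithLp.toLp 2 (fun i => y i + c i) ∈ ball c R := by
      rw [mem_ball_iff_norm, ← sq_lt_sq₀ (norm_nonneg _) hR.le, ← sum_sub_mul_self]
      have h1 : ∀ i ∈ Finset.univ, (y i + c i - c i) * (y i + c i - c i) < R ^ 2 / n ^ 2 := by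
        intro i _
        have h2 := hy i (mem_univ i)
        rw [add_sub_cancel_right, ← div_pow, pow_two]
        exact mul_lt_mul'' h2.2 h2.2 h2.1.le h2.1.le
      refine (Finset.sum_lt_sum_of_nonempty ⟨⟨0, hn⟩, Finset.mem_univ _⟩ h1).trans_le ?_
      rw [Finset.sum_const, Finset.card_univ, Fintype.card_fin, nsmul_eq_mul]
      rw [← mul_div_assoc, div_le_iff₀ (by positivity)]
      nlinarith [mul_pos hR hR, mul_le_mul_of_nonneg_left hn1 hn0.le]
    have h3 := hp _ hx
    simp only [polyFun, add_sub_cancel_right] at h3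
    rw [h3, map_zero]

/-- A polynomial multiple of `R² - |y|²` is harmonic only if it is zero: its Dirichlet energy on
the ball vanishes. -/
theorem eq_zero_of_polyLaplacian_ballPoly_mul (hn : 1 ≤ n) {R : ℝ} (hR : 0 < R)
    {w : MvPolynomial (Fin n) ℝ} (hw : polyLaplacian n (ballPoly n R * w) = 0) : w = 0 := by
  set c : 𝔼 := 0
  have hN := isOuterNormalAt_ball c hR
  have hb : Bornology.IsBounded (ball c R) := isBounded_ball
  have := isFiniteMeasure_surfaceMeasure isOpen_ball hb hN
  set ζ := polyFun c (ballPoly n R * w) with hζ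
  have hs : ∀ {m : WithTop ℕ∞}, ContDiff ℝ m ζ := contDiff_polyFun c _
  have hg : Continuous (gradient ζ) := (hs (m := 1)).continuous_gradient (by simp)
  have h0 : ∀ᵐ x ∂(surfaceMeasure (ball c R)), ζ x = 0 := by
    refine (ae_restrict_iff' isClosed_frontier.measurableSet).2 (Eventually.of_forall
      fun x hx => ?_)
    rw [frontier_ball c hR.ne', mem_sphere_iff_norm] at hx
    rw [hζ, polyFun_mul, polyFun_ballPoly, hx, sub_self, zero_mul]
  have h1 := integral_polyLaplacian_of_isTrace isOpen_ball hb hN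
    (memLp_interior hb (hs (m := 1)).continuous) (memLp_interior hb hg)
    (isTrace_of_contDiff hb hs) c (ballPoly n R * w)
  have h2 : ∫ x, ζ x * inner ℝ (R⁻¹ • (x - c)) (gradient ζ x) ∂(surfaceMeasure (ball c R)) = 0 :=
    integral_eq_zero_of_ae (by filter_upwards [h0] with x hx; simp [hx])
  have h3 : ∫ x, ζ x ^ 2 ∂(surfaceMeasure (ball c R)) = 0 :=
    integral_eq_zero_of_ae (by filter_upwards [h0] with x hx; simp [hx])
  rw [← hζ, h2, hw] at h1
  have h4 : ∀ x, polyFun c (0 : MvPolynomial (Fin n) ℝ) x = 0 := fun x => map_zero _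
  simp only [h4, mul_zero, integral_zero, add_zero, real_inner_self_eq_norm_sq] at h1
  obtain ⟨C, hC⟩ := exists_friedrichs hn isOpen_ball hb hN
  have h5 := hC ζ hs
  rw [h1, h3, add_zero, mul_zero] at h5
  have h6 : ∫ x in ball c R, ζ x ^ 2 = 0 :=
    le_antisymm h5 (integral_nonneg fun _ => sq_nonneg _)
  have h7 : ζ =ᵐ[volume.restrict (ball c R)] 0 :=
    ae_eq_zero_of_integral_sq (memLp_interior hb (hs (m := 1)).continuous) h6
  have h8 : EqOn ζ 0 (ball c R) :=
    Measure.eqOn_open_of_ae_eq h7 isOpen_ball (hs (m := 1)).continuous.continuousOn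
      continuousOn_const
  refine eq_zero_of_polyFun_eq_zero hn c hR fun x hx => ?_
  have h9 := h8 hx
  rw [hζ, polyFun_mul, polyFun_ballPoly] at h9
  rw [mem_ball_iff_norm] at hx
  have h10 : R ^ 2 - ‖x - c‖ ^ 2 ≠ 0 := by
    have := norm_nonneg (x - c)
    nlinarith
  exact (mul_eq_zero.1 h9).resolve_left h10

/-- The Poisson problem with polynomial right-hand side and zero boundary values has a polynomial
solution on the ball. -/
theorem exists_polyLaplacian_ballPoly_mul (hn : 1 ≤ n) {R : ℝ} (hR : 0 < R) {m : ℕ}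
    {q : MvPolynomial (Fin n) ℝ} (hq : q.totalDegree ≤ m) :
    ∃ w : MvPolynomial (Fin n) ℝ, w.totalDegree ≤ m ∧
      polyLaplacian n (ballPoly n R * w) = q := by
  have hmaps : ∀ w ∈ MvPolynomial.restrictTotalDegree (Fin n) ℝ m,
      (polyLaplacian n ∘ₗ LinearMap.mulLeft ℝ (ballPoly n R)) w ∈
        MvPolynomial.restrictTotalDegree (Fin n) ℝ m := by
    intro w hw
    rw [MvPolynomial.mem_restrictTotalDegree] at hw ⊢
    have h1 := totalDegree_polyLaplacian_le (ballPoly n R * w)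
    have h2 := MvPolynomial.totalDegree_mul (ballPoly n R) w
    have h3 := totalDegree_ballPoly_le (n := n) R
    rw [LinearMap.comp_apply, LinearMap.mulLeft_apply]
    omega
  have hinj : Function.Injective ((polyLaplacian n ∘ₗ LinearMap.mulLeft ℝ
      (ballPoly n R)).restrict hmaps) := by
    rw [injective_iff_map_eq_zero]
    intro w hw
    have h1 := congrArg Subtype.val hw
    exact Subtype.ext (eq_zero_of_polyLaplacian_ballPoly_mul hn hR h1)
  obtain ⟨w, hw⟩ := LinearMap.surjective_of_injective hinj
    ⟨q, (MvPolynomial.mem_restrictTotalDegree _ _ _).2 hq⟩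
  exact ⟨w.1, (MvPolynomial.mem_restrictTotalDegree _ _ _).1 w.2, congrArg Subtype.val hw⟩

/-! ### The first eigenvalue of a ball -/

/-- Polynomials are dense among the continuous functions on a compact set. -/
theorem exists_polyFun_near (c : 𝔼) {K : Set 𝔼} (hK : IsCompact K) {f : 𝔼 → ℝ}
    (hf : Continuous f) {ε : ℝ} (hε : 0 < ε) :
    ∃ p : MvPolynomial (Fin n) ℝ, ∀ x ∈ K, |polyFun c p x - f x| < ε := by
  let X : Fin n → C(EuclideanSpace ℝ (Fin n), ℝ) := fun i => ⟨fun x => x i - c i, by fun_prop⟩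
  have hX : ∀ p x, (MvPolynomial.aeval X p) x = polyFun c p x := by
    intro p x
    unfold polyFun
    induction p using MvPolynomial.induction_on with
    | C a => simp
    | add p q hp hq => simp [hp, hq]
    | mul_X p i hp => simp [hp, X]
  have hsep : (MvPolynomial.aeval (R := ℝ) X).range.SeparatesPoints := by
    intro x y hxy
    obtain ⟨i, hi⟩ : ∃ i, x i ≠ y i := by
      by_contra! h
      exact hxy (by ext i; exact h i)
    refine ⟨X i, ⟨X i, ⟨MvPolynomial.X i, by simp⟩, rfl⟩, fun h => hi ?_⟩
    exact sub_left_injective h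
  obtain ⟨g, ⟨p, rfl⟩, hp⟩ :=
    ContinuousMap.exists_mem_subalgebra_near_continuous_of_isCompact_of_separatesPoints hsep
      ⟨f, hf⟩ hK hε
  refine ⟨p, fun x hx => ?_⟩
  have := hp x hx
  rw [← hX, ← Real.norm_eq_abs]
  exact this

section

variable {c : EuclideanSpace ℝ (Fin n)} {R ν : ℝ} {u t : EuclideanSpace ℝ (Fin n) → ℝ}
  {G : EuclideanSpace ℝ (Fin n) → EuclideanSpace ℝ (Fin n)}

/-- Green's second identity for a Steklov eigenfunction on a ball and a polynomial. -/
theorem IsSteklovSolution.ball_green (hR : 0 < R) (h : IsSteklovSolution (ball c R) ν u G t)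
    (p : MvPolynomial (Fin n) ℝ) :
    (ν * ∫ x, t x * polyFun c p x ∂(surfaceMeasure (ball c R))) +
        ∫ x in ball c R, u x * polyFun c (polyLaplacian n p) x =
      ∫ x, t x * inner ℝ (R⁻¹ • (x - c)) (gradient (polyFun c p) x)
        ∂(surfaceMeasure (ball c R)) := by
  rw [← integral_polyLaplacian_of_isTrace isOpen_ball isBounded_ball (isOuterNormalAt_ball c hR)
    h.memH1.memLp h.memH1.memLp_grad h.isTrace c p, ← h.weakForm _ (contDiff_polyFun c p),
    interiorMeasure]

/-- The boundary values of an eigenfunction of a ball with eigenvalue less than `1 / R` are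
orthogonal to all polynomials. -/
theorem IsSteklovSolution.integral_trace_mul_polyFun (hn : 1 ≤ n) (hR : 0 < R) (hν : 0 < ν)
    (hνR : ν < 1 / R) (h : IsSteklovSolution (ball c R) ν u G t) (k : ℕ) :
    ∀ p : MvPolynomial (Fin n) ℝ, p.totalDegree ≤ k →
      ∫ x, t x * polyFun c p x ∂(surfaceMeasure (ball c R)) = 0 := by
  have hfin := isFiniteMeasure_surfaceMeasure isOpen_ball isBounded_ball (isOuterNormalAt_ball c hR)
  induction k with
  | zero =>
    intro p hp
    rw [Nat.le_zero, MvPolynomial.totalDegree_eq_zero_iff_eq_C] at hp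
    rw [hp]
    simp only [polyFun, MvPolynomial.eval_C]
    rw [integral_mul_const, h.integral_trace_eq_zero hν.ne', zero_mul]
  | succ k ih =>
    -- homogeneous polynomials of degree `k + 1`: solve a Poisson problem to reduce the degree
    have hhom : ∀ p : MvPolynomial (Fin n) ℝ, p.IsHomogeneous (k + 1) →
        ∫ x, t x * polyFun c p x ∂(surfaceMeasure (ball c R)) = 0 := by
      intro p hp
      have hdeg : (polyLaplacian n p).totalDegree ≤ k := by
        have h1 := totalDegree_polyLaplacian_le p
        have h2 := hp.totalDegree_le
        omega
      obtain ⟨w, hw, hwp⟩ := exists_polyLaplacian_ballPoly_mul hn hR hdeg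
      have g1 := h.ball_green hR p
      have g2 := h.ball_green hR (ballPoly n R * w)
      have e1 : ∫ x, t x * inner ℝ (R⁻¹ • (x - c)) (gradient (polyFun c p) x)
          ∂(surfaceMeasure (ball c R)) = ((k + 1 : ℕ) : ℝ) / R *
            ∫ x, t x * polyFun c p x ∂(surfaceMeasure (ball c R)) := by
        rw [← integral_const_mul]
        refine integral_congr_ae (Eventually.of_forall fun x => ?_)
        dsimp only
        rw [inner_normal_gradient_of_isHomogeneous c x R hp]
        ring
      have hbd : ∀ᵐ x ∂(surfaceMeasure (ball c R)), ‖x - c‖ = R := by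
        refine (ae_restrict_iff' isClosed_frontier.measurableSet).2 (Eventually.of_forall
          fun x hx => ?_)
        rwa [frontier_ball c hR.ne', mem_sphere_iff_norm] at hx
      have e2 : ∫ x, t x * inner ℝ (R⁻¹ • (x - c)) (gradient (polyFun c (ballPoly n R * w)) x)
          ∂(surfaceMeasure (ball c R)) = 0 := by
        have e3 : ∫ x, t x * inner ℝ (R⁻¹ • (x - c))
            (gradient (polyFun c (ballPoly n R * w)) x) ∂(surfaceMeasure (ball c R)) =
            ∫ x, -2 * R * (t x * polyFun c w x) ∂(surfaceMeasure (ball c R)) := by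
          refine integral_congr_ae ?_
          filter_upwards [hbd] with x hx
          rw [inner_normal_gradient_ballPoly_mul c x hR hx]
          ring
        rw [e3, integral_const_mul, ih w hw, mul_zero]
      have e4 : ∫ x, t x * polyFun c (ballPoly n R * w) x ∂(surfaceMeasure (ball c R)) = 0 := by
        refine integral_eq_zero_of_ae ?_
        filter_upwards [hbd] with x hx
        simp [polyFun_mul, polyFun_ballPoly, hx]
      rw [e2, e4, hwp, mul_zero, zero_add] at g2
      rw [e1, g2, add_zero] at g1
      have hne : ν - ((k + 1 : ℕ) : ℝ) / R ≠ 0 := by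
        have h1 : 1 / R ≤ ((k + 1 : ℕ) : ℝ) / R := by
          refine div_le_div_of_nonneg_right ?_ hR.le
          push_cast
          linarith [Nat.cast_nonneg (α := ℝ) k]
        exact (sub_neg.2 (hνR.trans_le h1)).ne
      exact (mul_eq_zero.1 (by rw [sub_mul, g1, sub_self])).resolve_left hne
    intro p hp
    have hint : ∀ q : MvPolynomial (Fin n) ℝ,
        Integrable (fun x => t x * polyFun c q x) (surfaceMeasure (ball c R)) := fun q =>
      h.isTrace.memLp.integrable_mul
        (memLp_surface isBounded_ball (contDiff_polyFun c q (m := 0)).continuous)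
    have hsum : ∀ x, t x * polyFun c p x = ∑ i ∈ Finset.range (p.totalDegree + 1),
        t x * polyFun c (MvPolynomial.homogeneousComponent i p) x := by
      intro x
      conv_lhs => rw [← MvPolynomial.sum_homogeneousComponent p]
      rw [← Finset.mul_sum]
      simp [polyFun]
    simp_rw [hsum]
    rw [integral_finsetSum _ fun i _ => hint _]
    refine Finset.sum_eq_zero fun i hi => ?_
    have hi' : i ≤ k + 1 := by
      rw [Finset.mem_range] at hi
      omega
    have hcomp := MvPolynomial.homogeneousComponent_isHomogeneous i p
    rcases hi'.eq_or_lt with rfl | hlt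
    · exact hhom _ hcomp
    · exact ih _ (hcomp.totalDegree_le.trans (Nat.lt_succ_iff.1 hlt))

/-- The positive eigenvalues of a ball of radius `R` are at least `1 / R`. -/
theorem one_div_le_of_isSteklovEigenvalue_ball (hn : 1 ≤ n) (hR : 0 < R) (hν : 0 < ν)
    (h : IsSteklovEigenvalue (ball c R) ν) : 1 / R ≤ ν := by
  by_contra! hνR
  obtain ⟨u, G, t, h, hu⟩ := h
  have hN := isOuterNormalAt_ball c hR
  have hb : Bornology.IsBounded (ball c R) := isBounded_ball
  have := isFiniteMeasure_surfaceMeasure isOpen_ball hb hN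
  have hpoly := fun p => h.integral_trace_mul_polyFun hn hR hν hνR _ p le_rfl
  have hti : Integrable t (surfaceMeasure (ball c R)) := h.isTrace.memLp.integrable (by norm_num)
  have hcont : ∀ f : 𝔼 → ℝ, Continuous f →
      ∫ x, t x * f x ∂(surfaceMeasure (ball c R)) = 0 := by
    intro f hf
    have hint : ∀ g : 𝔼 → ℝ, Continuous g →
        Integrable (fun x => t x * g x) (surfaceMeasure (ball c R)) := fun g hg =>
      h.isTrace.memLp.integrable_mul (memLp_surface hb hg)
    set A := ∫ x, |t x| ∂(surfaceMeasure (ball c R)) with hA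
    have hA0 : 0 ≤ A := integral_nonneg fun _ => abs_nonneg _
    rw [← abs_nonpos_iff]
    refine le_of_forall_pos_le_add fun ε hε => ?_
    obtain ⟨p, hp⟩ := exists_polyFun_near c
      (hb.isCompact_closure.of_isClosed_subset isClosed_frontier frontier_subset_closure) hf
      (ε := ε / (A + 1)) (by positivity)
    have hpc : Continuous (polyFun c p) := (contDiff_polyFun c p (m := 0)).continuous
    have h1 : ∫ x, t x * f x ∂(surfaceMeasure (ball c R)) =
        -∫ x, t x * (polyFun c p x - f x) ∂(surfaceMeasure (ball c R)) := by
      simp_rw [mul_sub]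
      rw [integral_sub (hint _ hpc) (hint _ hf), hpoly, zero_sub, neg_neg]
    rw [h1, abs_neg, zero_add]
    calc |∫ x, t x * (polyFun c p x - f x) ∂(surfaceMeasure (ball c R))|
        ≤ ∫ x, |t x * (polyFun c p x - f x)| ∂(surfaceMeasure (ball c R)) :=
          abs_integral_le_integral_abs
      _ ≤ ∫ x, |t x| * (ε / (A + 1)) ∂(surfaceMeasure (ball c R)) := by
          refine integral_mono_ae (hint _ (hpc.sub hf)).abs (hti.abs.mul_const _) ?_
          refine (ae_restrict_iff' isClosed_frontier.measurableSet).2 (Eventually.of_forall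
            fun x hx => ?_)
          dsimp only
          rw [abs_mul]
          exact mul_le_mul_of_nonneg_left (hp x hx).le (abs_nonneg _)
      _ = A * (ε / (A + 1)) := integral_mul_const _ _
      _ ≤ (A + 1) * (ε / (A + 1)) :=
          mul_le_mul_of_nonneg_right (by linarith) (by positivity)
      _ = ε := by field_simp
  -- the trace is an `L²` limit of smooth functions, hence orthogonal to itself
  obtain ⟨φ, hφ, -, -, h3⟩ := h.isTrace.approx
  have hlim := tendsto_integral_mul (fun k => memLp_surface hb (hφ k).continuous)
    h.isTrace.memLp h3 h.isTrace.memLp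
  have h4 : ∀ k, ∫ x, φ k x * t x ∂(surfaceMeasure (ball c R)) = 0 := fun k => by
    simp_rw [mul_comm (φ k _)]
    exact hcont _ (hφ k).continuous
  simp only [h4, ← pow_two] at hlim
  exact (h.integral_trace_sq_pos hn isOpen_ball hb hN hu).ne
    (tendsto_nhds_unique tendsto_const_nhds hlim)

end

end Steklov

theorem mainTheorem3 (n : ℕ) (hn : 1 ≤ n) (Ω : Set (EuclideanSpace ℝ (Fin n)))
    (hΩ : Steklov.IsBoundedSmoothDomain Ω) (R : ℝ) (hR : 0 < R)
    (hvol : volume Ω = volume (Metric.ball (0 : EuclideanSpace ℝ (Fin n)) R)) :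
    IsLeast (Steklov.nonzeroSteklovEigenvalues Ω) (Steklov.firstSteklovEigenvalue Ω) ∧
    Steklov.firstSteklovEigenvalue Ω ≤ 1 / R ∧
    (Steklov.firstSteklovEigenvalue Ω = 1 / R ↔
      ∃ c : EuclideanSpace ℝ (Fin n), Ω = Metric.ball c R) := by
  obtain ⟨hpos, h, -⟩ := hΩ.isLeast_firstSteklovEigenvalue hn
  obtain ⟨hle, heq⟩ := hΩ.firstSteklovEigenvalue_le hn hR hvol
  refine ⟨h, hle, heq, ?_⟩
  rintro ⟨c, rfl⟩
  exact le_antisymm hle (Steklov.one_div_le_of_isSteklovEigenvalue_ball hn hR hpos h.1.2)
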